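/- **Setting.** A (simple, not necessarily convex) polygon is a compact planar region bounded by a simple closed polygonal curve with at least $3$ edges. Let $K$ be a finite pure $2$-complex in $\mathbb{R}^2$, given by finitely many polygons, any two of which are disjoint or meet exactly in a common vertex or a common edge, and let its underlying space $|K|$ be connected. Let $\mathcal{C}^H$ be a finite collection of polygons (holes), and let the outside $O$ be the closure of $\mathbb{R}^2\setminus(|K|\cup|\mathcal{C}^H|)$. Assume: the holes are pairwise disjoint and disjoint from $O$; a polygon of $K$ and a hole are disjoint or meet exactly in one common vertex or one common edge; no two adjacent edges of a polygon of $K$ both lie in $O$. **Euler transformation.** Let $L$ be a $2$-complex, viewed abstractly as a set of polygons given by their edges. Each polygon $f$ of $L$ gets its own copy $v_f$ of each of its vertices $v$; on the side of a boundary edge (an edge in exactly one polygon of $L$) where there is a hole or the outside, the copy of $v$ is $v$ itself (holes and outside are not altered). The Euler transformation of $L$ consists of the following polygons. Class 1: for each polygon $f$, its copy on the vertices $v_f$. Class 2: for each edge $e=\{u,v\}$, the $4$-gon $\hat f_e$ whose edges are the two copies of $e$ on the two sides of $e$, the edge joining the two copies of $u$, and the edge joining the two copies of $v$. Class 3: for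 each vertex $v$, the polygon $\hat f_v$ on the copies of $v$, where the two copies of $v$ on the two sides of an edge at $v$ are joined; if the polygons at $v$ fall into several fans (classes of polygons connected through edges at $v$), there is one such polygon for each fan, and figures with fewer than three edges are not counted as polygons. The generalized Euler transformation of $L$ is the Euler transformation of the Euler transformation of $L$. **Combinatorial changes.** For each polygon $f$ of $K$ choose a set of edges of $f$ such that at least three edges of $f$ are not chosen. Let $\hat K$ be the complex obtained from the Euler transformation of $K$ by collapsing the copies of the chosen edges of $f$ in the Class 1 polygon $\hat f$ to points, for each $f$. (Edges that get the same end points become one edge, and polygons degenerating to an edge are discarded as polygons.) A Class 2 polygon $\hat f_e$ may thereby collapse to an edge $\hat e$. **Lemma.** Let $\hat k\subseteq\hat K$ be the subcomplex of all Class 3 polygons that contain some edge $\hat e$ to which a Class 2 polygon $\hat f_e$ has collapsed, and let $\hat k_j$ be its components. Let each component be decomposed in any way as $\hat k_j=\bigcup_i\tilde k_i$ into subcomplexes (sets of polygons), no two of which have an edge in common. Replace each $\tilde k_i$ by its generalized Euler transformation $\check k_i$, in which the unaltered boundary vertices are identified with the vertices of $\hat K$ that they are and all other vertices are new, and let $\bar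 k$ be the union of all the $\check k_i$. Then the $1$-skeleton of $(\hat K\smallsetminus\hat k)\cup\bar k$ is Eulerian: it is a finite-degree connected graph in which every vertex has even degree, and it has a closed walk that traverses each edge exactly once. -/

import Mathlib

/-! ### Polygons and polygonal complexes in the plane -/

/-- The Euclidean plane `ℝ²`. -/
abbrev Plane : Type := EuclideanSpace ℝ (Fin 2)

/-- A (closed, not necessarily convex) simple polygon in the plane. It is given by its boundary,
a simple closed polygonal curve with at least three edges, and by the compact region which that
curve bounds. By the Jordan curve theorem the region is determined by the curve: it is the only
compact set that is the closure of its interior and has the curve as its frontier. -/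
structure PlanePolygon where
  /-- number of vertices -/
  n : ℕ
  three_le : 3 ≤ n
  /-- cyclically ordered vertices -/
  poly : Polygon Plane n
  vertices_injective : Function.Injective poly.vertices
  /-- two different edges meet exactly in their common end points -/
  edges_meet : ∀ i j : Fin n, i ≠ j →
    poly.edgeSet ℝ i ∩ poly.edgeSet ℝ j =
      {poly i, poly (finRotate n i)} ∩ {poly j, poly (finRotate n j)}
  /-- the closed region bounded by the polygonal curve -/
  region : Set Plane
  isCompact_region : IsCompact region
  closure_interior_region : closure (interior region) = region
  frontier_region : frontier region = poly.boundary ℝ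

namespace PlanePolygon

/-- The vertices of a polygon. -/
def vertices (P : PlanePolygon) : Set Plane := Set.range P.poly.vertices

/-- The edges of a polygon, each recorded as the unordered pair of its end points. -/
def edges (P : PlanePolygon) : Set (Sym2 Plane) :=
  Set.range fun i : Fin P.n => s(P.poly i, P.poly (finRotate P.n i))

/-- The intersection of two (different) polygons is empty or a common face of both, i.e. a common
vertex or a common edge. -/
def MeetInFace (P Q : PlanePolygon) : Prop :=
  P.region ∩ Q.region = ∅ ∨
  (∃ v, v ∈ P.vertices ∧ v ∈ Q.vertices ∧ P.region ∩ Q.region = {v}) ∨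
  (∃ u v, s(u, v) ∈ P.edges ∧ s(u, v) ∈ Q.edges ∧ P.region ∩ Q.region = segment ℝ u v)

end PlanePolygon

/-- A finite pure polygonal complex in the plane, given by its polygons; its vertices and edges
are the vertices and edges of these polygons. -/
structure PlaneComplex where
  cells : Set PlanePolygon
  finite_cells : cells.Finite
  meetInFace : cells.Pairwise PlanePolygon.MeetInFace

/-- The underlying space of a collection of polygons. -/
def supportOf (C : Set PlanePolygon) : Set Plane := ⋃ P ∈ C, P.region

/-- The (unbounded) outside polygon belonging to the complex `K` and the holes `H`: the closed
region that is left over, so that `K`, `H` and the outside together cover the plane. -/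
def outsideOf (K : PlaneComplex) (H : Set PlanePolygon) : Set Plane :=
  closure (supportOf K.cells ∪ supportOf H)ᶜ

/-- `K` is an admissible input mesh for the Euler transformation, `H` being its collection of
polygonal holes. -/
structure IsInputMesh (K : PlaneComplex) (H : Set PlanePolygon) : Prop where
  connected : IsConnected (supportOf K.cells)
  finite_holes : H.Finite
  holes_disjoint : H.Pairwise fun h h' => Disjoint h.region h'.region
  holes_outside_disjoint : ∀ h ∈ H, Disjoint h.region (outsideOf K H)
  /-- a polygon of `K` and a hole intersect in at most one facet of both -/
  meet_holes : ∀ P ∈ K.cells, ∀ h ∈ H, P.MeetInFace h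
  /-- no two adjacent edges of a polygon of `K` belong to the outside -/
  adjacent_outside : ∀ P ∈ K.cells, ∀ i : Fin P.n,
    ¬ (P.poly.edgeSet ℝ i ⊆ outsideOf K H ∧
       P.poly.edgeSet ℝ (finRotate P.n i) ⊆ outsideOf K H)

/-! ### Abstract 2-complexes -/

/-- An abstract pure 2-complex with vertices in `V`: the set of its polygons, each polygon being
recorded as the set of its edges. -/
abbrev PolyComplex (V : Type*) : Type _ := Set (Set (Sym2 V))

/-- The abstract complex underlying a polygonal complex in the plane. -/
def PlaneComplex.toPolyComplex (K : PlaneComplex) : PolyComplex Plane :=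
  PlanePolygon.edges '' K.cells

namespace PolyComplex

variable {V : Type*}

/-- The edges of a complex. -/
def edges (K : PolyComplex V) : Set (Sym2 V) := ⋃₀ K

/-- The vertices of a polygon. -/
def polygonVertices (P : Set (Sym2 V)) : Set V := {v | ∃ e ∈ P, v ∈ e}

/-- The vertices of a complex. -/
def vertices (K : PolyComplex V) : Set V := {v | ∃ e ∈ K.edges, v ∈ e}

/-- The 1-skeleton of a complex, a graph on the vertices of the complex. -/
def skeleton (K : PolyComplex V) : SimpleGraph K.vertices :=
  (SimpleGraph.fromEdgeSet K.edges).induce K.vertices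

/-- The component of the polygon `P` in the complex `K`: all polygons of `K` that are reached from
`P` through a chain of polygons of `K` in which consecutive ones have a common vertex. -/
def component (K : PolyComplex V) (P : Set (Sym2 V)) : PolyComplex V :=
  {Q | Relation.ReflTransGen (fun P Q => P ∈ K ∧ Q ∈ K ∧
    (polygonVertices P ∩ polygonVertices Q).Nonempty) P Q}

/-- `pieces` is a decomposition of each component of `k` into subcomplexes, no two of which have
an edge in common. -/
structure IsEdgeDisjointDecomposition (k : PolyComplex V) (pieces : Set (PolyComplex V)) :
    Prop where
  sUnion_eq : ⋃₀ pieces = k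
  in_component : ∀ L ∈ pieces, ∃ P ∈ k, L ⊆ component k P
  edge_disjoint : pieces.Pairwise fun L M => Disjoint (edges L) (edges M)

/-! ### The Euler transformation -/

/-- The vertices of the Euler transformation: `(some f, v)` is the copy of the vertex `v` in the
duplicate of the polygon `f`, and `(none, v)` is the copy of `v` in the unaltered holes and
outside of the complex, i.e. the point `v` itself. -/
abbrev ETVertex (V : Type*) : Type _ := Option (Set (Sym2 V)) × V

/-- A boundary edge: it belongs to exactly one polygon of the complex, so that a hole or the
outside is on its other side. -/
def IsBoundaryEdge (K : PolyComplex V) (e : Sym2 V) : Prop := ∃! P, P ∈ K ∧ e ∈ P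

/-- What is on the sides of an edge: the polygons of `K` that contain it, together with `none`
(a hole or the outside) when it is a boundary edge. -/
def sides (K : PolyComplex V) (e : Sym2 V) : Set (Option (Set (Sym2 V))) :=
  {s | (∃ P ∈ K, e ∈ P ∧ s = some P) ∨ (IsBoundaryEdge K e ∧ s = none)}

/-- Class 1: the copy of the polygon `f`. -/
def copyPolygon (f : Set (Sym2 V)) : Set (Sym2 (ETVertex V)) :=
  Sym2.map (fun v => (some f, v)) '' f

/-- Class 2: the 4-gon of the edge `e`. Its edges are the two copies of `e` and, for each of the
two end points of `e`, the edge that joins its two copies. -/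
def edgePolygon (K : PolyComplex V) (e : Sym2 V) : Set (Sym2 (ETVertex V)) :=
  {a | ∃ u v, e = s(u, v) ∧
    ((∃ s ∈ sides K e, a = s((s, u), (s, v))) ∨
     (∃ s ∈ sides K e, ∃ t ∈ sides K e, s ≠ t ∧ a = s((s, v), (t, v))))}

/-- The polygons at the vertex `v` that are reached from `f` by passing through edges at `v`.
At a vertex which is not an articulation vertex these are all the polygons at `v`. -/
def fan (K : PolyComplex V) (v : V) (f : Set (Sym2 V)) : Set (Set (Sym2 V)) :=
  {g | Relation.ReflTransGen (fun P Q => P ∈ K ∧ Q ∈ K ∧ ∃ e, e ∈ P ∧ e ∈ Q ∧ v ∈ e) f g}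

/-- Class 3: the polygon generated by the vertex `v`; its vertices are the copies of `v`, and
copies on the two sides of an edge at `v` are joined. An articulation vertex generates one such
polygon for each of the fans of polygons around it. -/
def vertexPolygon (K : PolyComplex V) (v : V) (f : Set (Sym2 V)) : Set (Sym2 (ETVertex V)) :=
  {a | ∃ g ∈ fan K v f, ∃ e ∈ g, v ∈ e ∧
    ∃ s ∈ sides K e, ∃ t ∈ sides K e, s ≠ t ∧ a = s((s, v), (t, v))}

/-- The polygons of Class 3. If only a single polygon lies at a boundary vertex, then the figure
generated by this vertex has just one edge and is not a polygon. -/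
def class3 (K : PolyComplex V) : PolyComplex (ETVertex V) :=
  {Q | 3 ≤ Q.encard ∧ ∃ f ∈ K, ∃ v ∈ polygonVertices f, Q = vertexPolygon K v f}

/-- The Euler transformation of a 2-complex. -/
def eulerTransform (K : PolyComplex V) : PolyComplex (ETVertex V) :=
  copyPolygon '' K ∪ edgePolygon K '' K.edges ∪ class3 K

/-- The generalized Euler transformation: the Euler transformation applied twice. -/
def genEulerTransform (K : PolyComplex V) : PolyComplex (ETVertex (ETVertex V)) :=
  eulerTransform (eulerTransform K)

/-! ### Combinatorial changes -/

/-- A choice of combinatorial changes: in the copy of each polygon `f` of `K` the copies of the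
edges in `collapsed f` are collapsed to points; at least three edges are left. -/
structure CombinatorialChange (K : PolyComplex V) where
  collapsed : Set (Sym2 V) → Set (Sym2 V)
  subset : ∀ f ∈ K, collapsed f ⊆ f
  three_le : ∀ f ∈ K, 3 ≤ (f \ collapsed f).encard

namespace CombinatorialChange

variable {K : PolyComplex V} (c : CombinatorialChange K)

/-- The end points of a collapsed edge are to be identified. -/
def rel (x y : ETVertex V) : Prop :=
  ∃ f ∈ K, ∃ u v, s(u, v) ∈ c.collapsed f ∧ x = (some f, u) ∧ y = (some f, v)

/-- The vertices of the Euler transformation with combinatorial changes. -/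
abbrev Vertex : Type _ := Quot c.rel

/-- What becomes of a polygon when edges are collapsed: collapsed edges disappear, and edges that
get the same end points become one edge. -/
def image (P : Set (Sym2 (ETVertex V))) : Set (Sym2 c.Vertex) :=
  {a | a ∈ Sym2.map (Quot.mk c.rel) '' P ∧ ¬ a.IsDiag}

/-- The Euler transformation with combinatorial changes. Polygons that degenerate to an edge are
no longer polygons of it. -/
def eulerTransform : PolyComplex c.Vertex :=
  {Q | 3 ≤ Q.encard ∧ ∃ P ∈ K.eulerTransform, Q = c.image P}

/-- The edges to which Class 2 polygons are collapsed. -/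
def collapsedEdges : Set (Sym2 c.Vertex) :=
  {a | ∃ e ∈ K.edges, c.image (K.edgePolygon e) = {a}}

/-- The subcomplex of all Class 3 polygons that contain an edge to which a Class 2 polygon is
collapsed. -/
def affected : PolyComplex c.Vertex :=
  {Q | (∃ P ∈ K.class3, Q = c.image P) ∧ ∃ a ∈ c.collapsedEdges, a ∈ Q}

end CombinatorialChange

/-! ### Replacing subcomplexes by their generalized Euler transformations -/

/-- The vertices that are available after the replacement of subcomplexes `L`: the old vertices,
and new vertices belonging to `L`. -/
abbrev ReplVertex (V : Type*) : Type _ := V ⊕ (PolyComplex V × ETVertex (ETVertex V))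

open Classical in
/-- Places the generalized Euler transformation of `L` where `L` has been: the unaltered vertices
`(none, (none, w))` are the old vertices `w`, all others are new. -/
noncomputable def place (L : PolyComplex V) (x : ETVertex (ETVertex V)) : ReplVertex V :=
  if x.1 = none ∧ x.2.1 = none then Sum.inl x.2.2 else Sum.inr (L, x)

/-- The complex `(K ∖ k) ∪ k'`, where `k'` is the union of the generalized Euler transformations
of the subcomplexes in `pieces`. -/
noncomputable def replace (K k : PolyComplex V) (pieces : Set (PolyComplex V)) :
    PolyComplex (ReplVertex V) :=
  (fun P => Sym2.map Sum.inl '' P) '' (K \ k) ∪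
    ⋃ L ∈ pieces, (fun P => Sym2.map (place L) '' P) '' genEulerTransform L

end PolyComplex

open Classical in
/-- An Eulerian graph: it is connected, each vertex has (finite) even degree, and there is a closed
walk that traverses each edge exactly once. -/
def IsEulerianGraph {V : Type*} (G : SimpleGraph V) : Prop :=
  G.Connected ∧ (∀ v, (G.neighborSet v).Finite ∧ Even (G.neighborSet v).ncard) ∧
    ∃ (v : V) (p : G.Walk v v), p.IsEulerian

/-! Even degrees come from a count. At a copy `(s, v)` each edge of the complex that contains `v`
and has `s` as a side contributes exactly two edges of the Euler transformation: its own copy on the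
side `s`, and the edge across it to the copy of `v` on its other side. So all degrees are even as
soon as each edge has exactly two sides and different edges at a vertex have different pairs of
sides (`IsTwoSided.even_neighbors`). The second condition may fail in a subcomplex, where one
polygon can have two adjacent boundary edges. After one Euler transformation it holds
(`IsLocallyPlanar.isTwoSided_eulerTransform`), so the second transformation makes the new vertices
even. The hypothesis `IsLocallyPlanar` passes to subcomplexes, so it is enough to prove it for the
affected Class 3 polygons as a whole.

At an old vertex each boundary edge of a piece is kept and brings along one new edge, which together
is an even number. It remains to count the surviving edges that are not boundary edges of a piece
(`even_ncard_remaining`). These are copies of edges of `K` and edges of unaffected Class 3 polygons.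
Contracting some edges of a cycle leaves an even number of edge ends at each point, and the boundary
edges at a vertex of `K` are even in number, so the copies are even in number. Two Class 3 polygons
meet only along an edge to which a quadrangle has collapsed, so the unaffected ones are
edge-disjoint cycles and contribute two edges each.

For connectedness, polygons of the mesh that meet in a vertex have linked copies, if necessary
through the unaltered vertex on the side of a hole or the outside. An edge lost in the replacement
lies on an affected Class 3 polygon. No fan of affected polygons closes up around a vertex, since
all edges of some polygon of `K` would then be collapsed (`exists_boundary_fan`); hence each old
vertex stays attached to the transformed piece.

The geometry enters only through `PlaneComplex.isMesh`: near an inner point of an edge a cell covers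
exactly one of the two sides, and a fan of cells without boundary edge fills a neighbourhood of its
vertex. The closed walk is Euler's theorem for finite connected graphs with even degrees. -/

/-! ### Graph theory -/

namespace SimpleGraph

variable {V : Type*}

/-- A finite connected graph all of whose degrees are even has an Eulerian circuit. -/
theorem Connected.exists_isEulerian [Fintype V] [DecidableEq V] (G : SimpleGraph V)
    [DecidableRel G.Adj] (hc : G.Connected) (he : ∀ v, Even (G.degree v)) :
    ∃ (v : V) (p : G.Walk v v), p.IsEulerian := by
  have := hc.nonempty
  -- A longest trail uses every edge at its end point. If it were not closed, it would use an odd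
  -- number of edges there, against the even degree.
  obtain ⟨u, v, p, hp, hmax⟩ := Walk.exists_isTrail_forall_isTrail_length_le_length G
  have hclosed : u = v := by
    by_contra huv
    have hodd : ¬ Even (p.edges.countP fun e => v ∈ e) := by
      rw [hp.even_countP_edges_iff v]
      simp [huv]
    have hall : ∀ w (hw : G.Adj v w), s(v, w) ∈ p.edges := by
      intro w hw
      by_contra hnot
      have ht : (Walk.cons hw.symm p.reverse).IsTrail := by
        rw [Walk.isTrail_cons]
        refine ⟨(Walk.reverse_isTrail_iff p).2 hp, ?_⟩
        rw [Walk.edges_reverse, List.mem_reverse, Sym2.eq_swap]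
        exact hnot
      have := hmax _ _ _ ht
      simp at this
    apply hodd
    have hcount : p.edges.countP (fun e => v ∈ e) = G.degree v := by
      rw [List.countP_eq_length_filter, ← card_incidenceFinset_eq_degree,
        ← List.toFinset_card_of_nodup (hp.edges_nodup.filter _)]
      congr 1
      ext e
      simp only [List.mem_toFinset, List.mem_filter, decide_eq_true_eq, mem_incidenceFinset,
        incidenceSet, Set.mem_sep_iff]
      constructor
      · rintro ⟨h1, h2⟩
        exact ⟨p.edges_subset_edgeSet h1, h2⟩
      · rintro ⟨h1, h2⟩
        refine ⟨?_, h2⟩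
        obtain ⟨w, rfl⟩ := h2
        exact hall w h1
    rw [hcount]
    exact he v
  subst hclosed
  refine ⟨u, p, hp.isEulerian_of_forall_mem ?_⟩
  -- A closed trail can be rotated to start at any of its vertices, so an unused edge at such a
  -- vertex would give a longer trail.
  have hall : ∀ x ∈ p.support, ∀ y, G.Adj x y → s(x, y) ∈ p.edges := by
    intro x hx y hxy
    by_contra hnot
    have ht : (Walk.cons hxy.symm (p.rotate x hx)).IsTrail := by
      rw [Walk.isTrail_cons]
      refine ⟨hp.rotate hx, ?_⟩
      rw [(p.rotate_edges x hx).perm.mem_iff, Sym2.eq_swap]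
      exact hnot
    have := hmax _ _ _ ht
    have hlen : (p.rotate x hx).length = p.length := by
      rw [← Walk.length_edges, ← Walk.length_edges, (p.rotate_edges x hx).perm.length_eq]
    simp [hlen] at this
  have hsupp : ∀ x, x ∈ p.support := by
    intro x
    obtain ⟨q⟩ := hc.preconnected u x
    have : ∀ {a b : V} (q : G.Walk a b), a ∈ p.support → b ∈ p.support := by
      intro a b q
      induction q with
      | nil => exact id
      | cons h q ih => exact fun ha => ih (p.snd_mem_support_of_mem_edges (hall _ ha _ h))
    exact this q p.start_mem_support
  intro e
  induction e with
  | _ x y => exact fun h => hall x (hsupp x) y h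

/-- If in a finite component of a graph each vertex has degree at most `2`, then the deficiencies
from `2` add up to `0` or `2`: the component is a cycle or a path. -/
theorem ConnectedComponent.sum_deficiency {D : SimpleGraph V} (C : D.ConnectedComponent)
    (s : Finset V) (hs : ∀ x, x ∈ s ↔ x ∈ C.supp) (m : V → ℕ)
    (hm : ∀ x ∈ s, (D.neighborSet x).ncard + m x = 2) :
    ∑ x ∈ s, m x = 0 ∨ ∑ x ∈ s, m x = 2 := by
  classical
  have hsC : (s : Set V) = C.supp := by ext x; exact hs x
  have hfin : C.supp.Finite := hsC ▸ s.finite_toSet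
  have : Fintype C := hfin.fintype
  have hconn := C.connected_toSimpleGraph
  have hdeg : ∀ x : C, C.toSimpleGraph.degree x = (D.neighborSet x.1).ncard := by
    intro x
    rw [← card_neighborSet_eq_degree, ← Nat.card_eq_fintype_card, Nat.card_coe_set_eq,
      ← Set.ncard_image_of_injective _ Subtype.val_injective]
    congr 1
    ext y
    simp only [Set.mem_image, mem_neighborSet, Subtype.exists, exists_and_right, exists_eq_right]
    constructor
    · rintro ⟨hy, h⟩
      exact h
    · intro h
      exact ⟨C.mem_supp_of_adj_mem_supp x.2 h, h⟩
  have hsum := C.toSimpleGraph.sum_degrees_eq_twice_card_edges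
  -- The deficiencies add up to twice the number of vertices minus twice the number of edges. This
  -- is even, and connectedness bounds it by 2.
  have hle := hconn.card_vert_le_card_edgeSet_add_one
  rw [Nat.card_eq_fintype_card, Nat.card_eq_fintype_card, ← edgeFinset_card] at hle
  have htot : ∑ x : C, (C.toSimpleGraph.degree x + m x.1) = 2 * Fintype.card C := by
    rw [Finset.sum_congr rfl (fun x _ => (by rw [hdeg]; exact hm x.1 ((hs _).2 x.2) :
      C.toSimpleGraph.degree x + m x.1 = 2))]
    simp [mul_comm]
  have hms : ∑ x : C, m x.1 = ∑ x ∈ s, m x := by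
    rw [Finset.sum_subtype s hs m]
    rfl
  rw [Finset.sum_add_distrib, hsum, hms] at htot
  omega

end SimpleGraph

namespace PolyComplex

variable {V : Type*}

/-! ### Combinatorial conditions on complexes -/

/-- Any two vertices of the polygon are joined by a path of edges of the polygon. -/
def IsConnectedPolygon (P : Set (Sym2 V)) : Prop :=
  ∀ x ∈ polygonVertices P, ∀ y ∈ polygonVertices P,
    Relation.ReflTransGen (fun x y => s(x, y) ∈ P) x y

/-- A finite complex of closed polygons that is at most two-sided at each edge and in which
different polygons have no two adjacent edges in common. -/
structure IsLocallyPlanar (K : PolyComplex V) : Prop where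
  finite : K.Finite
  finite_polygon : ∀ P ∈ K, P.Finite
  not_isDiag : ∀ P ∈ K, ∀ e ∈ P, ¬ e.IsDiag
  two_edges : ∀ P ∈ K, ∀ v ∈ polygonVertices P, {e ∈ P | v ∈ e}.ncard = 2
  two_polygons : ∀ e, ∀ P ∈ K, ∀ Q ∈ K, ∀ R ∈ K, e ∈ P → e ∈ Q → e ∈ R → P = Q ∨ P = R ∨ Q = R
  share : ∀ P ∈ K, ∀ Q ∈ K, P ≠ Q → ∀ v, ∀ e ∈ P, e ∈ Q → v ∈ e → ∀ e' ∈ P, e' ∈ Q → v ∈ e' →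
    e = e'

/-- A finite complex in which each edge has exactly two sides, different for adjacent edges. -/
structure IsTwoSided (K : PolyComplex V) : Prop where
  finite_edges : K.edges.Finite
  not_isDiag : ∀ e ∈ K.edges, ¬ e.IsDiag
  two_sides : ∀ e ∈ K.edges, ∃ s t, s ≠ t ∧ sides K e = {s, t}
  separated : ∀ v, ∀ e ∈ K.edges, v ∈ e → ∀ e' ∈ K.edges, v ∈ e' → sides K e = sides K e' → e = e'

/-- The combinatorial properties of an admissible input mesh. -/
structure IsMesh (K : PolyComplex V) : Prop extends IsLocallyPlanar K where
  connected_polygon : ∀ P ∈ K, IsConnectedPolygon P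
  share_one : ∀ P ∈ K, ∀ Q ∈ K, P ≠ Q → ∀ e ∈ P, e ∈ Q → ∀ e' ∈ P, e' ∈ Q → e = e'
  boundary_separated : ∀ P ∈ K, ∀ v, ∀ e ∈ P, v ∈ e → IsBoundaryEdge K e →
    ∀ e' ∈ P, v ∈ e' → IsBoundaryEdge K e' → e = e'
  fan_boundary : ∀ P ∈ K, ∀ Q ∈ K, ∀ v ∈ polygonVertices P, v ∈ polygonVertices Q →
    Q ∉ fan K v P → ∃ R ∈ fan K v P, ∃ e ∈ R, v ∈ e ∧ IsBoundaryEdge K e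
  chain : ∀ P ∈ K, ∀ Q ∈ K, Relation.ReflTransGen (fun P Q => P ∈ K ∧ Q ∈ K ∧
    (polygonVertices P ∩ polygonVertices Q).Nonempty) P Q
  nonempty : K.Nonempty

end PolyComplex

/-! ### Geometry of plane polygons -/

namespace PlanePolygon

open Filter Topology

variable (P : PlanePolygon)

lemma finRotate_ne (i : Fin P.n) : finRotate P.n i ≠ i := by
  have h := support_finRotate_of_le (n := P.n) (by have := P.three_le; omega)
  exact Equiv.Perm.mem_support.1 (h ▸ Finset.mem_univ i)

/-- Three vertices are needed here: with two, both edges would be the same unordered pair, and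
`edge_injective` would fail. -/
lemma finRotate_finRotate_ne (i : Fin P.n) : finRotate P.n (finRotate P.n i) ≠ i := by
  have h3 := P.three_le
  have := i.neZero
  rw [finRotate_apply, finRotate_apply]
  intro h
  have hv := congrArg Fin.val h
  have h1 : ((1 : Fin P.n) : ℕ) = 1 := by
    rw [Fin.val_one', Nat.mod_eq_of_lt (by omega)]
  rw [Fin.val_add, Fin.val_add, h1] at hv
  have hi := i.2
  rcases Nat.lt_or_ge (i.1 + 1) P.n with h2 | h2
  · rw [Nat.mod_eq_of_lt h2] at hv
    rcases Nat.lt_or_ge (i.1 + 1 + 1) P.n with h4 | h4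
    · rw [Nat.mod_eq_of_lt h4] at hv; omega
    · have : i.1 + 1 + 1 = P.n := by omega
      rw [this, Nat.mod_self] at hv; omega
  · have : i.1 + 1 = P.n := by omega
    rw [this, Nat.mod_self, Nat.mod_eq_of_lt (by omega)] at hv; omega

/-- The edge with index `i`. -/
def edge (i : Fin P.n) : Sym2 Plane := s(P.poly i, P.poly (finRotate P.n i))

lemma edge_mem (i : Fin P.n) : P.edge i ∈ P.edges := ⟨i, rfl⟩

lemma poly_ne {i j : Fin P.n} (h : i ≠ j) : P.poly i ≠ P.poly j := P.vertices_injective.ne h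

lemma edge_injective : Function.Injective P.edge := by
  intro i j h
  rcases Sym2.eq_iff.1 h with ⟨h1, -⟩ | ⟨h1, h2⟩
  · exact P.vertices_injective h1
  · have h1 := P.vertices_injective h1
    have h2 := P.vertices_injective h2
    rw [h1] at h2
    exact absurd h2 (P.finRotate_finRotate_ne j)

lemma not_isDiag {e : Sym2 Plane} (he : e ∈ P.edges) : ¬ e.IsDiag := by
  obtain ⟨i, rfl⟩ := he
  simpa using P.poly_ne (P.finRotate_ne i).symm

lemma poly_mem_edge_iff (i j : Fin P.n) : P.poly i ∈ P.edge j ↔ j = i ∨ finRotate P.n j = i := by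
  rw [edge, Sym2.mem_iff, P.vertices_injective.eq_iff, P.vertices_injective.eq_iff]
  tauto

lemma polygonVertices_edges : PolyComplex.polygonVertices P.edges = P.vertices := by
  ext v
  constructor
  · rintro ⟨e, ⟨i, rfl⟩, hv⟩
    rcases Sym2.mem_iff.1 hv with rfl | rfl
    exacts [⟨i, rfl⟩, ⟨_, rfl⟩]
  · rintro ⟨i, rfl⟩
    exact ⟨P.edge i, P.edge_mem i, Sym2.mem_mk_left _ _⟩

lemma two_edges {v : Plane} (hv : v ∈ P.vertices) : {e ∈ P.edges | v ∈ e}.ncard = 2 := by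
  obtain ⟨i, rfl⟩ := hv
  obtain ⟨j, hj⟩ := (finRotate P.n).surjective i
  have hij : i ≠ j := by
    rintro rfl
    exact P.finRotate_ne _ hj
  have : {e ∈ P.edges | P.poly i ∈ e} = {P.edge i, P.edge j} := by
    ext e
    simp only [Set.mem_ofPred_eq, Set.mem_insert_iff, Set.mem_singleton_iff]
    constructor
    · rintro ⟨⟨k, rfl⟩, hk⟩
      rcases (P.poly_mem_edge_iff i k).1 hk with rfl | h
      · exact Or.inl rfl
      · rw [← hj] at h
        exact Or.inr (by rw [(finRotate P.n).injective h]; rfl)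
    · rintro (rfl | rfl)
      · exact ⟨P.edge_mem i, (P.poly_mem_edge_iff i i).2 (Or.inl rfl)⟩
      · exact ⟨P.edge_mem j, (P.poly_mem_edge_iff i j).2 (Or.inr hj)⟩
  rw [this, Set.ncard_pair (P.edge_injective.ne hij)]

lemma finite_edges : P.edges.Finite := Set.finite_range _

lemma sameCycle (i j : Fin P.n) : (finRotate P.n).SameCycle i j :=
  (isCycle_finRotate_of_le (by have := P.three_le; omega)).sameCycle
    (P.finRotate_ne i) (P.finRotate_ne j)

lemma isConnectedPolygon : PolyComplex.IsConnectedPolygon P.edges := by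
  rw [PolyComplex.IsConnectedPolygon, polygonVertices_edges]
  rintro _ ⟨i, rfl⟩ _ ⟨j, rfl⟩
  obtain ⟨k, hk⟩ := (P.sameCycle i j).exists_nat_pow_eq
  subst hk
  induction k with
  | zero => exact Relation.ReflTransGen.refl
  | succ k ih =>
    refine ih.tail ⟨((finRotate P.n) ^ k) i, ?_⟩
    rw [pow_succ']
    rfl

lemma edgeSet_eq (i : Fin P.n) :
    P.poly.edgeSet ℝ i = segment ℝ (P.poly i) (P.poly (finRotate P.n i)) :=
  affineSegment_eq_segment _ _ _

variable {P}

lemma exists_edge {a b : Plane} (h : s(a, b) ∈ P.edges) :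
    ∃ i, P.edge i = s(a, b) ∧ P.poly.edgeSet ℝ i = segment ℝ a b ∧
      ({P.poly i, P.poly (finRotate P.n i)} : Set Plane) = {a, b} := by
  obtain ⟨i, hi⟩ := h
  refine ⟨i, hi, ?_⟩
  rw [edgeSet_eq]
  rcases Sym2.eq_iff.1 hi with ⟨h1, h2⟩ | ⟨h1, h2⟩
  · rw [h1, h2]; exact ⟨rfl, rfl⟩
  · rw [h1, h2]; exact ⟨segment_symm _ _ _, Set.pair_comm _ _⟩

lemma segment_inter_segment {a b c d : Plane} (h : s(a, b) ∈ P.edges) (h' : s(c, d) ∈ P.edges)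
    (hne : s(a, b) ≠ s(c, d)) : segment ℝ a b ∩ segment ℝ c d = {a, b} ∩ {c, d} := by
  obtain ⟨i, hi, hi1, hi2⟩ := exists_edge h
  obtain ⟨j, hj, hj1, hj2⟩ := exists_edge h'
  rw [← hi1, ← hi2, ← hj1, ← hj2]
  refine P.edges_meet i j ?_
  rintro rfl
  exact hne (hi.symm.trans hj)

lemma ne_of_mem_edges {a b : Plane} (h : s(a, b) ∈ P.edges) : a ≠ b := by
  simpa using P.not_isDiag h

lemma ne_of_mem_openSegment {a b x : Plane} (hab : a ≠ b) (hx : x ∈ openSegment ℝ a b) :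
    x ≠ a ∧ x ≠ b := by
  constructor
  · rintro rfl
    exact hab ((left_mem_openSegment_iff).1 hx)
  · rintro rfl
    exact hab ((right_mem_openSegment_iff).1 hx)

lemma eq_of_mem_openSegment {a b c d x : Plane} (h : s(a, b) ∈ P.edges) (h' : s(c, d) ∈ P.edges)
    (hx : x ∈ openSegment ℝ a b) (hx' : x ∈ segment ℝ c d) : s(a, b) = s(c, d) := by
  by_contra hne
  have : x ∈ ({a, b} : Set Plane) ∩ {c, d} := by
    rw [← segment_inter_segment h h' hne]
    exact ⟨openSegment_subset_segment _ _ _ hx, hx'⟩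
  have h2 := ne_of_mem_openSegment (ne_of_mem_edges h) hx
  rcases this.1 with h | h
  exacts [h2.1 h, h2.2 h]

lemma notMem_vertices {a b x : Plane} (h : s(a, b) ∈ P.edges) (hx : x ∈ openSegment ℝ a b) :
    x ∉ P.vertices := by
  rintro ⟨i, rfl⟩
  have := eq_of_mem_openSegment h (P.edge_mem i) hx (left_mem_segment _ _ _)
  have h3 : P.poly i ∈ s(a, b) := this ▸ Sym2.mem_mk_left _ _
  have h2 := ne_of_mem_openSegment (ne_of_mem_edges h) hx
  rcases Sym2.mem_iff.1 h3 with h | h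
  exacts [h2.1 h, h2.2 h]

lemma isClosed_region : IsClosed P.region := P.isCompact_region.isClosed

lemma segment_subset_frontier {a b : Plane} (h : s(a, b) ∈ P.edges) :
    segment ℝ a b ⊆ frontier P.region := by
  obtain ⟨i, -, hi, -⟩ := exists_edge h
  rw [P.frontier_region, ← hi]
  exact Set.subset_iUnion _ i

lemma segment_subset_region {a b : Plane} (h : s(a, b) ∈ P.edges) :
    segment ℝ a b ⊆ P.region :=
  (segment_subset_frontier h).trans P.isClosed_region.frontier_subset

lemma vertices_subset_region : P.vertices ⊆ P.region := by
  rintro _ ⟨i, rfl⟩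
  exact segment_subset_region (P.edge_mem i) (left_mem_segment _ _ _)

lemma exists_mem_openSegment (a b : Plane) : (openSegment ℝ a b).Nonempty :=
  ⟨_, midpoint_mem_openSegment a b⟩

lemma vertices_nonempty : P.vertices.Nonempty := ⟨_, ⟨⟨0, by have := P.three_le; omega⟩, rfl⟩⟩

/-- A nonzero linear form on the plane that is constant on the line through `a` and `b`. -/
lemma exists_linearForm {a b : Plane} (hab : a ≠ b) :
    ∃ l : Plane →L[ℝ] ℝ, l ≠ 0 ∧ l b = l a := by
  refine ⟨(b 0 - a 0) • EuclideanSpace.proj (1 : Fin 2) -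
    (b 1 - a 1) • EuclideanSpace.proj (0 : Fin 2), ?_, ?_⟩
  · intro h
    apply hab
    have h1 := congrArg (fun l : Plane →L[ℝ] ℝ => l (EuclideanSpace.single 1 1)) h
    have h0 := congrArg (fun l : Plane →L[ℝ] ℝ => l (EuclideanSpace.single 0 1)) h
    simp at h0 h1
    ext i
    fin_cases i
    · simp only [Fin.zero_eta]; linarith
    · simp only [Fin.mk_one]; linarith
  · simp
    ring

lemma eq_of_mem_segment {l : Plane →L[ℝ] ℝ} {a b x : Plane} (h : l b = l a)
    (hx : x ∈ segment ℝ a b) : l x = l a := by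
  obtain ⟨s, t, -, -, hst, rfl⟩ := hx
  simp only [map_add, map_smul, smul_eq_mul, h]
  rw [← add_mul, hst, one_mul]

/-- Near each point of a level line of `l ≠ 0` there are points with larger values. -/
lemma frequently_lt {l : Plane →L[ℝ] ℝ} (hl : l ≠ 0) (x : Plane) :
    ∃ᶠ y in 𝓝 x, l x < l y := by
  obtain ⟨d, hd⟩ : ∃ d, 0 < l d := by
    obtain ⟨d, hd⟩ : ∃ d, l d ≠ 0 := by
      by_contra! h
      exact hl (ContinuousLinearMap.ext h)
    rcases lt_or_gt_of_ne hd with h | h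
    · exact ⟨-d, by simpa using h⟩
    · exact ⟨d, h⟩
  have ht : Tendsto (fun t : ℝ => x + t • d) (𝓝[>] 0) (𝓝 x) := by
    have : Tendsto (fun t : ℝ => x + t • d) (𝓝 0) (𝓝 (x + (0 : ℝ) • d)) :=
      Continuous.tendsto (by fun_prop) 0
    rw [zero_smul, add_zero] at this
    exact this.mono_left nhdsWithin_le_nhds
  refine ht.frequently (Eventually.frequently ?_)
  filter_upwards [self_mem_nhdsWithin] with t ht
  have : 0 < t * l d := mul_pos ht hd
  simpa using this

/-- A linear form constant on the segment takes larger values arbitrarily near each of its points.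
-/
lemma interior_segment_eq_empty (a b : Plane) : interior (segment ℝ a b) = ∅ := by
  rcases eq_or_ne a b with rfl | hab
  · simp
  · obtain ⟨l, hl, h⟩ := exists_linearForm hab
    rw [Set.eq_empty_iff_forall_notMem]
    intro x hx
    have h1 := mem_interior_iff_mem_nhds.1 hx
    obtain ⟨y, hy, hy'⟩ := ((frequently_lt hl x).and_eventually h1).exists
    rw [eq_of_mem_segment h hy', eq_of_mem_segment h (mem_of_mem_nhds h1)] at hy
    exact lt_irrefl _ hy

lemma MeetInFace.interior_inter {P Q : PlanePolygon} (h : P.MeetInFace Q) :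
    interior (P.region ∩ Q.region) = ∅ := by
  rcases h with h | ⟨v, -, -, h⟩ | ⟨u, v, -, -, h⟩
  · rw [h, interior_empty]
  · rw [h, interior_singleton]
  · rw [h, interior_segment_eq_empty]

/-- An inner point of an edge is neither a vertex nor a point of another edge of the same polygon,
so the only common face that can contain it is this edge. -/
lemma MeetInFace.mem_edges {P Q : PlanePolygon} (h : P.MeetInFace Q) {a b x : Plane}
    (hab : s(a, b) ∈ P.edges) (hx : x ∈ openSegment ℝ a b) (hxQ : x ∈ Q.region) :
    s(a, b) ∈ Q.edges := by
  have hm : x ∈ P.region ∩ Q.region :=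
    ⟨segment_subset_region hab (openSegment_subset_segment _ _ _ hx), hxQ⟩
  rcases h with h | ⟨v, hv, -, h⟩ | ⟨u, v, h1, h2, h⟩
  · simp [h] at hm
  · rw [h] at hm
    rw [Set.mem_singleton_iff.1 hm] at hx
    exact absurd hv (notMem_vertices hab hx)
  · rw [h] at hm
    rwa [eq_of_mem_openSegment hab h1 hx hm]

lemma MeetInFace.eq_of_subset {P Q : PlanePolygon} (h : P.MeetInFace Q) {a b c d : Plane}
    (hab : s(a, b) ∈ P.edges) (hcd : s(c, d) ∈ P.edges) (hx : segment ℝ a b ⊆ Q.region)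
    (hy : segment ℝ c d ⊆ Q.region) : s(a, b) = s(c, d) := by
  have hm : ∀ {a b}, s(a, b) ∈ P.edges → segment ℝ a b ⊆ Q.region →
      segment ℝ a b ⊆ P.region ∩ Q.region :=
    fun h h' => Set.subset_inter (segment_subset_region h) h'
  obtain ⟨x, hx'⟩ := exists_mem_openSegment a b
  obtain ⟨y, hy'⟩ := exists_mem_openSegment c d
  have hxm := hm hab hx (openSegment_subset_segment _ _ _ hx')
  have hym := hm hcd hy (openSegment_subset_segment _ _ _ hy')
  rcases h with h | ⟨v, hv, -, h⟩ | ⟨u, v, h1, h2, h⟩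
  · simp [h] at hxm
  · rw [h] at hxm
    rw [Set.mem_singleton_iff.1 hxm] at hx'
    exact absurd hv (notMem_vertices hab hx')
  · rw [h] at hxm hym
    rw [eq_of_mem_openSegment hab h1 hx' hxm, eq_of_mem_openSegment hcd h1 hy' hym]

/-- Near `x`, the polygon covers the side `c < l` of the line `l = c`, and nothing of the other. -/
def CoversSide (P : PlanePolygon) (l : Plane →L[ℝ] ℝ) (x : Plane) : Prop :=
  ∀ᶠ y in 𝓝 x, (l x < l y → y ∈ P.region) ∧ (l y < l x → y ∉ P.region)

/-- A local substitute for the separation of the plane by the curve. A small disc about an inner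
point of an edge meets the frontier only in the line of the edge, so each open half disc lies wholly
inside or wholly outside the region; the two cases in which both do the same are excluded. -/
lemma coversSide_or {a b x : Plane} (hab : s(a, b) ∈ P.edges) (hx : x ∈ openSegment ℝ a b)
    {l : Plane →L[ℝ] ℝ} (hl : l ≠ 0) (h : l b = l a) :
    P.CoversSide l x ∨ P.CoversSide (-l) x := by
  have hxs := openSegment_subset_segment _ _ _ hx
  have hlx : l x = l a := eq_of_mem_segment h hxs
  have hother : ∀ᶠ y in 𝓝 x, ∀ i, P.edge i ≠ s(a, b) → y ∉ P.poly.edgeSet ℝ i := by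
    rw [eventually_all]
    intro i
    by_cases hi : P.edge i = s(a, b)
    · exact Eventually.of_forall fun y hy => absurd hi hy
    · have hcl : IsClosed (P.poly.edgeSet ℝ i) := by
        rw [edgeSet_eq, ← convexHull_pair]
        exact ((Set.toFinite _).isCompact_convexHull ℝ).isClosed
      have hxi : x ∉ P.poly.edgeSet ℝ i := fun hxi =>
        hi (eq_of_mem_openSegment hab (P.edge_mem i) hx (P.edgeSet_eq i ▸ hxi)).symm
      filter_upwards [hcl.isOpen_compl.mem_nhds hxi] with y hy _ using hy
  obtain ⟨ε, hε, hball⟩ := Metric.eventually_nhds_iff_ball.1 hother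
  have hfr : ∀ y ∈ Metric.ball x ε, l y ≠ l x → y ∉ frontier P.region := by
    intro y hy hly hyf
    rw [P.frontier_region] at hyf
    obtain ⟨i, hi⟩ := Set.mem_iUnion.1 hyf
    by_cases hi' : P.edge i = s(a, b)
    · obtain ⟨j, hj, hj', -⟩ := exists_edge hab
      have hij := P.edge_injective (hi'.trans hj.symm)
      rw [hij, hj'] at hi
      exact hly ((eq_of_mem_segment h hi).trans hlx.symm)
    · exact hball y hy i hi' hi
  -- A convex set that avoids the frontier cannot meet both the interior and the complement.
  have hhalf : ∀ D : Set Plane, Convex ℝ D → D ⊆ Metric.ball x ε → (∀ y ∈ D, l y ≠ l x) →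
      D ⊆ interior P.region ∨ D ⊆ P.regionᶜ := by
    intro D hD hDb hDl
    refine hD.isPreconnected.subset_or_subset isOpen_interior P.isClosed_region.isOpen_compl ?_ ?_
    · exact disjoint_compl_right.mono_left interior_subset
    · intro y hy
      have := hfr y (hDb hy) (hDl y hy)
      by_cases hyP : y ∈ P.region
      · left
        by_contra hyi
        exact this (P.isClosed_region.frontier_eq ▸ ⟨hyP, hyi⟩)
      · exact Or.inr hyP
  have hlin : IsLinearMap ℝ l := ⟨map_add l, map_smul l⟩
  have hp := hhalf (Metric.ball x ε ∩ {y | l x < l y})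
    ((convex_ball x ε).inter (convex_halfSpace_gt hlin _)) Set.inter_subset_left
    (fun y hy => ne_of_gt hy.2)
  have hn := hhalf (Metric.ball x ε ∩ {y | l y < l x})
    ((convex_ball x ε).inter (convex_halfSpace_lt hlin _)) Set.inter_subset_left
    (fun y hy => ne_of_lt hy.2)
  have hnhds : Metric.ball x ε ∈ 𝓝 x := Metric.ball_mem_nhds x hε
  have hneg : (-l) ≠ 0 := neg_ne_zero.2 hl
  rcases hp with hp | hp <;> rcases hn with hn | hn
  -- Both half discs inside: the points of the line in the disc are limits of points of the closed
  -- region, so `x` would be an interior point and not on the frontier.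
  · exfalso
    have hxf := segment_subset_frontier hab hxs
    rw [P.isClosed_region.frontier_eq] at hxf
    apply hxf.2
    rw [mem_interior_iff_mem_nhds]
    filter_upwards [Metric.isOpen_ball.mem_nhds (Metric.mem_ball_self hε)] with y hy
    by_contra hyP
    have hopen : Metric.ball x ε ∩ P.regionᶜ ∈ 𝓝 y :=
      (Metric.isOpen_ball.inter P.isClosed_region.isOpen_compl).mem_nhds ⟨hy, hyP⟩
    obtain ⟨z, hz, hzm⟩ := ((frequently_lt hl y).and_eventually hopen).exists
    have hyl : l y = l x := by
      rcases lt_trichotomy (l y) (l x) with h1 | h1 | h1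
      · exact absurd (interior_subset (hn ⟨hy, h1⟩)) hyP
      · exact h1
      · exact absurd (interior_subset (hp ⟨hy, h1⟩)) hyP
    exact hzm.2 (interior_subset (hp ⟨hzm.1, hyl ▸ hz⟩))
  · left
    filter_upwards [hnhds] with y hy
    exact ⟨fun h1 => interior_subset (hp ⟨hy, h1⟩), fun h1 => hn ⟨hy, h1⟩⟩
  · right
    filter_upwards [hnhds] with y hy
    refine ⟨fun h1 => interior_subset (hn ⟨hy, ?_⟩), fun h1 => hp ⟨hy, ?_⟩⟩
    · simpa using h1
    · simpa using h1
  -- Both half discs outside: the region is the closure of its interior, so there is an interior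
  -- point in the disc, and near it a point of the region off the line.
  · exfalso
    have hxP := segment_subset_region hab hxs
    rw [← P.closure_interior_region] at hxP
    obtain ⟨y, hyb, hyi⟩ := mem_closure_iff_nhds.1 hxP _ hnhds
    have hopen : Metric.ball x ε ∩ interior P.region ∈ 𝓝 y :=
      (Metric.isOpen_ball.inter isOpen_interior).mem_nhds ⟨hyb, hyi⟩
    by_cases hyl : l y < l x
    · exact hn ⟨hyb, hyl⟩ (interior_subset hyi)
    · obtain ⟨z, hz, hzm⟩ := ((frequently_lt hl y).and_eventually hopen).exists
      exact hp ⟨hzm.1, lt_of_le_of_lt (not_lt.1 hyl) hz⟩ (interior_subset hzm.2)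

end PlanePolygon

/-! ### Plane complexes are combinatorial meshes -/

namespace PlaneComplex

open Filter Topology

open PlanePolygon PolyComplex

variable {K : PlaneComplex} {P Q R : PlanePolygon}

lemma eq_of_mem_interior (hP : P ∈ K.cells) (hQ : Q ∈ K.cells) {x : Plane}
    (hx : x ∈ interior (P.region ∩ Q.region)) : P = Q := by
  by_contra hne
  rw [(K.meetInFace hP hQ hne).interior_inter] at hx
  exact hx

lemma share_one (hP : P ∈ K.cells) (hQ : Q ∈ K.cells) (hne : P ≠ Q) {e e' : Sym2 Plane}
    (he : e ∈ P.edges) (heQ : e ∈ Q.edges) (he' : e' ∈ P.edges) (heQ' : e' ∈ Q.edges) :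
    e = e' := by
  induction e with | _ a b
  induction e' with | _ c d
  exact (K.meetInFace hP hQ hne).eq_of_subset he he' (segment_subset_region heQ)
    (segment_subset_region heQ')

/-- Passing to edge sets loses no cell: different cells with equal edge sets would share both edges
at a vertex, more than a common face allows. -/
lemma edges_injOn : Set.InjOn PlanePolygon.edges K.cells := by
  intro P hP Q hQ h
  by_contra hne
  obtain ⟨v, hv⟩ := P.vertices_nonempty
  obtain ⟨e, e', hee, h2⟩ := Set.ncard_eq_two.1 (P.two_edges hv)
  have he : e ∈ {e ∈ P.edges | v ∈ e} := h2 ▸ Set.mem_insert _ _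
  have he' : e' ∈ {e ∈ P.edges | v ∈ e} := h2 ▸ Set.mem_insert_of_mem _ rfl
  exact hee (share_one hP hQ hne he.1 (h ▸ he.1) he'.1 (h ▸ he'.1))

/-- Two cells on the same side of the line overlap in an open set, while different cells meet in a
set with empty interior. -/
lemma eq_of_coversSide (hP : P ∈ K.cells) (hQ : Q ∈ K.cells) {l : Plane →L[ℝ] ℝ} (hl : l ≠ 0)
    {x : Plane} (h : P.CoversSide l x) (h' : Q.CoversSide l x) : P = Q := by
  have hev : ∀ᶠ y in 𝓝 x, l x < l y → y ∈ P.region ∩ Q.region := by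
    filter_upwards [h, h'] with y h1 h2 h3 using ⟨h1.1 h3, h2.1 h3⟩
  obtain ⟨y, hy, hy'⟩ := ((frequently_lt hl x).and_eventually hev.eventually_nhds).exists
  refine eq_of_mem_interior hP hQ (x := y) (mem_interior_iff_mem_nhds.2 ?_)
  filter_upwards [hy', (isOpen_lt continuous_const l.continuous).mem_nhds hy] with z h1 h2
    using h1 h2

lemma mem_interior_union {l : Plane →L[ℝ] ℝ} (hl : l ≠ 0)
    {x : Plane} (h : P.CoversSide l x) (h' : Q.CoversSide (-l) x) :
    x ∈ interior (P.region ∪ Q.region) := by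
  rw [mem_interior_iff_mem_nhds]
  have hev : ∀ᶠ y in 𝓝 x, l y ≠ l x → y ∈ P.region ∪ Q.region := by
    filter_upwards [h, h'] with y h1 h2 h3
    rcases lt_or_gt_of_ne h3 with h4 | h4
    · exact Or.inr (h2.1 (by simpa using h4))
    · exact Or.inl (h1.1 h4)
  filter_upwards [hev.eventually_nhds] with y hy
  by_contra hyn
  have hopen := (P.isClosed_region.union Q.isClosed_region).isOpen_compl.mem_nhds hyn
  obtain ⟨z, hz, hz1, hz2⟩ := ((frequently_lt hl y).and_eventually (hy.and hopen)).exists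
  have hzx : l z = l x := by
    by_contra h
    exact hz2 (hz1 h)
  have hyx : l y = l x := by
    by_contra h
    exact hyn (hy.self_of_nhds h)
  rw [hzx, hyx] at hz
  exact lt_irrefl _ hz

/-- Pigeonhole: among three cells at an edge, two cover the same side of it. -/
lemma two_polygons {e : Sym2 Plane} (hP : P ∈ K.cells) (hQ : Q ∈ K.cells) (hR : R ∈ K.cells)
    (heP : e ∈ P.edges) (heQ : e ∈ Q.edges) (heR : e ∈ R.edges) : P = Q ∨ P = R ∨ Q = R := by
  induction e with | _ a b
  obtain ⟨l, hl, h⟩ := exists_linearForm (ne_of_mem_edges heP)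
  obtain ⟨x, hx⟩ := exists_mem_openSegment a b
  have hneg : (-l) ≠ 0 := neg_ne_zero.2 hl
  rcases coversSide_or heP hx hl h with h1 | h1 <;>
  rcases coversSide_or heQ hx hl h with h2 | h2 <;>
  rcases coversSide_or heR hx hl h with h3 | h3 <;>
  first
  | exact Or.inl (eq_of_coversSide hP hQ hl h1 h2)
  | exact Or.inl (eq_of_coversSide hP hQ hneg h1 h2)
  | exact Or.inr (Or.inl (eq_of_coversSide hP hR hl h1 h3))
  | exact Or.inr (Or.inl (eq_of_coversSide hP hR hneg h1 h3))
  | exact Or.inr (Or.inr (eq_of_coversSide hQ hR hl h2 h3))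
  | exact Or.inr (Or.inr (eq_of_coversSide hQ hR hneg h2 h3))

/-- The union of two cells with a common edge is a neighbourhood of each inner point of it. -/
lemma mem_interior_union_of_mem_edges (hP : P ∈ K.cells) (hQ : Q ∈ K.cells) (hne : P ≠ Q)
    {a b x : Plane} (heP : s(a, b) ∈ P.edges) (heQ : s(a, b) ∈ Q.edges)
    (hx : x ∈ openSegment ℝ a b) : x ∈ interior (P.region ∪ Q.region) := by
  obtain ⟨l, hl, h⟩ := exists_linearForm (ne_of_mem_edges heP)
  have hneg : (-l) ≠ 0 := neg_ne_zero.2 hl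
  rcases coversSide_or heP hx hl h with h1 | h1 <;>
  rcases coversSide_or heQ hx hl h with h2 | h2
  · exact absurd (eq_of_coversSide hP hQ hl h1 h2) hne
  · exact mem_interior_union hl h1 h2
  · rw [Set.union_comm]
    exact mem_interior_union hl h2 h1
  · exact absurd (eq_of_coversSide hP hQ hneg h1 h2) hne

lemma isClosed_support {C : Set PlanePolygon} (hC : C.Finite) : IsClosed (supportOf C) :=
  hC.isClosed_biUnion fun P _ => P.isClosed_region

lemma mem_supportOf {C : Set PlanePolygon} {x : Plane} :
    x ∈ supportOf C ↔ ∃ P ∈ C, x ∈ P.region := by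
  simp [supportOf]

/-- An edge that lies in a single cell of the mesh and in no hole belongs to the outside. -/
lemma segment_subset_outside {H : Set PlanePolygon} (hK : IsInputMesh K H) (hP : P ∈ K.cells)
    {a b : Plane} (he : s(a, b) ∈ P.edges) (hb : ∀ Q ∈ K.cells, s(a, b) ∈ Q.edges → Q = P)
    (hH : ∀ h ∈ H, s(a, b) ∉ h.edges) : segment ℝ a b ⊆ outsideOf K H := by
  have hopen : openSegment ℝ a b ⊆ outsideOf K H := by
    intro x hx
    obtain ⟨l, hl, h⟩ := exists_linearForm (ne_of_mem_edges he)
    have hneg : (-l) ≠ 0 := neg_ne_zero.2 hl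
    have hcells : ∀ᶠ y in 𝓝 x, y ∉ supportOf (K.cells \ {P}) := by
      refine (isClosed_support (K.finite_cells.subset Set.sdiff_subset)).isOpen_compl.mem_nhds ?_
      intro hxs
      obtain ⟨Q, ⟨hQ, hQP⟩, hxQ⟩ := mem_supportOf.1 hxs
      exact hQP (hb Q hQ ((K.meetInFace hP hQ (Ne.symm hQP)).mem_edges he hx hxQ))
    have hholes : ∀ᶠ y in 𝓝 x, y ∉ supportOf H := by
      refine (isClosed_support hK.finite_holes).isOpen_compl.mem_nhds ?_
      intro hxs
      obtain ⟨Q, hQ, hxQ⟩ := mem_supportOf.1 hxs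
      exact hH Q hQ ((hK.meet_holes P hP Q hQ).mem_edges he hx hxQ)
    -- The cell `P` leaves one side of the edge uncovered, and nothing else comes near `x`.
    have hfreq : ∃ᶠ y in 𝓝 x, y ∉ P.region := by
      rcases coversSide_or he hx hl h with h1 | h1
      · refine ((frequently_lt hneg x).and_eventually h1).mono fun y hy => hy.2.2 ?_
        simpa using hy.1
      · refine ((frequently_lt hl x).and_eventually h1).mono fun y hy => hy.2.2 ?_
        simpa using hy.1
    refine mem_closure_iff_frequently.2 ((hfreq.and_eventually (hcells.and hholes)).mono ?_)
    rintro y ⟨hy1, hy2, hy3⟩ (hy | hy)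
    · obtain ⟨Q, hQ, hyQ⟩ := mem_supportOf.1 hy
      rcases eq_or_ne Q P with rfl | hne
      · exact hy1 hyQ
      · exact hy2 (mem_supportOf.2 ⟨Q, ⟨hQ, hne⟩, hyQ⟩)
    · exact hy3 hy
  rw [← closure_openSegment]
  exact closure_minimal hopen isClosed_closure

/-- Each of two adjacent boundary edges borders a hole or the outside. If they border the same hole,
the polygon and the hole share two edges; if two holes, or a hole and the outside, these touch in
`v`; if both border the outside, `adjacent_outside` applies. -/
lemma boundary_separated {H : Set PlanePolygon} (hK : IsInputMesh K H) (hP : P ∈ K.cells)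
    {v : Plane} {e e' : Sym2 Plane} (he : e ∈ P.edges) (he' : e' ∈ P.edges) (hv : v ∈ e)
    (hv' : v ∈ e') (hb : ∀ Q ∈ K.cells, e ∈ Q.edges → Q = P)
    (hb' : ∀ Q ∈ K.cells, e' ∈ Q.edges → Q = P) : e = e' := by
  obtain ⟨i, rfl⟩ := he
  obtain ⟨j, rfl⟩ := he'
  change P.edge i = P.edge j
  by_contra hne
  have hij : i ≠ j := fun h => hne (by rw [h])
  have hvseg : ∀ k, v ∈ P.edge k → v ∈ P.poly.edgeSet ℝ k := by
    intro k hk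
    rw [edgeSet_eq]
    rcases Sym2.mem_iff.1 hk with rfl | rfl
    exacts [left_mem_segment _ _ _, right_mem_segment _ _ _]
  have hsub : ∀ k, (∀ Q ∈ K.cells, P.edge k ∈ Q.edges → Q = P) →
      (∃ h ∈ H, P.edge k ∈ h.edges) ∨ P.poly.edgeSet ℝ k ⊆ outsideOf K H := by
    intro k hk
    by_cases hh : ∃ h ∈ H, P.edge k ∈ h.edges
    · exact Or.inl hh
    · right
      push Not at hh
      rw [edgeSet_eq]
      exact segment_subset_outside hK hP (P.edge_mem k) hk hh
  have hin : ∀ k, ∀ h : PlanePolygon, P.edge k ∈ h.edges → P.poly.edgeSet ℝ k ⊆ h.region := by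
    intro k h hk
    rw [edgeSet_eq]
    exact segment_subset_region hk
  rcases hsub i hb with ⟨h, hh, hi⟩ | hi <;> rcases hsub j hb' with ⟨h', hh', hj⟩ | hj
  · rcases eq_or_ne h h' with rfl | hhh
    · refine hne ((hK.meet_holes P hP h hh).eq_of_subset (P.edge_mem i) (P.edge_mem j) ?_ ?_)
      · rw [← edgeSet_eq]; exact hin i h hi
      · rw [← edgeSet_eq]; exact hin j h hj
    · exact Set.disjoint_left.1 (hK.holes_disjoint hh hh' hhh) (hin i h hi (hvseg i hv))
        (hin j h' hj (hvseg j hv'))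
  · exact Set.disjoint_left.1 (hK.holes_outside_disjoint h hh) (hin i h hi (hvseg i hv))
      (hj (hvseg j hv'))
  · exact Set.disjoint_left.1 (hK.holes_outside_disjoint h' hh') (hin j h' hj (hvseg j hv'))
      (hi (hvseg i hv))
  · have hv : v = P.poly i ∨ v = P.poly (finRotate P.n i) := Sym2.mem_iff.1 hv
    rcases hv with rfl | rfl
    · rcases (P.poly_mem_edge_iff i j).1 hv' with h | h
      · exact hij h.symm
      · subst h
        exact hK.adjacent_outside P hP j ⟨hj, hi⟩
    · rcases (P.poly_mem_edge_iff _ j).1 hv' with h | h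
      · subst h
        exact hK.adjacent_outside P hP i ⟨hi, hj⟩
      · exact hij ((finRotate P.n).injective h).symm

/-! ### Cells around a vertex, fans, and chains of cells -/

lemma one_lt_rank_plane : 1 < Module.rank ℝ Plane := by
  rw [← Module.finrank_eq_rank, finrank_euclideanSpace_fin]
  norm_num

/-- The ball is homeomorphic to the plane with `v` corresponding to the origin, and the plane
without a point is connected. -/
lemma isPreconnected_ball_sdiff (v : Plane) {ε : ℝ} (hε : 0 < ε) :
    IsPreconnected (Metric.ball v ε \ {v}) := by
  have h := (isConnected_compl_singleton_of_one_lt_rank one_lt_rank_plane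
    (0 : Plane)).isPreconnected
  have hinj := (OpenPartialHomeomorph.univBall v ε).injOn
  rw [OpenPartialHomeomorph.univBall_source, Set.injOn_univ] at hinj
  have heq : Metric.ball v ε \ {v} = OpenPartialHomeomorph.univBall v ε '' {0}ᶜ := by
    rw [Set.compl_eq_univ_sdiff, Set.image_sdiff hinj, Set.image_singleton,
      OpenPartialHomeomorph.univBall_apply_zero, ← OpenPartialHomeomorph.univBall_source v ε,
      OpenPartialHomeomorph.image_source_eq_target, OpenPartialHomeomorph.univBall_target v hε]
  rw [heq]
  exact h.image _ (OpenPartialHomeomorph.continuous_univBall v ε).continuousOn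

/-- Cells at the vertex `v` such that each edge at `v` of one of them is an edge of another one of
them fill a neighbourhood of `v`. -/
lemma mem_interior_support {F : Set PlanePolygon} (hF : F ⊆ K.cells) {v : Plane}
    (hP : P ∈ F) (hvF : ∀ P ∈ F, v ∈ P.vertices)
    (h : ∀ P ∈ F, ∀ e ∈ P.edges, v ∈ e → ∃ Q ∈ F, Q ≠ P ∧ e ∈ Q.edges) :
    v ∈ interior (supportOf F) := by
  have hfin : F.Finite := K.finite_cells.subset hF
  have hclosed := isClosed_support hfin
  have hev : ∀ᶠ y in 𝓝 v, ∀ P ∈ F, ∀ i, v ∉ P.edge i → y ∉ P.poly.edgeSet ℝ i := by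
    rw [eventually_all_finite hfin]
    intro P hPF
    rw [eventually_all]
    intro i
    by_cases hi : v ∈ P.edge i
    · exact Eventually.of_forall fun y hy => absurd hi hy
    · have hcl : IsClosed (P.poly.edgeSet ℝ i) := by
        rw [edgeSet_eq, ← convexHull_pair]
        exact ((Set.toFinite _).isCompact_convexHull ℝ).isClosed
      have hvi : v ∉ P.poly.edgeSet ℝ i := by
        intro hvi
        rw [edgeSet_eq, ← insert_endpoints_openSegment] at hvi
        rcases hvi with rfl | rfl | hvi
        · exact hi (Sym2.mem_mk_left _ _)
        · exact hi (Sym2.mem_mk_right _ _)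
        · exact notMem_vertices (P.edge_mem i) hvi (hvF P hPF)
      filter_upwards [hcl.isOpen_compl.mem_nhds hvi] with y hy _ using hy
  have hev2 : ∀ᶠ y in 𝓝 v, ∀ P ∈ F, ∀ i, P.poly i ≠ v → y ≠ P.poly i := by
    rw [eventually_all_finite hfin]
    intro P hPF
    rw [eventually_all]
    intro i
    by_cases hi : P.poly i = v
    · exact Eventually.of_forall fun y hy => absurd hi hy
    · filter_upwards [isOpen_ne.mem_nhds (Ne.symm hi)] with y hy _ using hy
  -- The ball is so small that it meets only edges at `v` and contains no vertex of these cells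
  -- except `v`.
  obtain ⟨ε, hε, hball⟩ := Metric.eventually_nhds_iff_ball.1 (hev.and hev2)
  -- In the punctured ball a frontier point of a cell is an inner point of an edge at `v`, and the
  -- second cell at this edge fills the other side. So the support is open as well as closed in the
  -- punctured ball, and connectedness gives all of it.
  have hfr : ∀ y ∈ Metric.ball v ε \ {v}, y ∈ supportOf F → y ∈ interior (supportOf F) := by
    rintro y ⟨hyb, hyv⟩ hyF
    obtain ⟨P, hPF, hyP⟩ := mem_supportOf.1 hyF
    have hmono : ∀ {Q}, Q ∈ F → Q.region ⊆ supportOf F :=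
      fun hQ x hx => mem_supportOf.2 ⟨_, hQ, hx⟩
    by_cases hyi : y ∈ interior P.region
    · exact interior_mono (hmono hPF) hyi
    · have hyf : y ∈ frontier P.region := P.isClosed_region.frontier_eq ▸ ⟨hyP, hyi⟩
      rw [P.frontier_region] at hyf
      obtain ⟨i, hi⟩ := Set.mem_iUnion.1 hyf
      obtain ⟨hb1, hb2⟩ := hball y hyb
      have hvi : v ∈ P.edge i := by
        by_contra hvi
        exact hb1 P hPF i hvi hi
      have hend : ∀ k, y ≠ P.poly k := by
        intro k hk
        by_cases hkv : P.poly k = v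
        · exact hyv (hk.trans hkv)
        · exact hb2 P hPF k hkv hk
      rw [edgeSet_eq, ← insert_endpoints_openSegment] at hi
      rcases hi with hi | hi | hi
      · exact absurd hi (hend _)
      · exact absurd hi (hend _)
      · obtain ⟨Q, hQF, hQP, hQe⟩ := h P hPF _ (P.edge_mem i) hvi
        refine interior_mono ?_ (mem_interior_union_of_mem_edges (hF hPF) (hF hQF) hQP.symm
          (P.edge_mem i) hQe hi)
        exact Set.union_subset (hmono hPF) (hmono hQF)
  have hsub : Metric.ball v ε \ {v} ⊆ interior (supportOf F) := by
    refine (isPreconnected_ball_sdiff v hε).subset_left_of_subset_union isOpen_interior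
      hclosed.isOpen_compl (disjoint_compl_right.mono_left interior_subset) ?_ ?_
    · intro y hy
      by_cases hyF : y ∈ supportOf F
      · exact Or.inl (hfr y hy hyF)
      · exact Or.inr hyF
    · have hvP := vertices_subset_region (hvF P hP)
      rw [← P.closure_interior_region] at hvP
      obtain ⟨y, hyb, hyi⟩ := mem_closure_iff_nhds.1 hvP _ (Metric.ball_mem_nhds v hε)
      have hne : ((Metric.ball v ε ∩ interior P.region) \ {v}).Nonempty := by
        rw [Set.nonempty_iff_ne_empty]
        intro hem
        have hs : Metric.ball v ε ∩ interior P.region ⊆ {v} := Set.sdiff_eq_empty.1 hem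
        have := interior_maximal hs (Metric.isOpen_ball.inter isOpen_interior) ⟨hyb, hyi⟩
        rw [interior_singleton] at this
        exact this
      obtain ⟨z, ⟨hzb, hzi⟩, hzv⟩ := hne
      exact ⟨z, ⟨hzb, hzv⟩,
        interior_mono (fun x hx => mem_supportOf.2 ⟨P, hP, hx⟩) hzi⟩
  rw [mem_interior_iff_mem_nhds]
  filter_upwards [Metric.ball_mem_nhds v hε] with y hy
  rcases eq_or_ne y v with rfl | hyv
  · exact mem_supportOf.2 ⟨P, hP, vertices_subset_region (hvF P hP)⟩
  · exact interior_subset (hsub ⟨hy, hyv⟩)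

lemma interior_biUnion_eq_empty {ι : Type*} {s : Set ι} (hs : s.Finite) {A : ι → Set Plane}
    (hA : ∀ i ∈ s, IsClosed (A i) ∧ interior (A i) = ∅) : interior (⋃ i ∈ s, A i) = ∅ := by
  induction s, hs using Set.Finite.induction_on with
  | empty => simp
  | insert _ _ ih =>
    rw [Set.biUnion_insert, interior_union_isClosed_of_interior_empty]
    · exact (hA _ (Set.mem_insert _ _)).2
    · exact (hA _ (Set.mem_insert _ _)).1
    · exact ih fun i hi => hA i (Set.mem_insert_of_mem _ hi)

/-- There is no room for a further cell at `v`: its interior points near `v` would lie in the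
interior of a finite union of closed intersections, each with empty interior. -/
lemma mem_of_mem_interior_support {F : Set PlanePolygon} (hF : F ⊆ K.cells) {v : Plane}
    (hv : v ∈ interior (supportOf F)) (hQ : Q ∈ K.cells) (hvQ : v ∈ Q.vertices) : Q ∈ F := by
  by_contra hQF
  have hvQ := vertices_subset_region hvQ
  rw [← Q.closure_interior_region] at hvQ
  obtain ⟨y, hy, hyi⟩ := mem_closure_iff_nhds.1 hvQ _ (isOpen_interior.mem_nhds hv)
  have hem := interior_biUnion_eq_empty (K.finite_cells.subset hF)
    (A := fun P => P.region ∩ Q.region) (fun P hP =>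
      ⟨P.isClosed_region.inter Q.isClosed_region, (K.meetInFace (hF hP) hQ
        (fun h => hQF (h ▸ hP))).interior_inter⟩)
  have : y ∈ interior (⋃ P ∈ F, P.region ∩ Q.region) := by
    rw [← Set.iUnion₂_inter, interior_inter]
    exact ⟨hy, hyi⟩
  rw [hem] at this
  exact this

lemma isBoundaryEdge_iff {e : Sym2 Plane} (hP : P ∈ K.cells) (he : e ∈ P.edges) :
    IsBoundaryEdge K.toPolyComplex e ↔ ∀ Q ∈ K.cells, e ∈ Q.edges → Q = P := by
  constructor
  · rintro h Q hQ heQ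
    exact edges_injOn hQ hP (h.unique ⟨⟨Q, hQ, rfl⟩, heQ⟩ ⟨⟨P, hP, rfl⟩, he⟩)
  · intro h
    refine ⟨P.edges, ⟨⟨P, hP, rfl⟩, he⟩, ?_⟩
    rintro _ ⟨⟨Q, hQ, rfl⟩, heQ⟩
    rw [h Q hQ heQ]

/-- A fan without boundary edge at `v` fills a neighbourhood of `v` and therefore contains every
cell at `v`. -/
lemma fan_boundary (hP : P ∈ K.cells) (hQ : Q ∈ K.cells) {v : Plane} (hvP : v ∈ P.vertices)
    (hvQ : v ∈ Q.vertices) (hfan : Q.edges ∉ fan K.toPolyComplex v P.edges) :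
    ∃ R ∈ fan K.toPolyComplex v P.edges, ∃ e ∈ R, v ∈ e ∧ IsBoundaryEdge K.toPolyComplex e := by
  by_contra! hno
  let F : Set PlanePolygon := {R | R ∈ K.cells ∧ R.edges ∈ fan K.toPolyComplex v P.edges}
  have hF : F ⊆ K.cells := fun R hR => hR.1
  have hvF : ∀ R ∈ F, v ∈ R.vertices := by
    rintro R ⟨hR, hRfan⟩
    rcases Relation.ReflTransGen.cases_tail hRfan with h | ⟨S, -, -, -, e, -, he, hve⟩
    · rw [edges_injOn hR hP h]
      exact hvP
    · rw [← polygonVertices_edges]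
      exact ⟨e, he, hve⟩
  refine hfan (mem_of_mem_interior_support hF (mem_interior_support hF (P := P) ?_ hvF ?_) hQ
    hvQ).2
  · exact ⟨hP, Relation.ReflTransGen.refl⟩
  · rintro R ⟨hR, hRfan⟩ e he hve
    have := hno _ hRfan e he hve
    rw [isBoundaryEdge_iff hR he] at this
    push Not at this
    obtain ⟨S, hS, heS, hSR⟩ := this
    refine ⟨S, ⟨hS, hRfan.tail ⟨⟨R, hR, rfl⟩, ⟨S, hS, rfl⟩, e, he, heS, hve⟩⟩, hSR, heS⟩

/-- The cells that are reached and those that are not have closed supports which cover the connected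
support of `K`. A common point lies in a common face, which has a common vertex. -/
lemma chain (hconn : IsConnected (supportOf K.cells)) (hP : P ∈ K.cells) (hQ : Q ∈ K.cells) :
    Relation.ReflTransGen (fun P Q => P ∈ K.toPolyComplex ∧ Q ∈ K.toPolyComplex ∧
      (polygonVertices P ∩ polygonVertices Q).Nonempty) P.edges Q.edges := by
  by_contra hPQ
  set rel : Set (Sym2 Plane) → Set (Sym2 Plane) → Prop := fun P Q => P ∈ K.toPolyComplex ∧
    Q ∈ K.toPolyComplex ∧ (polygonVertices P ∩ polygonVertices Q).Nonempty with hrel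
  let A : Set PlanePolygon := {R | R ∈ K.cells ∧ Relation.ReflTransGen rel P.edges R.edges}
  let B : Set PlanePolygon := {R | R ∈ K.cells ∧ ¬ Relation.ReflTransGen rel P.edges R.edges}
  have hA : A ⊆ K.cells := fun R hR => hR.1
  have hB : B ⊆ K.cells := fun R hR => hR.1
  have hne : ∀ {C : Set PlanePolygon} {R}, R ∈ C → C ⊆ K.cells →
      (supportOf K.cells ∩ supportOf C).Nonempty := by
    intro C R hR hC
    obtain ⟨v, hv⟩ := R.vertices_nonempty
    have hv := vertices_subset_region hv
    exact ⟨v, mem_supportOf.2 ⟨R, hC hR, hv⟩, mem_supportOf.2 ⟨R, hR, hv⟩⟩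
  have h := isPreconnected_closed_iff.1 hconn.isPreconnected _ _
    (isClosed_support (K.finite_cells.subset hA)) (isClosed_support (K.finite_cells.subset hB))
    ?_ (hne (R := P) ⟨hP, Relation.ReflTransGen.refl⟩ hA) (hne (R := Q) ⟨hQ, hPQ⟩ hB)
  · obtain ⟨x, -, hxA, hxB⟩ := h
    obtain ⟨R, hR, hxR⟩ := mem_supportOf.1 hxA
    obtain ⟨S, hS, hxS⟩ := mem_supportOf.1 hxB
    refine hS.2 (hR.2.tail ⟨⟨R, hR.1, rfl⟩, ⟨S, hS.1, rfl⟩, ?_⟩)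
    have hRS : R ≠ S := fun h => hS.2 (h ▸ hR.2)
    rcases K.meetInFace hR.1 hS.1 hRS with h | ⟨v, h1, h2, -⟩ | ⟨u, v, h1, h2, -⟩
    · exact absurd (h ▸ (⟨hxR, hxS⟩ : x ∈ R.region ∩ S.region)) (Set.notMem_empty x)
    · exact ⟨v, (polygonVertices_edges R).symm ▸ h1, (polygonVertices_edges S).symm ▸ h2⟩
    · exact ⟨u, ⟨_, h1, Sym2.mem_mk_left _ _⟩, ⟨_, h2, Sym2.mem_mk_left _ _⟩⟩
  · intro x hx
    obtain ⟨R, hR, hxR⟩ := mem_supportOf.1 hx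
    by_cases hRP : Relation.ReflTransGen rel P.edges R.edges
    · exact Or.inl (mem_supportOf.2 ⟨R, ⟨hR, hRP⟩, hxR⟩)
    · exact Or.inr (mem_supportOf.2 ⟨R, ⟨hR, hRP⟩, hxR⟩)

/-- An admissible input mesh has the combinatorial properties of a mesh. -/
theorem isMesh {H : Set PlanePolygon} (hK : IsInputMesh K H) : K.toPolyComplex.IsMesh where
  finite := K.finite_cells.image _
  finite_polygon := by rintro _ ⟨P, -, rfl⟩; exact P.finite_edges
  not_isDiag := by rintro _ ⟨P, -, rfl⟩ e he; exact P.not_isDiag he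
  two_edges := by
    rintro _ ⟨P, -, rfl⟩ v hv
    exact P.two_edges (polygonVertices_edges P ▸ hv)
  two_polygons := by
    rintro e _ ⟨P, hP, rfl⟩ _ ⟨Q, hQ, rfl⟩ _ ⟨R, hR, rfl⟩ heP heQ heR
    rcases two_polygons hP hQ hR heP heQ heR with rfl | rfl | rfl
    exacts [Or.inl rfl, Or.inr (Or.inl rfl), Or.inr (Or.inr rfl)]
  share := by
    rintro _ ⟨P, hP, rfl⟩ _ ⟨Q, hQ, rfl⟩ hne v e he heQ - e' he' heQ' -
    exact share_one hP hQ (fun h => hne (h ▸ rfl)) he heQ he' heQ'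
  connected_polygon := by rintro _ ⟨P, -, rfl⟩; exact P.isConnectedPolygon
  share_one := by
    rintro _ ⟨P, hP, rfl⟩ _ ⟨Q, hQ, rfl⟩ hne e he heQ e' he' heQ'
    exact share_one hP hQ (fun h => hne (h ▸ rfl)) he heQ he' heQ'
  boundary_separated := by
    rintro _ ⟨P, hP, rfl⟩ v e he hv hb e' he' hv' hb'
    rw [isBoundaryEdge_iff hP he] at hb
    rw [isBoundaryEdge_iff hP he'] at hb'
    exact boundary_separated hK hP he he' hv hv' hb hb'
  fan_boundary := by
    rintro _ ⟨P, hP, rfl⟩ _ ⟨Q, hQ, rfl⟩ v hvP hvQ hfan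
    rw [polygonVertices_edges] at hvP hvQ
    exact fan_boundary hP hQ hvP hvQ hfan
  chain := by
    rintro _ ⟨P, hP, rfl⟩ _ ⟨Q, hQ, rfl⟩
    exact chain hK.connected hP hQ
  nonempty := by
    obtain ⟨x, hx⟩ := hK.connected.nonempty
    obtain ⟨P, hP, -⟩ := mem_supportOf.1 hx
    exact ⟨_, P, hP, rfl⟩

end PlaneComplex

namespace PolyComplex

variable {V : Type*} {K : PolyComplex V}

/-! ### Sides and fans -/

lemma some_mem_sides {e : Sym2 V} {P : Set (Sym2 V)} :
    some P ∈ sides K e ↔ P ∈ K ∧ e ∈ P := by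
  simp only [sides, Set.mem_ofPred_eq, Option.some.injEq, reduceCtorEq, and_false, or_false]
  constructor
  · rintro ⟨Q, hQ, he, rfl⟩
    exact ⟨hQ, he⟩
  · rintro ⟨hP, he⟩
    exact ⟨P, hP, he, rfl⟩

lemma none_mem_sides {e : Sym2 V} : none ∈ sides K e ↔ IsBoundaryEdge K e := by
  simp [sides]

lemma mem_edges_of_mem_sides {e : Sym2 V} {s : Option (Set (Sym2 V))} (h : s ∈ sides K e) :
    e ∈ K.edges := by
  rcases h with ⟨P, hP, he, -⟩ | ⟨⟨P, hP, -⟩, -⟩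
  exacts [⟨P, hP, he⟩, ⟨P, hP⟩]

lemma sides_eq_of_unique {e : Sym2 V} {P : Set (Sym2 V)} (hP : P ∈ K) (he : e ∈ P)
    (h : ∀ R ∈ K, e ∈ R → R = P) : sides K e = {some P, none} := by
  ext s
  cases s with
  | none =>
    simp only [none_mem_sides, Set.mem_insert_iff, reduceCtorEq, Set.mem_singleton_iff, or_true,
      iff_true]
    exact ⟨P, ⟨hP, he⟩, fun R hR => h R hR.1 hR.2⟩
  | some R =>
    simp only [some_mem_sides, Set.mem_insert_iff, Option.some.injEq, Set.mem_singleton_iff,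
      reduceCtorEq, or_false]
    constructor
    · exact fun hR => h R hR.1 hR.2
    · rintro rfl
      exact ⟨hP, he⟩

lemma sides_eq_of_pair {e : Sym2 V} {P Q : Set (Sym2 V)} (hP : P ∈ K) (heP : e ∈ P) (hQ : Q ∈ K)
    (heQ : e ∈ Q) (hne : P ≠ Q) (h : ∀ R ∈ K, e ∈ R → R = P ∨ R = Q) :
    sides K e = {some P, some Q} := by
  ext s
  cases s with
  | none =>
    simp only [none_mem_sides, Set.mem_insert_iff, reduceCtorEq, Set.mem_singleton_iff, or_self,
      iff_false]
    intro hb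
    exact hne (hb.unique ⟨hP, heP⟩ ⟨hQ, heQ⟩)
  | some R =>
    simp only [some_mem_sides, Set.mem_insert_iff, Option.some.injEq, Set.mem_singleton_iff]
    constructor
    · exact fun hR => h R hR.1 hR.2
    · rintro (rfl | rfl)
      exacts [⟨hP, heP⟩, ⟨hQ, heQ⟩]

lemma eq_of_mem_pair {α : Type*} {A : Set α} (hA : ∃ s t, s ≠ t ∧ A = {s, t}) {x y z : α}
    (hx : x ∈ A) (hy : y ∈ A) (hz : z ∈ A) (hxy : x ≠ y) (hxz : x ≠ z) : y = z := by
  obtain ⟨s, t, -, rfl⟩ := hA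
  simp only [Set.mem_insert_iff, Set.mem_singleton_iff] at hx hy hz
  rcases hx with rfl | rfl <;> rcases hy with rfl | rfl <;> rcases hz with rfl | rfl <;> tauto

lemma exists_ne_of_pair {α : Type*} {A : Set α} (hA : ∃ s t, s ≠ t ∧ A = {s, t}) (x : α) :
    ∃ y ∈ A, y ≠ x := by
  obtain ⟨s, t, hst, rfl⟩ := hA
  by_cases h : s = x
  · exact ⟨t, by simp, fun h' => hst (h.trans h'.symm)⟩
  · exact ⟨s, by simp, h⟩

lemma fan_symm {v : V} {f g : Set (Sym2 V)} (h : g ∈ fan K v f) : f ∈ fan K v g := by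
  induction h with
  | refl => exact Relation.ReflTransGen.refl
  | tail _ h ih =>
    obtain ⟨hP, hQ, e, heP, heQ, hv⟩ := h
    exact Relation.ReflTransGen.head ⟨hQ, hP, e, heQ, heP, hv⟩ ih

lemma fan_eq {v : V} {f g : Set (Sym2 V)} (h : g ∈ fan K v f) : fan K v g = fan K v f := by
  ext R
  exact ⟨fun hR => Relation.ReflTransGen.trans h hR,
    fun hR => Relation.ReflTransGen.trans (fan_symm h) hR⟩

lemma self_mem_fan (v : V) (f : Set (Sym2 V)) : f ∈ fan K v f := Relation.ReflTransGen.refl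

lemma mem_fan_of_mem {v : V} {f g h : Set (Sym2 V)} {e : Sym2 V} (hg : g ∈ fan K v f)
    (hgK : g ∈ K) (hh : h ∈ K) (heg : e ∈ g) (heh : e ∈ h) (hv : v ∈ e) : h ∈ fan K v f :=
  Relation.ReflTransGen.tail hg ⟨hgK, hh, e, heg, heh, hv⟩

lemma mem_of_mem_fan {v : V} {f g : Set (Sym2 V)} (hf : f ∈ K) (hg : g ∈ fan K v f) : g ∈ K := by
  rcases Relation.ReflTransGen.cases_tail hg with rfl | ⟨_, -, -, h, -⟩
  exacts [hf, h]

lemma mem_polygonVertices_of_mem_fan {v : V} {f g : Set (Sym2 V)} (hf : v ∈ polygonVertices f)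
    (hg : g ∈ fan K v f) : v ∈ polygonVertices g := by
  rcases Relation.ReflTransGen.cases_tail hg with rfl | ⟨_, -, -, -, e, -, he, hv⟩
  exacts [hf, ⟨e, he, hv⟩]

/-! ### Edges of the polygons of the Euler transformation -/

lemma mem_copyPolygon {f : Set (Sym2 V)} {x y : ETVertex V} :
    s(x, y) ∈ copyPolygon f ↔ x.1 = some f ∧ y.1 = some f ∧ s(x.2, y.2) ∈ f := by
  constructor
  · rintro ⟨e, he, h⟩
    induction e with | _ u v
    rw [Sym2.map_mk] at h
    rcases Sym2.eq_iff.1 h with ⟨rfl, rfl⟩ | ⟨rfl, rfl⟩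
    · exact ⟨rfl, rfl, he⟩
    · exact ⟨rfl, rfl, Sym2.eq_swap ▸ he⟩
  · obtain ⟨s, u⟩ := x
    obtain ⟨t, v⟩ := y
    rintro ⟨rfl, rfl, h⟩
    exact ⟨_, h, rfl⟩

lemma mem_edgePolygon {e : Sym2 V} {x y : ETVertex V} :
    s(x, y) ∈ edgePolygon K e ↔ x.1 ∈ sides K e ∧ y.1 ∈ sides K e ∧
      ((x.1 = y.1 ∧ e = s(x.2, y.2)) ∨ (x.1 ≠ y.1 ∧ x.2 = y.2 ∧ x.2 ∈ e)) := by
  obtain ⟨s, u⟩ := x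
  obtain ⟨t, v⟩ := y
  simp only [edgePolygon, Set.mem_ofPred_eq]
  constructor
  · rintro ⟨u', v', rfl, ⟨s', hs', h⟩ | ⟨s', hs', t', ht', hst, h⟩⟩
    · rcases Sym2.eq_iff.1 h with ⟨h1, h2⟩ | ⟨h1, h2⟩ <;> cases h1 <;> cases h2
      · exact ⟨hs', hs', Or.inl ⟨rfl, rfl⟩⟩
      · exact ⟨hs', hs', Or.inl ⟨rfl, Sym2.eq_swap⟩⟩
    · rcases Sym2.eq_iff.1 h with ⟨h1, h2⟩ | ⟨h1, h2⟩ <;> cases h1 <;> cases h2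
      · exact ⟨hs', ht', Or.inr ⟨hst, rfl, Sym2.mem_mk_right _ _⟩⟩
      · exact ⟨ht', hs', Or.inr ⟨hst.symm, rfl, Sym2.mem_mk_right _ _⟩⟩
  · rintro ⟨hs, ht, ⟨rfl, rfl⟩ | ⟨hst, rfl, hu⟩⟩
    · exact ⟨u, v, rfl, Or.inl ⟨s, hs, rfl⟩⟩
    · obtain ⟨w, rfl⟩ := hu
      exact ⟨w, u, Sym2.eq_swap, Or.inr ⟨s, hs, t, ht, hst, rfl⟩⟩

lemma mem_vertexPolygon {v : V} {f : Set (Sym2 V)} {x y : ETVertex V} :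
    s(x, y) ∈ vertexPolygon K v f ↔ x.1 ≠ y.1 ∧ x.2 = v ∧ y.2 = v ∧
      ∃ g ∈ fan K v f, ∃ e ∈ g, v ∈ e ∧ x.1 ∈ sides K e ∧ y.1 ∈ sides K e := by
  obtain ⟨s, u⟩ := x
  obtain ⟨t, w⟩ := y
  simp only [vertexPolygon, Set.mem_ofPred_eq]
  constructor
  · rintro ⟨g, hg, e, he, hv, s', hs', t', ht', hst, h⟩
    rcases Sym2.eq_iff.1 h with ⟨h1, h2⟩ | ⟨h1, h2⟩ <;> cases h1 <;> cases h2
    · exact ⟨hst, rfl, rfl, g, hg, e, he, hv, hs', ht'⟩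
    · exact ⟨hst.symm, rfl, rfl, g, hg, e, he, hv, ht', hs'⟩
  · rintro ⟨hst, rfl, rfl, g, hg, e, he, hv, hs, ht⟩
    exact ⟨g, hg, e, he, hv, s, hs, t, ht, hst, rfl⟩

lemma edgePolygon_mem {e : Sym2 V} (he : e ∈ K.edges) : edgePolygon K e ∈ eulerTransform K :=
  Or.inl (Or.inr ⟨e, he, rfl⟩)

lemma copyPolygon_mem {f : Set (Sym2 V)} (hf : f ∈ K) : copyPolygon f ∈ eulerTransform K :=
  Or.inl (Or.inl ⟨f, hf, rfl⟩)

/-- The quadrangles already carry all edges: an edge of a Class 1 polygon is a copy of some `e`, an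
edge of a Class 3 polygon crosses some `e`, and both lie on the quadrangle of `e`. -/
lemma mem_eulerTransform_edges {a : Sym2 (ETVertex V)} :
    a ∈ (eulerTransform K).edges ↔ ∃ e ∈ K.edges, a ∈ edgePolygon K e := by
  constructor
  · rintro ⟨P, (⟨f, hf, rfl⟩ | ⟨e, he, rfl⟩) | ⟨-, f, hf, v, hv, rfl⟩, ha⟩
    · induction a with | _ x y
      obtain ⟨h1, h2, h3⟩ := mem_copyPolygon.1 ha
      refine ⟨_, ⟨f, hf, h3⟩, mem_edgePolygon.2 ⟨?_, ?_, Or.inl ⟨h1.trans h2.symm, rfl⟩⟩⟩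
      · exact h1 ▸ some_mem_sides.2 ⟨hf, h3⟩
      · exact h2 ▸ some_mem_sides.2 ⟨hf, h3⟩
    · exact ⟨e, he, ha⟩
    · induction a with | _ x y
      obtain ⟨h1, h2, h3, g, hg, e, he, hve, hs, ht⟩ := mem_vertexPolygon.1 ha
      exact ⟨e, mem_edges_of_mem_sides hs, mem_edgePolygon.2 ⟨hs, ht, Or.inr ⟨h1, h2.trans h3.symm,
        h2 ▸ hve⟩⟩⟩
  · rintro ⟨e, he, ha⟩
    exact ⟨_, edgePolygon_mem he, ha⟩

lemma vertexPolygon_eq {v : V} {f g : Set (Sym2 V)} (h : g ∈ fan K v f) :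
    vertexPolygon K v g = vertexPolygon K v f := by
  simp only [vertexPolygon, fan_eq h]

/-- A polygon `g` whose copy of `v` lies on the polygon generated by `v` belongs to the fan. -/
lemma mem_fan_of_mem_vertexPolygon {v : V} {f g : Set (Sym2 V)} (hf : f ∈ K)
    {x y : ETVertex V} (h : s(x, y) ∈ vertexPolygon K v f) (hx : x.1 = some g) :
    g ∈ fan K v f := by
  obtain ⟨-, -, -, g', hg', e, he, hv, hs, -⟩ := mem_vertexPolygon.1 h
  rw [hx, some_mem_sides] at hs
  exact mem_fan_of_mem hg' (mem_of_mem_fan hf hg') hs.1 he hs.2 hv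

/-! ### Locally planar complexes -/

namespace IsLocallyPlanar

variable (hK : K.IsLocallyPlanar)
include hK

/-- No field refers to boundary edges, so arbitrary pieces inherit the property; boundary separation
would not be inherited. -/
lemma mono {L : PolyComplex V} (hL : L ⊆ K) : L.IsLocallyPlanar where
  finite := hK.finite.subset hL
  finite_polygon P hP := hK.finite_polygon P (hL hP)
  not_isDiag P hP := hK.not_isDiag P (hL hP)
  two_edges P hP := hK.two_edges P (hL hP)
  two_polygons e P hP Q hQ R hR := hK.two_polygons e P (hL hP) Q (hL hQ) R (hL hR)
  share P hP Q hQ := hK.share P (hL hP) Q (hL hQ)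

lemma finite_edges : K.edges.Finite := hK.finite.sUnion hK.finite_polygon

lemma two_sides {e : Sym2 V} (he : e ∈ K.edges) : ∃ s t, s ≠ t ∧ sides K e = {s, t} := by
  obtain ⟨P, hP, heP⟩ := he
  by_cases h : ∃ Q ∈ K, e ∈ Q ∧ Q ≠ P
  · obtain ⟨Q, hQ, heQ, hne⟩ := h
    refine ⟨some P, some Q, by simpa using hne.symm, sides_eq_of_pair hP heP hQ heQ hne.symm ?_⟩
    intro R hR heR
    rcases hK.two_polygons e R hR P hP Q hQ heR heP heQ with h | h | h
    exacts [Or.inl h, Or.inr h, absurd h.symm hne]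
  · push Not at h
    exact ⟨some P, none, by simp, sides_eq_of_unique hP heP h⟩

lemma exists_other_edge {P : Set (Sym2 V)} (hP : P ∈ K) {e : Sym2 V} (he : e ∈ P) {v : V}
    (hv : v ∈ e) : ∃ e' ∈ P, v ∈ e' ∧ e' ≠ e ∧ ∀ e'' ∈ P, v ∈ e'' → e'' = e ∨ e'' = e' := by
  obtain ⟨a, b, hab, h⟩ := Set.ncard_eq_two.1 (hK.two_edges P hP v ⟨e, he, hv⟩)
  have hall : ∀ {c}, c ∈ P ∧ v ∈ c ↔ c = a ∨ c = b := fun {c} => by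
    have := Set.ext_iff.1 h c
    simpa using this
  have ha := hall.2 (Or.inl rfl)
  have hb := hall.2 (Or.inr rfl)
  rcases hall.1 ⟨he, hv⟩ with rfl | rfl
  · exact ⟨b, hb.1, hb.2, hab.symm, fun c hc hvc => hall.1 ⟨hc, hvc⟩⟩
  · exact ⟨a, ha.1, ha.2, hab, fun c hc hvc => (hall.1 ⟨hc, hvc⟩).symm⟩

omit hK in
lemma isBoundaryEdge_or {P : Set (Sym2 V)} (hP : P ∈ K) {e : Sym2 V} (he : e ∈ P) :
    IsBoundaryEdge K e ∨ ∃ Q ∈ K, Q ≠ P ∧ e ∈ Q := by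
  by_cases h : ∃ Q ∈ K, Q ≠ P ∧ e ∈ Q
  · exact Or.inr h
  · push Not at h
    exact Or.inl ⟨P, ⟨hP, he⟩, fun Q hQ => by
      by_contra hne
      exact h Q hQ.1 hne hQ.2⟩

/-- Two adjacent edges with the same sides are the boundary edges of a single polygon. -/
lemma boundary_of_ne {e e' : Sym2 V} {v : V} (hv : v ∈ e) (hv' : v ∈ e') (hne : e ≠ e')
    {s t : Option (Set (Sym2 V))} (hst : s ≠ t) (hs : s ∈ sides K e) (ht : t ∈ sides K e)
    (hs' : s ∈ sides K e') (ht' : t ∈ sides K e') :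
    ∃ f ∈ K, e ∈ f ∧ e' ∈ f ∧ (s = some f ∧ t = none ∨ s = none ∧ t = some f) ∧
      IsBoundaryEdge K e ∧ IsBoundaryEdge K e' := by
  rcases s with _ | f <;> rcases t with _ | g
  · exact absurd rfl hst
  · rw [some_mem_sides] at ht ht'
    rw [none_mem_sides] at hs hs'
    exact ⟨g, ht.1, ht.2, ht'.2, Or.inr ⟨rfl, rfl⟩, hs, hs'⟩
  · rw [some_mem_sides] at hs hs'
    rw [none_mem_sides] at ht ht'
    exact ⟨f, hs.1, hs.2, hs'.2, Or.inl ⟨rfl, rfl⟩, ht, ht'⟩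
  · rw [some_mem_sides] at hs hs' ht ht'
    exact absurd (hK.share f hs.1 g ht.1 (fun h => hst (h ▸ rfl)) v e hs.2 ht.2 hv e' hs'.2 ht'.2
      hv') hne

omit hK in
lemma exists_some_of_ne {e : Sym2 V} {s t : Option (Set (Sym2 V))} (hst : s ≠ t)
    (hs : s ∈ sides K e) (ht : t ∈ sides K e) :
    ∃ f ∈ K, e ∈ f ∧ (s = some f ∨ t = some f) := by
  rcases s with _ | f
  · rcases t with _ | g
    · exact absurd rfl hst
    · rw [some_mem_sides] at ht
      exact ⟨g, ht.1, ht.2, Or.inr rfl⟩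
  · rw [some_mem_sides] at hs
    exact ⟨f, hs.1, hs.2, Or.inl rfl⟩

omit hK in
/-- The edges at `v` of the polygon generated by `v`, in terms of any polygon of its fan. -/
lemma mem_vertexPolygon_of_sides {f : Set (Sym2 V)} {e : Sym2 V} {v : V}
    (he : e ∈ f) (hv : v ∈ e) {s t : Option (Set (Sym2 V))} (hst : s ≠ t) (hs : s ∈ sides K e)
    (ht : t ∈ sides K e) : s((s, v), (t, v)) ∈ vertexPolygon K v f :=
  mem_vertexPolygon.2 ⟨hst, rfl, rfl, f, self_mem_fan v f, e, he, hv, hs, ht⟩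

end IsLocallyPlanar

end PolyComplex

namespace PolyComplex

variable {V : Type*} {K : PolyComplex V}

/-! ### The Euler transformation of a locally planar complex is two-sided -/

lemma edgePolygon_injective {e e' : Sym2 V} (he : e ∈ K.edges)
    (h : edgePolygon K e = edgePolygon K e') : e = e' := by
  obtain ⟨P, hP, heP⟩ := he
  induction e with | _ u v
  have hs : some P ∈ sides K s(u, v) := some_mem_sides.2 ⟨hP, heP⟩
  have : s(((some P, u) : ETVertex V), (some P, v)) ∈ edgePolygon K s(u, v) :=
    mem_edgePolygon.2 ⟨hs, hs, Or.inl ⟨rfl, rfl⟩⟩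
  rw [h, mem_edgePolygon] at this
  rcases this.2.2 with ⟨-, h⟩ | ⟨h, -⟩
  exacts [h.symm, absurd rfl h]

lemma finite_eulerTransform_edges (hK : K.edges.Finite)
    (hs : ∀ e ∈ K.edges, (sides K e).Finite) : (eulerTransform K).edges.Finite := by
  have hfin : ∀ e ∈ K.edges, (edgePolygon K e).Finite := by
    intro e he
    have he2 : {v | v ∈ e}.Finite := by
      induction e with | _ a b
      refine (Set.toFinite {a, b}).subset fun v hv => ?_
      simpa using hv
    refine ((((hs e he).prod he2).prod ((hs e he).prod he2)).image
      (fun p => s(p.1, p.2))).subset ?_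
    intro a ha
    induction a with | _ x y
    obtain ⟨hs, ht, ⟨-, rfl⟩ | ⟨-, hxy, hx⟩⟩ := mem_edgePolygon.1 ha
    · exact ⟨(x, y), ⟨⟨hs, Sym2.mem_mk_left _ _⟩, ⟨ht, Sym2.mem_mk_right _ _⟩⟩, rfl⟩
    · exact ⟨(x, y), ⟨⟨hs, hx⟩, ⟨ht, hxy ▸ hx⟩⟩, rfl⟩
  refine (hK.biUnion hfin).subset ?_
  intro a ha
  obtain ⟨e, he, h⟩ := mem_eulerTransform_edges.1 ha
  exact Set.mem_biUnion he h

namespace IsLocallyPlanar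

variable (hK : K.IsLocallyPlanar)
include hK

omit hK in
lemma edgePolygon_ne_vertexPolygon {e : Sym2 V} (he : e ∈ K.edges) (v : V) (f : Set (Sym2 V)) :
    edgePolygon K e ≠ vertexPolygon K v f := by
  obtain ⟨P, hP, heP⟩ := he
  induction e with | _ u w
  intro h
  have hs : some P ∈ sides K s(u, w) := some_mem_sides.2 ⟨hP, heP⟩
  have : s(((some P, u) : ETVertex V), (some P, w)) ∈ edgePolygon K s(u, w) :=
    mem_edgePolygon.2 ⟨hs, hs, Or.inl ⟨rfl, rfl⟩⟩
  rw [h, mem_vertexPolygon] at this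
  exact this.1 rfl

lemma edgePolygon_ne_copyPolygon {e : Sym2 V} (he : e ∈ K.edges) (f : Set (Sym2 V)) :
    edgePolygon K e ≠ copyPolygon f := by
  obtain ⟨s, t, hst, h⟩ := hK.two_sides he
  induction e with | _ u w
  intro heq
  have hs : s ∈ sides K s(u, w) := h ▸ Set.mem_insert _ _
  have ht : t ∈ sides K s(u, w) := h ▸ Set.mem_insert_of_mem _ rfl
  have : s(((s, u) : ETVertex V), (t, u)) ∈ edgePolygon K s(u, w) :=
    mem_edgePolygon.2 ⟨hs, ht, Or.inr ⟨hst, rfl, Sym2.mem_mk_left _ _⟩⟩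
  rw [heq, mem_copyPolygon] at this
  exact hst (this.1.trans this.2.1.symm)

/-- The neighbour `g` of `f` has a second edge at `v`, which `f` does not contain because of
`share`. So what lies across it is neither `f` nor `g`. -/
lemma exists_third_side {f g : Set (Sym2 V)} (hf : f ∈ K) (hg : g ∈ K) (hne : g ≠ f)
    {e : Sym2 V} {v : V} (hef : e ∈ f) (heg : e ∈ g) (hv : v ∈ e) :
    ∃ t, t ≠ some f ∧ t ≠ some g ∧ s(((some g, v) : ETVertex V), (t, v)) ∈ vertexPolygon K v f := by
  obtain ⟨e', he', hv', hne', -⟩ := hK.exists_other_edge hg heg hv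
  obtain ⟨t, ht, htg⟩ := exists_ne_of_pair (hK.two_sides ⟨g, hg, he'⟩) (some g)
  refine ⟨t, ?_, htg, ?_⟩
  · rintro rfl
    exact hne' (hK.share g hg f hf hne v e' he' (some_mem_sides.1 ht).2 hv' e heg hef hv)
  · rw [← vertexPolygon_eq (mem_fan_of_mem (self_mem_fan v f) hf hg hef heg hv)]
    exact mem_vertexPolygon_of_sides he' hv' htg.symm (some_mem_sides.2 ⟨hg, he'⟩) ht

/-- The two edges of `f` at `v` have different other sides by `huniq`, which gives two edges at the
copy of `v` in `f`. At least one of these sides is a polygon, and that polygon supplies a third edge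
away from this copy. -/
lemma three_le_vertexPolygon {f : Set (Sym2 V)} (hf : f ∈ K) {e : Sym2 V} {v : V} (he : e ∈ f)
    (hv : v ∈ e) {t : Option (Set (Sym2 V))} (ht : t ∈ sides K e) (htf : t ≠ some f)
    (huniq : ∀ e' ∈ f, v ∈ e' → t ∈ sides K e' → e' = e) :
    3 ≤ (vertexPolygon K v f).encard := by
  obtain ⟨e', he', hv', hne', -⟩ := hK.exists_other_edge hf he hv
  obtain ⟨t', ht', htf'⟩ := exists_ne_of_pair (hK.two_sides ⟨f, hf, he'⟩) (some f)
  have htt : t ≠ t' := by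
    rintro rfl
    exact hne' (huniq e' he' hv' ht')
  have h1 := mem_vertexPolygon_of_sides he hv htf.symm (some_mem_sides.2 ⟨hf, he⟩) ht
  have h2 := mem_vertexPolygon_of_sides he' hv' htf'.symm (some_mem_sides.2 ⟨hf, he'⟩) ht'
  obtain ⟨g, t₃, h3f, h3g, h3, hgf⟩ : ∃ g t₃, t₃ ≠ some f ∧ t₃ ≠ some g ∧
      s(((some g, v) : ETVertex V), (t₃, v)) ∈ vertexPolygon K v f ∧ g ≠ f := by
    rcases t with _ | g
    · rcases t' with _ | g
      · exact absurd rfl htt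
      · rw [some_mem_sides] at ht'
        have hgf : g ≠ f := fun h => htf' (h ▸ rfl)
        obtain ⟨t₃, h⟩ := hK.exists_third_side hf ht'.1 hgf he' ht'.2 hv'
        exact ⟨g, t₃, h.1, h.2.1, h.2.2, hgf⟩
    · rw [some_mem_sides] at ht
      have hgf : g ≠ f := fun h => htf (h ▸ rfl)
      obtain ⟨t₃, h⟩ := hK.exists_third_side hf ht.1 hgf he ht.2 hv
      exact ⟨g, t₃, h.1, h.2.1, h.2.2, hgf⟩
  rw [← Set.encard_eq_three.2 ⟨s(((some f, v) : ETVertex V), (t, v)),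
    s(((some f, v) : ETVertex V), (t', v)), s(((some g, v) : ETVertex V), (t₃, v)), ?_, ?_, ?_, rfl⟩]
  · refine Set.encard_le_encard ?_
    rintro a (rfl | rfl | rfl)
    exacts [h1, h2, h3]
  · simp only [ne_eq, Sym2.eq_iff, Prod.mk.injEq, and_true, true_and, not_or, not_and]
    exact ⟨htt, fun _ => htf⟩
  · simp only [ne_eq, Sym2.eq_iff, Prod.mk.injEq, Option.some.injEq, and_true, not_or, not_and]
    exact ⟨fun h => absurd h.symm hgf, fun h => absurd h.symm h3f⟩
  · simp only [ne_eq, Sym2.eq_iff, Prod.mk.injEq, Option.some.injEq, and_true, not_or, not_and]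
    exact ⟨fun h => absurd h.symm hgf, fun h => absurd h.symm h3f⟩

/-- If both edges of `f` at `v` are boundary edges, then `f` is its whole fan, and the figure at `v`
is the single edge between the copy in `f` and the unaltered `v`. -/
lemma encard_vertexPolygon_lt {f : Set (Sym2 V)} (hf : f ∈ K) {e e' : Sym2 V} {v : V}
    (he : e ∈ f) (he' : e' ∈ f) (hne : e ≠ e') (hv : v ∈ e) (hv' : v ∈ e')
    (hb : IsBoundaryEdge K e) (hb' : IsBoundaryEdge K e') :
    ¬ 3 ≤ (vertexPolygon K v f).encard := by
  obtain ⟨e₂, -, -, -, hall⟩ := hK.exists_other_edge hf he hv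
  have hall : ∀ c ∈ f, v ∈ c → IsBoundaryEdge K c := by
    intro c hc hvc
    rcases hall c hc hvc with rfl | rfl
    · exact hb
    · rcases hall e' he' hv' with rfl | rfl
      exacts [absurd rfl hne, hb']
  have hfan : ∀ g ∈ fan K v f, g = f := by
    intro g hg
    induction hg with
    | refl => rfl
    | tail _ h ih =>
      obtain ⟨-, hQ, c, hc, hcQ, hvc⟩ := h
      rw [ih] at hc
      exact (hall c hc hvc).unique ⟨hQ, hcQ⟩ ⟨hf, hc⟩
  have hsub : vertexPolygon K v f ⊆ {s(((some f, v) : ETVertex V), (none, v))} := by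
    intro a ha
    induction a with | _ x y
    obtain ⟨h1, h2, h3, g, hg, c, hc, hvc, hx, hy⟩ := mem_vertexPolygon.1 ha
    rw [hfan g hg] at hc
    have hs := sides_eq_of_unique hf hc fun R hR hcR =>
      (hall c hc hvc).unique ⟨hR, hcR⟩ ⟨hf, hc⟩
    obtain ⟨s, u⟩ := x
    obtain ⟨t, w⟩ := y
    simp only at h1 h2 h3 hx hy
    rw [hs] at hx hy
    subst h2 h3
    rcases hx with rfl | rfl <;> rcases hy with rfl | rfl
    · exact absurd rfl h1
    · rfl
    · exact Sym2.eq_swap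
    · exact absurd rfl h1
  intro h3
  have := h3.trans (Set.encard_le_encard hsub)
  rw [Set.encard_singleton] at this
  exact absurd this (by norm_num)

/-- The edges that join the copies of a vertex have polygons on both sides. -/
lemma sides_of_fst_ne {e : Sym2 V} {x y : ETVertex V} (hxy : x.1 ≠ y.1)
    (h : s(x, y) ∈ edgePolygon K e) :
    ∃ P Q, P ≠ Q ∧ sides (eulerTransform K) s(x, y) = {some P, some Q} := by
  obtain ⟨s, v⟩ := x
  obtain ⟨t, w⟩ := y
  simp only at hxy
  obtain ⟨hs, ht, ⟨h1, -⟩ | ⟨-, rfl, hv⟩⟩ := mem_edgePolygon.1 h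
  · exact absurd h1 hxy
  simp only at hs ht hv
  have hcases : ∀ R ∈ eulerTransform K, s(((s, v) : ETVertex V), (t, v)) ∈ R →
      (∃ e', v ∈ e' ∧ s ∈ sides K e' ∧ t ∈ sides K e' ∧ R = edgePolygon K e') ∨
      ∃ g ∈ K, 3 ≤ R.encard ∧ R = vertexPolygon K v g := by
    rintro R ((⟨f, hf, rfl⟩ | ⟨e', he', rfl⟩) | ⟨h3, f, hf, u, hu, rfl⟩) hR
    · rw [mem_copyPolygon] at hR
      exact absurd (hR.1.trans hR.2.1.symm) hxy
    · obtain ⟨hs', ht', ⟨h1, -⟩ | ⟨-, -, hv'⟩⟩ := mem_edgePolygon.1 hR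
      · exact absurd h1 hxy
      · exact Or.inl ⟨e', hv', hs', ht', rfl⟩
    · obtain ⟨-, rfl, -⟩ := mem_vertexPolygon.1 hR
      exact Or.inr ⟨f, hf, h3, rfl⟩
  have heK := mem_edges_of_mem_sides hs
  have hfan : ∀ {f g}, f ∈ K → g ∈ K → (s = some f ∨ t = some f) →
      s(((s, v) : ETVertex V), (t, v)) ∈ vertexPolygon K v g →
      vertexPolygon K v g = vertexPolygon K v f := by
    intro f g hf hg hst hR
    rcases hst with rfl | rfl
    · exact (vertexPolygon_eq (mem_fan_of_mem_vertexPolygon hg hR rfl)).symm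
    · exact (vertexPolygon_eq (mem_fan_of_mem_vertexPolygon hg (Sym2.eq_swap ▸ hR) rfl)).symm
  -- If no other edge at `v` has the same sides, the second polygon at this edge is of Class 3.
  -- Otherwise a polygon stands alone in its fan at `v` between two boundary edges; the Class 3
  -- figure degenerates, and the quadrangles of the two boundary edges are glued along this edge.
  by_cases huniq : ∀ e', v ∈ e' → s ∈ sides K e' → t ∈ sides K e' → e' = e
  · obtain ⟨f, hf, hef, hst⟩ := exists_some_of_ne hxy hs ht
    have h3 : 3 ≤ (vertexPolygon K v f).encard := by
      rcases hst with rfl | rfl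
      · exact hK.three_le_vertexPolygon hf hef hv ht hxy.symm fun e' he' hv' ht' =>
          huniq e' hv' (some_mem_sides.2 ⟨hf, he'⟩) ht'
      · exact hK.three_le_vertexPolygon hf hef hv hs hxy fun e' he' hv' hs' =>
          huniq e' hv' hs' (some_mem_sides.2 ⟨hf, he'⟩)
    refine ⟨_, _, edgePolygon_ne_vertexPolygon heK v f,
      sides_eq_of_pair (edgePolygon_mem heK) h (Or.inr ⟨h3, f, hf, v, ⟨e, hef, hv⟩, rfl⟩)
        (mem_vertexPolygon_of_sides hef hv hxy hs ht)
        (edgePolygon_ne_vertexPolygon heK v f) ?_⟩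
    intro R hR haR
    rcases hcases R hR haR with ⟨e', hv', hs', ht', rfl⟩ | ⟨g, hg, -, rfl⟩
    · exact Or.inl (by rw [huniq e' hv' hs' ht'])
    · exact Or.inr (hfan hf hg hst haR)
  · push Not at huniq
    obtain ⟨e', hv', hs', ht', hne⟩ := huniq
    obtain ⟨f, hf, hef, hef', hst, hb, hb'⟩ :=
      boundary_of_ne hK hv hv' hne.symm hxy hs ht hs' ht'
    have hst : s = some f ∨ t = some f := hst.imp And.left And.right
    have hneq : edgePolygon K e ≠ edgePolygon K e' :=
      fun h => hne (edgePolygon_injective heK h).symm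
    refine ⟨_, _, hneq, sides_eq_of_pair (edgePolygon_mem heK) h
      (edgePolygon_mem (mem_edges_of_mem_sides hs'))
      (mem_edgePolygon.2 ⟨hs', ht', Or.inr ⟨hxy, rfl, hv'⟩⟩) hneq ?_⟩
    intro R hR haR
    rcases hcases R hR haR with ⟨c, hvc, hsc, htc, rfl⟩ | ⟨g, hg, h3, rfl⟩
    · have hcf : c ∈ f := by
        rcases hst with rfl | rfl
        exacts [(some_mem_sides.1 hsc).2, (some_mem_sides.1 htc).2]
      obtain ⟨e₂, -, -, -, hall⟩ := hK.exists_other_edge hf hef hv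
      have h1 := hall c hcf hvc
      have h2 := hall e' hef' hv'
      rcases h2 with h2 | h2
      · exact absurd h2 hne
      · rw [← h2] at h1
        rcases h1 with rfl | rfl
        exacts [Or.inl rfl, Or.inr rfl]
    · rw [hfan hf hg hst haR] at h3
      exact absurd h3 (hK.encard_vertexPolygon_lt hf hef hef' hne.symm hv hv' hb hb')

omit hK in
lemma eq_of_mem_of_fst_eq {R : Set (Sym2 (ETVertex V))} (hR : R ∈ eulerTransform K)
    {x y : ETVertex V} (hxy : x.1 = y.1) (h : s(x, y) ∈ R) :
    R = edgePolygon K s(x.2, y.2) ∨ ∃ f ∈ K, x.1 = some f ∧ R = copyPolygon f := by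
  rcases hR with (⟨f, hf, rfl⟩ | ⟨e, he, rfl⟩) | ⟨-, f, hf, v, hv, rfl⟩
  · exact Or.inr ⟨f, hf, (mem_copyPolygon.1 h).1, rfl⟩
  · obtain ⟨-, -, ⟨-, rfl⟩ | ⟨h1, -⟩⟩ := mem_edgePolygon.1 h
    · exact Or.inl rfl
    · exact absurd hxy h1
  · exact absurd hxy (mem_vertexPolygon.1 h).1

omit hK in
lemma sides_of_fst_eq_none {e : Sym2 V} {x y : ETVertex V} (hx : x.1 = none) (hy : y.1 = none)
    (h : s(x, y) ∈ edgePolygon K e) :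
    sides (eulerTransform K) s(x, y) = {some (edgePolygon K e), none} := by
  obtain ⟨hs, -, ⟨-, rfl⟩ | ⟨h1, -⟩⟩ := mem_edgePolygon.1 h
  · refine sides_eq_of_unique (edgePolygon_mem (mem_edges_of_mem_sides hs)) h ?_
    intro R hR haR
    rcases eq_of_mem_of_fst_eq hR (hx.trans hy.symm) haR with h | ⟨f, -, hf, -⟩
    · exact h
    · exact absurd (hx.symm.trans hf) (by simp)
  · exact absurd (hx.trans hy.symm) h1

lemma sides_of_fst_eq_some {e : Sym2 V} {f : Set (Sym2 V)} {x y : ETVertex V} (hx : x.1 = some f)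
    (hy : y.1 = some f) (h : s(x, y) ∈ edgePolygon K e) :
    sides (eulerTransform K) s(x, y) = {some (edgePolygon K e), some (copyPolygon f)} := by
  obtain ⟨hs, -, ⟨-, rfl⟩ | ⟨h1, -⟩⟩ := mem_edgePolygon.1 h
  · have heK := mem_edges_of_mem_sides hs
    rw [hx, some_mem_sides] at hs
    refine sides_eq_of_pair (edgePolygon_mem heK) h (copyPolygon_mem hs.1)
      (mem_copyPolygon.2 ⟨hx, hy, hs.2⟩) (hK.edgePolygon_ne_copyPolygon heK f) ?_
    intro R hR haR
    rcases eq_of_mem_of_fst_eq hR (hx.trans hy.symm) haR with h | ⟨g, -, hg, rfl⟩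
    · exact Or.inl h
    · rw [hx, Option.some.injEq] at hg
      exact Or.inr (hg ▸ rfl)
  · exact absurd (hx.trans hy.symm) h1

/-- A boundary edge of the Euler transformation is an unaltered edge on the side of a hole or of
the outside. -/
lemma isBoundaryEdge_eulerTransform {x y : ETVertex V} :
    IsBoundaryEdge (eulerTransform K) s(x, y) ↔
      x.1 = none ∧ y.1 = none ∧ IsBoundaryEdge K s(x.2, y.2) := by
  constructor
  · intro hb
    rw [← none_mem_sides] at hb
    obtain ⟨e, he, h⟩ := mem_eulerTransform_edges.1 (mem_edges_of_mem_sides hb)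
    by_cases hxy : x.1 = y.1
    · rcases hx : x.1 with _ | f
      · refine ⟨rfl, hxy ▸ hx, ?_⟩
        obtain ⟨hs, -, ⟨-, rfl⟩ | ⟨h1, -⟩⟩ := mem_edgePolygon.1 h
        · exact none_mem_sides.1 (hx ▸ hs)
        · exact absurd hxy h1
      · rw [hK.sides_of_fst_eq_some hx (hxy ▸ hx) h] at hb
        simp at hb
    · obtain ⟨P, Q, -, hs⟩ := hK.sides_of_fst_ne hxy h
      rw [hs] at hb
      simp at hb
  · rintro ⟨hx, hy, hb⟩
    rw [← none_mem_sides] at hb ⊢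
    rw [sides_of_fst_eq_none hx hy (e := s(x.2, y.2))
      (mem_edgePolygon.2 ⟨hx ▸ hb, hy ▸ hb, Or.inl ⟨hx.trans hy.symm, rfl⟩⟩)]
    simp

/-- The Euler transformation of a locally planar complex is two-sided. -/
theorem isTwoSided_eulerTransform : (eulerTransform K).IsTwoSided where
  finite_edges := finite_eulerTransform_edges hK.finite_edges fun e he => by
    obtain ⟨s, t, -, h⟩ := hK.two_sides he
    exact h ▸ Set.toFinite _
  not_isDiag := by
    intro a ha
    induction a with | _ x y
    obtain ⟨e, ⟨P, hP, he⟩, h⟩ := mem_eulerTransform_edges.1 ha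
    rw [Sym2.mk_isDiag_iff]
    rintro rfl
    obtain ⟨hs, ht, ⟨-, rfl⟩ | ⟨h, -, -⟩⟩ := mem_edgePolygon.1 h
    · exact hK.not_isDiag P hP _ he (Sym2.mk_isDiag_iff.2 rfl)
    · exact h rfl
  two_sides := by
    intro a ha
    induction a with | _ x y
    obtain ⟨e, he, h⟩ := mem_eulerTransform_edges.1 ha
    by_cases hxy : x.1 = y.1
    · rcases hx : x.1 with _ | f
      · exact ⟨_, _, by simp, sides_of_fst_eq_none hx (hxy ▸ hx) h⟩
      · refine ⟨_, _, ?_, hK.sides_of_fst_eq_some hx (hxy ▸ hx) h⟩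
        simpa using hK.edgePolygon_ne_copyPolygon he f
    · obtain ⟨P, Q, hPQ, hs⟩ := hK.sides_of_fst_ne hxy h
      exact ⟨_, _, by simpa using hPQ, hs⟩
  separated := by
    intro x a ha hxa a' ha' hxa' hsides
    obtain ⟨y, rfl⟩ := hxa
    obtain ⟨y', rfl⟩ := hxa'
    obtain ⟨e, he, h⟩ := mem_eulerTransform_edges.1 ha
    have h' : s(x, y') ∈ edgePolygon K e := by
      have : some (edgePolygon K e) ∈ sides (eulerTransform K) s(x, y) :=
        some_mem_sides.2 ⟨edgePolygon_mem he, h⟩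
      rw [hsides] at this
      exact (some_mem_sides.1 this).2
    -- Edges with equal sides lie in the same quadrangle, which has one copied edge and one crossing
    -- edge at `x`. Their other sides differ: next to a copied edge is `none` or a Class 1 polygon,
    -- next to a crossing edge neither of these.
    have key : ∀ {y y' : ETVertex V}, s(x, y) ∈ edgePolygon K e → s(x, y') ∈ edgePolygon K e →
        sides (eulerTransform K) s(x, y) = sides (eulerTransform K) s(x, y') → x.1 = y.1 →
        x.1 ≠ y'.1 → False := by
      intro y y' h h' hsides hxy hxy'
      rcases hx : x.1 with _ | f
      · rw [sides_of_fst_eq_none hx (hxy ▸ hx) h] at hsides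
        obtain ⟨P, Q, -, hs⟩ := hK.sides_of_fst_ne hxy' h'
        rw [hs] at hsides
        have : none ∈ ({some P, some Q} : Set (Option (Set (Sym2 (ETVertex V))))) :=
          hsides ▸ Set.mem_insert_of_mem _ rfl
        simp at this
      · rw [hK.sides_of_fst_eq_some hx (hxy ▸ hx) h] at hsides
        have : some (copyPolygon f) ∈ sides (eulerTransform K) s(x, y') :=
          hsides ▸ Set.mem_insert_of_mem _ rfl
        have := mem_copyPolygon.1 (some_mem_sides.1 this).2
        exact hxy' (this.1.trans this.2.1.symm)
    obtain ⟨hsx, hsy, hc⟩ := mem_edgePolygon.1 h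
    obtain ⟨-, hsy', hc'⟩ := mem_edgePolygon.1 h'
    rcases hc with ⟨h1, h2⟩ | ⟨h1, h2, h3⟩ <;> rcases hc' with ⟨h1', h2'⟩ | ⟨h1', h2', h3'⟩
    · have : y.2 = y'.2 := Sym2.congr_right.1 (h2.symm.trans h2')
      rw [Prod.ext (h1.symm.trans h1') this]
    · exact (key h h' hsides h1 h1').elim
    · exact (key h' h hsides.symm h1' h1).elim
    · rw [Prod.ext (eq_of_mem_pair (hK.two_sides he) hsx hsy hsy' h1 h1') (h2.symm.trans h2')]

end IsLocallyPlanar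

end PolyComplex

namespace PolyComplex

variable {V : Type*} {K : PolyComplex V}

/-! ### Degrees in the Euler transformation of a two-sided complex -/

lemma mk_mem_eulerTransform_edges {x y : ETVertex V} :
    s(x, y) ∈ (eulerTransform K).edges ↔
      (x.1 = y.1 ∧ x.1 ∈ sides K s(x.2, y.2)) ∨
      (x.1 ≠ y.1 ∧ x.2 = y.2 ∧ ∃ e, x.2 ∈ e ∧ x.1 ∈ sides K e ∧ y.1 ∈ sides K e) := by
  rw [mem_eulerTransform_edges]
  constructor
  · rintro ⟨e, he, h⟩
    obtain ⟨hs, ht, ⟨h1, rfl⟩ | ⟨h1, h2, h3⟩⟩ := mem_edgePolygon.1 h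
    · exact Or.inl ⟨h1, hs⟩
    · exact Or.inr ⟨h1, h2, e, h3, hs, ht⟩
  · rintro (⟨h1, h2⟩ | ⟨h1, h2, e, he, hs, ht⟩)
    · exact ⟨_, mem_edges_of_mem_sides h2, mem_edgePolygon.2 ⟨h2, h1 ▸ h2, Or.inl ⟨h1, rfl⟩⟩⟩
    · exact ⟨e, mem_edges_of_mem_sides hs, mem_edgePolygon.2 ⟨hs, ht, Or.inr ⟨h1, h2, he⟩⟩⟩

/-- A set that consists of two disjoint parts equinumerous with a finite set is even. -/
lemma even_ncard_of_two_parts {α β : Type*} {N : Set α} {E : Set β} (hE : E.Finite)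
    (φ ψ : β → α) (hφ : Set.InjOn φ E) (hψ : Set.InjOn ψ E)
    (hdisj : ∀ e ∈ E, ∀ e' ∈ E, φ e ≠ ψ e') (hN : N = φ '' E ∪ ψ '' E) : Even N.ncard := by
  have hd : Disjoint (φ '' E) (ψ '' E) := by
    rw [Set.disjoint_left]
    rintro _ ⟨e, he, rfl⟩ ⟨e', he', h⟩
    exact hdisj e he e' he' h.symm
  rw [hN, Set.ncard_union_eq hd (hE.image φ) (hE.image ψ), hφ.ncard_image,
    hψ.ncard_image]
  exact ⟨_, rfl⟩

open Classical in
/-- The other end point of an edge at `v`. -/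
noncomputable def otherEnd (v : V) (e : Sym2 V) : V :=
  if h : v ∈ e then Sym2.Mem.other h else v

lemma mk_otherEnd {v : V} {e : Sym2 V} (h : v ∈ e) : s(v, otherEnd v e) = e := by
  rw [otherEnd, dif_pos h, Sym2.other_spec h]

lemma otherEnd_injOn (v : V) : Set.InjOn (otherEnd v) {e | v ∈ e} := by
  intro e he e' he' h
  rw [← mk_otherEnd he, ← mk_otherEnd he', h]

lemma otherEnd_mk (v u : V) : otherEnd v s(v, u) = u :=
  Sym2.congr_right.1 (mk_otherEnd (Sym2.mem_mk_left v u))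

namespace IsTwoSided

variable (hK : K.IsTwoSided)
include hK

lemma finite_eulerTransform_edges : (eulerTransform K).edges.Finite :=
  PolyComplex.finite_eulerTransform_edges hK.finite_edges fun e he => by
    obtain ⟨s, t, -, h⟩ := hK.two_sides e he
    exact h ▸ Set.toFinite _

lemma exists_other_side {e : Sym2 V} (he : e ∈ K.edges) (s : Option (Set (Sym2 V))) :
    ∃ t ∈ sides K e, t ≠ s := exists_ne_of_pair (hK.two_sides e he) s

lemma sides_eq {e : Sym2 V} {s t : Option (Set (Sym2 V))} (hs : s ∈ sides K e)
    (ht : t ∈ sides K e) (hst : s ≠ t) : sides K e = {s, t} := by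
  have h2 := hK.two_sides e (mem_edges_of_mem_sides hs)
  ext r
  constructor
  · intro hr
    by_cases h : s = r
    · exact Or.inl h.symm
    · exact Or.inr (eq_of_mem_pair h2 hs hr ht h hst)
  · rintro (rfl | rfl)
    exacts [hs, ht]

lemma eq_of_sides {e e' : Sym2 V} {v : V} (hv : v ∈ e) (hv' : v ∈ e')
    {s t : Option (Set (Sym2 V))} (hst : s ≠ t) (hs : s ∈ sides K e) (ht : t ∈ sides K e)
    (hs' : s ∈ sides K e') (ht' : t ∈ sides K e') : e = e' :=
  hK.separated v e (mem_edges_of_mem_sides hs) hv e' (mem_edges_of_mem_sides hs') hv'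
    ((hK.sides_eq hs ht hst).trans (hK.sides_eq hs' ht' hst).symm)

/-- Each vertex of the Euler transformation has even degree. -/
theorem even_neighbors (x : ETVertex V) :
    Even {y | s(x, y) ∈ (eulerTransform K).edges}.ncard := by
  classical
  obtain ⟨s, v⟩ := x
  -- Each edge in `E` yields two neighbours: the other end of its copy on the side `s`, and the copy
  -- of `v` on its other side.
  let E : Set (Sym2 V) := {e | v ∈ e ∧ s ∈ sides K e}
  have hE : E.Finite := hK.finite_edges.subset fun e he => mem_edges_of_mem_sides he.2
  have hother : ∀ e, ∃ t, e ∈ E → t ∈ sides K e ∧ t ≠ s := by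
    intro e
    by_cases he : e ∈ E
    · obtain ⟨t, ht⟩ := hK.exists_other_side (mem_edges_of_mem_sides he.2) s
      exact ⟨t, fun _ => ht⟩
    · exact ⟨none, fun h => absurd h he⟩
  choose o ho using hother
  refine even_ncard_of_two_parts hE (fun e => (s, otherEnd v e)) (fun e => (o e, v)) ?_ ?_ ?_ ?_
  · intro e he e' he' h
    exact otherEnd_injOn v he.1 he'.1 (Prod.mk.inj h).2
  -- Two edges leading to the same copy of `v` have the same two sides and so are equal by
  -- `separated`.
  · intro e he e' he' h
    have h := (Prod.mk.inj h).1
    exact hK.eq_of_sides he.1 he'.1 (ho e he).2.symm he.2 (ho e he).1 he'.2 (h ▸ (ho e' he').1)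
  · intro e he e' he' h
    exact (ho e' he').2 (Prod.mk.inj h).1.symm
  · ext ⟨t, u⟩
    simp only [Set.mem_ofPred_eq, mk_mem_eulerTransform_edges, Set.mem_union, Set.mem_image,
      Prod.mk.injEq]
    constructor
    · rintro (⟨rfl, h⟩ | ⟨hne, rfl, e, hv, hs, ht⟩)
      · exact Or.inl ⟨s(v, u), ⟨Sym2.mem_mk_left _ _, h⟩, rfl, otherEnd_mk v u⟩
      · have he : e ∈ E := ⟨hv, hs⟩
        exact Or.inr ⟨e, he, eq_of_mem_pair (hK.two_sides e (mem_edges_of_mem_sides hs)) hs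
          (ho e he).1 ht (ho e he).2.symm hne, rfl⟩
    · rintro (⟨e, he, rfl, rfl⟩ | ⟨e, he, rfl, rfl⟩)
      · exact Or.inl ⟨rfl, (mk_otherEnd he.1).symm ▸ he.2⟩
      · exact Or.inr ⟨(ho e he).2.symm, rfl, e, he.1, he.2, (ho e he).1⟩

end IsTwoSided

/-! ### The polygons generated by the vertices of a mesh -/

namespace IsMesh

variable (hK : K.IsMesh)
include hK

/-- Adjacent edges with equal sides would be two boundary edges of one polygon, which boundary
separation forbids. So a mesh needs no preliminary transformation. -/
theorem isTwoSided : K.IsTwoSided where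
  finite_edges := hK.finite_edges
  not_isDiag := by
    rintro e ⟨P, hP, he⟩
    exact hK.not_isDiag P hP e he
  two_sides e he := hK.toIsLocallyPlanar.two_sides he
  separated := by
    intro v e he hv e' he' hv' h
    by_contra hne
    obtain ⟨s, t, hst, h2⟩ := hK.toIsLocallyPlanar.two_sides he
    have hs : s ∈ sides K e := h2 ▸ Set.mem_insert _ _
    have ht : t ∈ sides K e := h2 ▸ Set.mem_insert_of_mem _ rfl
    obtain ⟨f, hf, hef, hef', -, hb, hb'⟩ :=
      hK.boundary_of_ne hv hv' hne hst hs ht (h ▸ hs) (h ▸ ht)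
    exact hne (hK.boundary_separated f hf v e hef hv hb e' hef' hv' hb')

/-- The graph of the polygons at `v`; polygons with a common edge at `v` are adjacent. -/
def _root_.PolyComplex.fanGraph (K : PolyComplex V) (v : V) : SimpleGraph (Set (Sym2 V)) where
  Adj P Q := P ≠ Q ∧ P ∈ K ∧ Q ∈ K ∧ ∃ e, e ∈ P ∧ e ∈ Q ∧ v ∈ e
  symm := ⟨fun _ _ ⟨h, hP, hQ, e, heP, heQ, hv⟩ => ⟨h.symm, hQ, hP, e, heQ, heP, hv⟩⟩
  loopless := ⟨fun _ h => h.1 rfl⟩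

omit hK in
lemma fanGraph_reachable_iff {v : V} {f g : Set (Sym2 V)} :
    (fanGraph K v).Reachable f g ↔ g ∈ fan K v f := by
  constructor
  · rintro ⟨p⟩
    induction p with
    | nil => exact self_mem_fan _ _
    | cons h _ ih =>
      rw [← fan_eq (Relation.ReflTransGen.single h.2)]
      exact ih
  · intro h
    induction h with
    | refl => exact SimpleGraph.Reachable.refl _
    | tail _ h ih =>
      rename_i P Q _
      rcases eq_or_ne P Q with rfl | hne
      · exact ih
      · exact ih.trans (SimpleGraph.Adj.reachable (G := fanGraph K v) ⟨hne, h⟩)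

/-- At most two polygons of a fan have a boundary edge at the vertex of the fan. -/
lemma ncard_boundary_fan {v : V} {f : Set (Sym2 V)} (hf : f ∈ K) (hv : v ∈ polygonVertices f) :
    {g ∈ fan K v f | ∃ e ∈ g, v ∈ e ∧ IsBoundaryEdge K e}.ncard = 0 ∨
    {g ∈ fan K v f | ∃ e ∈ g, v ∈ e ∧ IsBoundaryEdge K e}.ncard = 2 := by
  classical
  have hfin : (fan K v f).Finite := hK.finite.subset fun g hg => mem_of_mem_fan hf hg
  let C := (fanGraph K v).connectedComponentMk f
  have hC : ∀ g, g ∈ hfin.toFinset ↔ g ∈ C.supp := by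
    intro g
    rw [Set.Finite.mem_toFinset, SimpleGraph.ConnectedComponent.mem_supp_iff,
      SimpleGraph.ConnectedComponent.eq, SimpleGraph.reachable_comm, fanGraph_reachable_iff]
  -- A polygon of the fan has two edges at `v`, at most one of them a boundary edge, so its degree
  -- in `fanGraph` falls short of 2 by one exactly if it has a boundary edge there.
  have h := C.sum_deficiency hfin.toFinset hC
    (fun g => if ∃ e ∈ g, v ∈ e ∧ IsBoundaryEdge K e then 1 else 0) ?_
  · rw [← Finset.card_filter] at h
    have hcard : {g ∈ fan K v f | ∃ e ∈ g, v ∈ e ∧ IsBoundaryEdge K e}.ncard =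
        (hfin.toFinset.filter fun g => ∃ e ∈ g, v ∈ e ∧ IsBoundaryEdge K e).card := by
      rw [← Set.ncard_coe_finset]
      congr 1
      ext g
      simp
    rwa [hcard]
  · intro g hg
    have hg : g ∈ fan K v f := by simpa using hg
    have hgK := mem_of_mem_fan hf hg
    obtain ⟨e₁, he₁, hv₁⟩ := mem_polygonVertices_of_mem_fan hv hg
    obtain ⟨e₂, he₂, hv₂, hne, hall⟩ := hK.exists_other_edge hgK he₁ hv₁
    have hnb : ∀ {h e}, h ∈ K → h ≠ g → e ∈ g → e ∈ h → ∀ h', h' ∈ K → h' ≠ g → e ∈ h' → h' = h := by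
      intro h e hh hhg heg heh h' hh' hhg' heh'
      rcases hK.two_polygons e h hh h' hh' g hgK heh heh' heg with h1 | h1 | h1
      exacts [h1.symm, absurd h1 hhg, absurd h1 hhg']
    have hnbs : ∀ h, h ∈ (fanGraph K v).neighborSet g ↔ h ∈ K ∧ h ≠ g ∧ (e₁ ∈ h ∨ e₂ ∈ h) := by
      intro h
      constructor
      · rintro ⟨h1, -, h2, e, h3, h4, h5⟩
        refine ⟨h2, h1.symm, ?_⟩
        rcases hall e h3 h5 with rfl | rfl
        exacts [Or.inl h4, Or.inr h4]
      · rintro ⟨h1, h2, h3 | h3⟩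
        exacts [⟨h2.symm, hgK, h1, e₁, he₁, h3, hv₁⟩, ⟨h2.symm, hgK, h1, e₂, he₂, h3, hv₂⟩]
    have hbd : (∃ e ∈ g, v ∈ e ∧ IsBoundaryEdge K e) ↔
        IsBoundaryEdge K e₁ ∨ IsBoundaryEdge K e₂ := by
      constructor
      · rintro ⟨e, he, hve, hb⟩
        rcases hall e he hve with rfl | rfl
        exacts [Or.inl hb, Or.inr hb]
      · rintro (hb | hb)
        exacts [⟨e₁, he₁, hv₁, hb⟩, ⟨e₂, he₂, hv₂, hb⟩]
    have hnotb : ∀ {h e}, h ∈ K → h ≠ g → e ∈ g → e ∈ h → ¬ IsBoundaryEdge K e :=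
      fun hh hhg heg heh hb => hhg (hb.unique ⟨hh, heh⟩ ⟨hgK, heg⟩)
    have hbnot : ∀ {e}, e ∈ g → IsBoundaryEdge K e → ∀ h ∈ K, h ≠ g → e ∉ h :=
      fun heg hb h hh hhg heh => hnotb hh hhg heg heh hb
    rcases IsLocallyPlanar.isBoundaryEdge_or hgK he₁ with hb₁ | ⟨h₁, hh₁, hg₁, heh₁⟩ <;>
    rcases IsLocallyPlanar.isBoundaryEdge_or hgK he₂ with hb₂ | ⟨h₂, hh₂, hg₂, heh₂⟩
    · exact absurd (hK.boundary_separated g hgK v e₁ he₁ hv₁ hb₁ e₂ he₂ hv₂ hb₂) hne.symm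
    · rw [if_pos (hbd.2 (Or.inl hb₁)), Set.ncard_eq_one.2 ⟨h₂, ?_⟩]
      ext h
      rw [hnbs, Set.mem_singleton_iff]
      constructor
      · rintro ⟨hh, hhg, h' | h'⟩
        · exact absurd h' (hbnot he₁ hb₁ h hh hhg)
        · exact hnb hh₂ hg₂ he₂ heh₂ h hh hhg h'
      · rintro rfl
        exact ⟨hh₂, hg₂, Or.inr heh₂⟩
    · rw [if_pos (hbd.2 (Or.inr hb₂)), Set.ncard_eq_one.2 ⟨h₁, ?_⟩]
      ext h
      rw [hnbs, Set.mem_singleton_iff]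
      constructor
      · rintro ⟨hh, hhg, h' | h'⟩
        · exact hnb hh₁ hg₁ he₁ heh₁ h hh hhg h'
        · exact absurd h' (hbnot he₂ hb₂ h hh hhg)
      · rintro rfl
        exact ⟨hh₁, hg₁, Or.inl heh₁⟩
    · have hnb' : ¬ (IsBoundaryEdge K e₁ ∨ IsBoundaryEdge K e₂) := by
        rintro (hb | hb)
        exacts [hnotb hh₁ hg₁ he₁ heh₁ hb, hnotb hh₂ hg₂ he₂ heh₂ hb]
      rw [if_neg (hbd.not.2 hnb'), Set.ncard_eq_two.2 ⟨h₁, h₂, ?_, ?_⟩]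
      -- Both edges lead to different neighbours, since two polygons of a mesh share at most one
      -- edge.
      · rintro rfl
        exact hne (hK.share_one g hgK h₁ hh₁ hg₁.symm e₁ he₁ heh₁ e₂ he₂ heh₂).symm
      ext h
      rw [hnbs, Set.mem_insert_iff, Set.mem_singleton_iff]
      constructor
      · rintro ⟨hh, hhg, h' | h'⟩
        · exact Or.inl (hnb hh₁ hg₁ he₁ heh₁ h hh hhg h')
        · exact Or.inr (hnb hh₂ hg₂ he₂ heh₂ h hh hhg h')
      · rintro (rfl | rfl)
        exacts [⟨hh₁, hg₁, Or.inl heh₁⟩, ⟨hh₂, hg₂, Or.inr heh₂⟩]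

/-- The polygon generated by a vertex of a mesh is a closed polygon. -/
lemma two_edges_vertexPolygon {v : V} {f : Set (Sym2 V)} (hf : f ∈ K)
    (hv : v ∈ polygonVertices f) {x : ETVertex V}
    (hx : x ∈ polygonVertices (vertexPolygon K v f)) :
    {a ∈ vertexPolygon K v f | x ∈ a}.ncard = 2 := by
  obtain ⟨a, ha, y, rfl⟩ := hx
  obtain ⟨s, u⟩ := x
  obtain ⟨t, w⟩ := y
  obtain ⟨hst, rfl, rfl, g', hg', e, he, hve, hs, ht⟩ := mem_vertexPolygon.1 ha
  simp only at hst hg' hve hs ht ha hv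
  have h2 := hK.isTwoSided
  -- At the unaltered copy the edges correspond to the polygons of the fan with a boundary edge, of
  -- which there are none or two; at the copy in `g` they correspond to the two edges of `g` at the
  -- vertex.
  rcases s with _ | g
  · have hset : {a ∈ vertexPolygon K w f | ((none, w) : ETVertex V) ∈ a} =
        (fun g => s(((none, w) : ETVertex V), (some g, w))) ''
          {g ∈ fan K w f | ∃ e ∈ g, w ∈ e ∧ IsBoundaryEdge K e} := by
      ext a
      constructor
      · rintro ⟨ha, ⟨t, u⟩, rfl⟩
        obtain ⟨hst, -, rfl, g', hg', e, he, hve, hs, ht⟩ := mem_vertexPolygon.1 ha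
        rcases t with _ | g
        · exact absurd rfl hst
        · refine ⟨g, ⟨mem_fan_of_mem_vertexPolygon hf (Sym2.eq_swap ▸ ha) rfl, e,
            (some_mem_sides.1 ht).2, hve, none_mem_sides.1 hs⟩, rfl⟩
      · rintro ⟨g, ⟨hg, e, he, hve, hb⟩, rfl⟩
        exact ⟨mem_vertexPolygon.2 ⟨by simp, rfl, rfl, g, hg, e, he, hve, none_mem_sides.2 hb,
          some_mem_sides.2 ⟨mem_of_mem_fan hf hg, he⟩⟩, Sym2.mem_mk_left _ _⟩
    have hinj : Function.Injective fun g => s(((none, w) : ETVertex V), (some g, w)) := by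
      intro g g' h
      simpa using h
    rw [hset, Set.ncard_image_of_injective _ hinj]
    refine (hK.ncard_boundary_fan hf hv).resolve_left ?_
    have hfin : {g ∈ fan K w f | ∃ e ∈ g, w ∈ e ∧ IsBoundaryEdge K e}.Finite :=
      hK.finite.subset fun g hg => mem_of_mem_fan hf hg.1
    rw [Set.ncard_eq_zero hfin]
    exact Set.Nonempty.ne_empty ⟨g', hg', e, he, hve, none_mem_sides.1 hs⟩
  · have hg := mem_fan_of_mem_vertexPolygon hf ha rfl
    have hgK := mem_of_mem_fan hf hg
    have heg := (some_mem_sides.1 hs).2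
    obtain ⟨e', heg', hve', hne, hall⟩ := hK.exists_other_edge hgK heg hve
    have hs' : some g ∈ sides K e' := some_mem_sides.2 ⟨hgK, heg'⟩
    obtain ⟨t', ht', htg'⟩ := h2.exists_other_side ⟨g, hgK, heg'⟩ (some g)
    refine Set.ncard_eq_two.2 ⟨s(((some g, w) : ETVertex V), (t, w)),
      s(((some g, w) : ETVertex V), (t', w)), ?_, ?_⟩
    · intro h
      rw [Sym2.congr_right, Prod.mk.injEq] at h
      obtain ⟨rfl, -⟩ := h
      exact hne (h2.eq_of_sides hve' hve hst hs' ht' hs ht)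
    · ext a
      constructor
      · rintro ⟨ha', ⟨r, u⟩, rfl⟩
        obtain ⟨hsr, -, rfl, g', hg', c, hc, hvc, hsc, hrc⟩ := mem_vertexPolygon.1 ha'
        simp only at hsr hsc hrc
        rcases hall c (some_mem_sides.1 hsc).2 hvc with rfl | rfl
        · rw [eq_of_mem_pair (h2.two_sides _ (mem_edges_of_mem_sides hs)) hs hrc ht hsr hst]
          exact Or.inl rfl
        · rw [eq_of_mem_pair (h2.two_sides _ (mem_edges_of_mem_sides hs')) hs' hrc ht' hsr
            htg'.symm]
          exact Or.inr rfl
      · rintro (rfl | rfl)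
        · exact ⟨ha, Sym2.mem_mk_left _ _⟩
        · exact ⟨mem_vertexPolygon.2 ⟨htg'.symm, rfl, rfl, g, hg, e', heg', hve', hs', ht'⟩,
            Sym2.mem_mk_left _ _⟩

/-- Each vertex of a polygon of a mesh generates a polygon. -/
lemma vertexPolygon_mem {v : V} {f : Set (Sym2 V)} (hf : f ∈ K) (hv : v ∈ polygonVertices f) :
    vertexPolygon K v f ∈ class3 K := by
  refine ⟨?_, f, hf, v, hv, rfl⟩
  obtain ⟨e, he, hve⟩ := hv
  obtain ⟨t, ht, htf⟩ := hK.isTwoSided.exists_other_side ⟨f, hf, he⟩ (some f)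
  exact hK.three_le_vertexPolygon hf he hve ht htf fun e' he' hve' ht' =>
    hK.isTwoSided.eq_of_sides hve' hve htf.symm (some_mem_sides.2 ⟨hf, he'⟩) ht'
      (some_mem_sides.2 ⟨hf, he⟩) ht

end IsMesh

end PolyComplex

/-! ### Identification of vertices by collapsed edges -/

namespace PolyComplex

variable {V : Type*} {K : PolyComplex V}

/-- A set of vertices that is closed under passing along edges of a connected polygon and contains
one of its vertices contains all of them. -/
lemma IsConnectedPolygon.subset {P : Set (Sym2 V)} (hP : IsConnectedPolygon P) {S : Set V}
    {v : V} (hv : v ∈ polygonVertices P) (hvS : v ∈ S)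
    (hS : ∀ x ∈ S, ∀ y, s(x, y) ∈ P → y ∈ S) : polygonVertices P ⊆ S := by
  intro w hw
  have h := hP v hv w hw
  clear hw
  induction h with
  | refl => exact hvS
  | tail _ h ih => exact hS _ ih _ h

namespace CombinatorialChange

variable (c : CombinatorialChange K)

/-- The projection to the vertices of the Euler transformation with combinatorial changes. -/
abbrev proj (x : ETVertex V) : c.Vertex := Quot.mk c.rel x

/-- Collapsed edges of `f`, as a graph. -/
abbrev collapsedGraph (f : Set (Sym2 V)) : SimpleGraph V :=
  SimpleGraph.fromEdgeSet (c.collapsed f)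

variable {c}

/-- The side on which a copy lies is constant on the classes, so an edge between copies on different
sides never shrinks to a point. -/
lemma fst_eq_of_proj_eq {x y : ETVertex V} (h : c.proj x = c.proj y) : x.1 = y.1 := by
  refine congrArg (Quot.lift (fun x : ETVertex V => x.1) ?_) h
  rintro _ _ ⟨f, -, u, v, -, rfl, rfl⟩
  rfl

/-- Only copies inside polygons are related by `c.rel`; the unaltered vertices are classes by
themselves. -/
lemma eq_of_proj_eq_of_none {x y : ETVertex V} (h : c.proj x = c.proj y) (hx : x.1 = none) :
    x = y := by
  classical
  have := congrArg (Quot.lift (fun x : ETVertex V => if x.1 = none then some x else none) ?_) h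
  · simp only [hx, if_true] at this
    rw [← fst_eq_of_proj_eq h, hx, if_pos rfl] at this
    exact Option.some.inj this
  · rintro _ _ ⟨f, -, u, v, -, rfl, rfl⟩
    simp

lemma eq_of_proj_eq_of_snd_eq {x y : ETVertex V} (h : c.proj x = c.proj y) (h2 : x.2 = y.2) :
    x = y := Prod.ext (fst_eq_of_proj_eq h) h2

lemma proj_eq_of_mem {f : Set (Sym2 V)} (hf : f ∈ K) {u v : V} (h : s(u, v) ∈ c.collapsed f) :
    c.proj (some f, u) = c.proj (some f, v) := Quot.sound ⟨f, hf, u, v, h, rfl, rfl⟩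

/-- The component in the graph of collapsed edges of `f` is an invariant of the class and can be
read off from the quotient. -/
lemma proj_eq_iff {f : Set (Sym2 V)} (hf : f ∈ K) {u v : V} :
    c.proj (some f, u) = c.proj (some f, v) ↔ (c.collapsedGraph f).Reachable u v := by
  classical
  constructor
  · intro h
    have := congrArg (Quot.lift (fun x : ETVertex V =>
      if x.1 = some f then some ((c.collapsedGraph f).connectedComponentMk x.2) else none) ?_) h
    · simpa using this
    · rintro _ _ ⟨g, -, u, v, huv, rfl, rfl⟩
      by_cases hg : g = f
      · subst hg
        simp only [if_true, Option.some.injEq, SimpleGraph.ConnectedComponent.eq]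
        by_cases huv' : u = v
        · rw [huv']
        · exact SimpleGraph.Adj.reachable ((SimpleGraph.fromEdgeSet_adj _).2 ⟨huv, huv'⟩)
      · simp [hg]
  · rintro ⟨p⟩
    induction p with
    | nil => rfl
    | cons h _ ih => exact (proj_eq_of_mem hf ((SimpleGraph.fromEdgeSet_adj _).1 h).1).trans ih

section Mesh

variable (hK : K.IsMesh)
include hK

/-- The ends of edges of `f` that are not collapsed, at the vertices that are identified with
`v`. -/
lemma ncard_ends {f : Set (Sym2 V)} (hf : f ∈ K) {v : V} (hv : v ∈ polygonVertices f) :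
    {p : V × Sym2 V | c.proj (some f, v) = c.proj (some f, p.1) ∧ p.2 ∈ f ∧
      p.2 ∉ c.collapsed f ∧ p.1 ∈ p.2}.ncard = 0 ∨
    {p : V × Sym2 V | c.proj (some f, v) = c.proj (some f, p.1) ∧ p.2 ∈ f ∧
      p.2 ∉ c.collapsed f ∧ p.1 ∈ p.2}.ncard = 2 := by
  classical
  have hffin := hK.finite_polygon f hf
  let C := (c.collapsedGraph f).connectedComponentMk v
  have hCmem : ∀ x, x ∈ C.supp ↔ c.proj (some f, v) = c.proj (some f, x) := by
    intro x
    rw [proj_eq_iff hf, SimpleGraph.ConnectedComponent.mem_supp_iff,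
      SimpleGraph.ConnectedComponent.eq, SimpleGraph.reachable_comm]
  have hCsub : C.supp ⊆ polygonVertices f := by
    intro x hx
    rw [hCmem, proj_eq_iff hf] at hx
    obtain ⟨p⟩ := hx
    clear hCmem C
    induction p with
    | nil => exact hv
    | cons h _ ih =>
      have := c.subset f hf ((SimpleGraph.fromEdgeSet_adj _).1 h).1
      exact ih ⟨_, this, Sym2.mem_mk_right _ _⟩
  have hVfin : (polygonVertices f).Finite := by
    have : polygonVertices f = ⋃ e ∈ f, {v | v ∈ e} := by
      ext x; simp [polygonVertices]
    rw [this]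
    refine hffin.biUnion fun e _ => ?_
    induction e with | _ a b
    refine (Set.toFinite {a, b}).subset fun v hv => ?_
    simpa using hv
  have hCfin := hVfin.subset hCsub
  let ends : V → Finset (Sym2 V) := fun x => hffin.toFinset.filter fun e =>
    e ∉ c.collapsed f ∧ x ∈ e
  -- At each vertex of `f` there are two edges, collapsed or not, so the ends of edges that are not
  -- collapsed are the deficiencies of the component.
  have h := C.sum_deficiency hCfin.toFinset (fun x => by simp) (fun x => (ends x).card) ?_
  · rw [← Finset.card_sigma] at h
    have hcard : {p : V × Sym2 V | c.proj (some f, v) = c.proj (some f, p.1) ∧ p.2 ∈ f ∧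
        p.2 ∉ c.collapsed f ∧ p.1 ∈ p.2}.ncard = (hCfin.toFinset.sigma ends).card := by
      rw [← Set.ncard_coe_finset]
      refine Set.ncard_congr (fun p _ => ⟨p.1, p.2⟩) ?_ ?_ ?_
      · rintro ⟨x, e⟩ ⟨h1, h2, h3, h4⟩
        simp only [Finset.coe_sigma, Set.mem_sigma_iff, Finset.mem_coe, Set.Finite.mem_toFinset,
          hCmem, ends, Finset.mem_filter]
        exact ⟨h1, h2, h3, h4⟩
      · rintro ⟨x, e⟩ ⟨x', e'⟩ - - h
        simpa using h
      · rintro ⟨x, e⟩ h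
        simp only [Finset.coe_sigma, Set.mem_sigma_iff, Finset.mem_coe, Set.Finite.mem_toFinset,
          hCmem, ends, Finset.mem_filter] at h
        exact ⟨(x, e), ⟨h.1, h.2.1, h.2.2⟩, rfl⟩
    rwa [hcard]
  · intro x hx
    have hxf : x ∈ polygonVertices f := hCsub (by simpa using hx)
    have h1 : ((c.collapsedGraph f).neighborSet x).ncard =
        {e ∈ f | x ∈ e ∧ e ∈ c.collapsed f}.ncard := by
      refine Set.ncard_congr (fun y _ => s(x, y)) ?_ ?_ ?_
      · intro y hy
        have := ((SimpleGraph.fromEdgeSet_adj _).1 hy).1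
        exact ⟨c.subset f hf this, Sym2.mem_mk_left _ _, this⟩
      · intro y y' _ _ h
        exact Sym2.congr_right.1 h
      · rintro e ⟨he, ⟨y, rfl⟩, hc⟩
        refine ⟨y, (SimpleGraph.fromEdgeSet_adj _).2 ⟨hc, ?_⟩, rfl⟩
        exact fun h => hK.not_isDiag f hf _ he (Sym2.mk_isDiag_iff.2 h)
    have h2 : (ends x).card = {e ∈ f | x ∈ e ∧ e ∉ c.collapsed f}.ncard := by
      rw [← Set.ncard_coe_finset]
      congr 1
      ext e
      simp [ends, and_comm]
    rw [h1, h2, ← Set.ncard_union_eq ?_ (hffin.subset fun e he => he.1)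
      (hffin.subset fun e he => he.1), ← hK.two_edges f hf x hxf]
    · congr 1
      ext e
      simp only [Set.mem_union, Set.mem_ofPred_eq]
      tauto
    · rw [Set.disjoint_left]
      exact fun e he he' => he'.2.2 he.2.2

/-- The form in which `ncard_ends` is applied: two known ends at an identified vertex are all ends
there. -/
lemma eq_of_three_ends {f : Set (Sym2 V)} (hf : f ∈ K) {v : V}
    {p q r : V × Sym2 V} (hpq : p ≠ q)
    (hp : c.proj (some f, v) = c.proj (some f, p.1) ∧ p.2 ∈ f ∧ p.2 ∉ c.collapsed f ∧ p.1 ∈ p.2)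
    (hq : c.proj (some f, v) = c.proj (some f, q.1) ∧ q.2 ∈ f ∧ q.2 ∉ c.collapsed f ∧ q.1 ∈ q.2)
    (hr : c.proj (some f, v) = c.proj (some f, r.1) ∧ r.2 ∈ f ∧ r.2 ∉ c.collapsed f ∧
      r.1 ∈ r.2) : r = p ∨ r = q := by
  have h := ncard_ends (c := c) hK hf (v := p.1) ⟨_, hp.2.1, hp.2.2.2⟩
  rw [← hp.1] at h
  rcases h with h | h
  -- The value 0 of `ncard` could also stand for an infinite set, which is excluded by the
  -- finiteness of `f`.
  · by_cases hfin : {p : V × Sym2 V | c.proj (some f, v) = c.proj (some f, p.1) ∧ p.2 ∈ f ∧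
      p.2 ∉ c.collapsed f ∧ p.1 ∈ p.2}.Finite
    · rw [Set.ncard_eq_zero hfin] at h
      exact (Set.eq_empty_iff_forall_notMem.1 h p hp).elim
    · exfalso
      apply hfin
      refine ((hK.finite_polygon f hf).biUnion (t := fun e => {p : V × Sym2 V | p.1 ∈ e ∧ p.2 = e})
        fun e _ => ?_).subset ?_
      · induction e with | _ a b
        refine (Set.toFinite {(a, s(a, b)), (b, s(a, b))}).subset ?_
        rintro ⟨x, e⟩ ⟨h1, rfl⟩
        rcases Sym2.mem_iff.1 h1 with h | h <;> simp only at h <;> subst h <;> simp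
      · rintro p ⟨-, h1, -, h2⟩
        exact Set.mem_biUnion h1 ⟨h2, rfl⟩
  · obtain ⟨a, b, hab, h⟩ := Set.ncard_eq_two.1 h
    have hall : ∀ p : V × Sym2 V, (c.proj (some f, v) = c.proj (some f, p.1) ∧ p.2 ∈ f ∧
        p.2 ∉ c.collapsed f ∧ p.1 ∈ p.2) → p = a ∨ p = b := by
      intro p hp
      have : p ∈ ({a, b} : Set (V × Sym2 V)) := h ▸ hp
      simpa using this
    rcases hall p hp with rfl | rfl <;> rcases hall q hq with rfl | rfl <;>
      rcases hall r hr with rfl | rfl <;> tauto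

/-- The end points of an edge of `f` are identified in the copy of `f` only if it is collapsed. -/
lemma mem_collapsed_of_proj_eq {f : Set (Sym2 V)} (hf : f ∈ K) {u v : V} (he : s(u, v) ∈ f)
    (h : c.proj (some f, u) = c.proj (some f, v)) : s(u, v) ∈ c.collapsed f := by
  by_contra hnc
  have huv : u ≠ v := fun h => hK.not_isDiag f hf _ he (Sym2.mk_isDiag_iff.2 h)
  -- The two ends of this one edge exhaust the ends at the identified vertex. Walking around `f`
  -- never leaves this class, so all other edges are collapsed, although three are left.
  have key : ∀ r : V × Sym2 V, (c.proj (some f, u) = c.proj (some f, r.1) ∧ r.2 ∈ f ∧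
      r.2 ∉ c.collapsed f ∧ r.1 ∈ r.2) → r.2 = s(u, v) := by
    intro r hr
    rcases eq_of_three_ends hK hf (p := (u, s(u, v))) (q := (v, s(u, v)))
      (fun h => huv (Prod.mk.inj h).1) ⟨rfl, he, hnc, Sym2.mem_mk_left _ _⟩
      ⟨h, he, hnc, Sym2.mem_mk_right _ _⟩ hr with rfl | rfl <;> rfl
  have hall : polygonVertices f ⊆ {x | c.proj (some f, u) = c.proj (some f, x)} := by
    refine (hK.connected_polygon f hf).subset (v := u) ⟨_, he, Sym2.mem_mk_left _ _⟩ rfl ?_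
    intro x hx y hxy
    by_cases hc : s(x, y) ∈ c.collapsed f
    · exact Eq.trans hx (proj_eq_of_mem hf hc)
    · have := key (x, s(x, y)) ⟨hx, hxy, hc, Sym2.mem_mk_left _ _⟩
      have hy : y ∈ s(u, v) := this ▸ Sym2.mem_mk_right _ _
      rcases Sym2.mem_iff.1 hy with rfl | rfl
      exacts [rfl, h]
  have hsub : f \ c.collapsed f ⊆ {s(u, v)} := by
    rintro e ⟨hef, hec⟩
    induction e with | _ x y
    exact key (x, s(x, y)) ⟨hall ⟨_, hef, Sym2.mem_mk_left _ _⟩, hef, hec, Sym2.mem_mk_left _ _⟩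
  have := (c.three_le f hf).trans (Set.encard_le_encard hsub)
  rw [Set.encard_singleton] at this
  exact absurd this (by norm_num)

/-- Different edges of `f` that are not collapsed get different end points. -/
lemma eq_of_proj_eq_of_proj_eq {f : Set (Sym2 V)} (hf : f ∈ K) {u v u' v' : V}
    (he : s(u, v) ∈ f) (he' : s(u', v') ∈ f) (hc : s(u, v) ∉ c.collapsed f)
    (hc' : s(u', v') ∉ c.collapsed f) (hu : c.proj (some f, u) = c.proj (some f, u'))
    (hv : c.proj (some f, v) = c.proj (some f, v')) : s(u, v) = s(u', v') := by
  by_contra hne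
  -- The two edges exhaust the ends at both of their common end points. So the walk around `f` stays
  -- in two classes, and only two edges would be left.
  have key : ∀ r : V × Sym2 V, (c.proj (some f, u) = c.proj (some f, r.1) ∧ r.2 ∈ f ∧
      r.2 ∉ c.collapsed f ∧ r.1 ∈ r.2) → r = (u, s(u, v)) ∨ r = (u', s(u', v')) := by
    intro r hr
    exact eq_of_three_ends hK hf (fun h => hne (Prod.mk.inj h).2)
      ⟨rfl, he, hc, Sym2.mem_mk_left _ _⟩ ⟨hu, he', hc', Sym2.mem_mk_left _ _⟩ hr
  have key' : ∀ r : V × Sym2 V, (c.proj (some f, v) = c.proj (some f, r.1) ∧ r.2 ∈ f ∧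
      r.2 ∉ c.collapsed f ∧ r.1 ∈ r.2) → r = (v, s(u, v)) ∨ r = (v', s(u', v')) := by
    intro r hr
    exact eq_of_three_ends hK hf (fun h => hne (Prod.mk.inj h).2)
      ⟨rfl, he, hc, Sym2.mem_mk_right _ _⟩ ⟨hv, he', hc', Sym2.mem_mk_right _ _⟩ hr
  have hall : polygonVertices f ⊆ {x | c.proj (some f, u) = c.proj (some f, x) ∨
      c.proj (some f, v) = c.proj (some f, x)} := by
    refine (hK.connected_polygon f hf).subset (v := u) ⟨_, he, Sym2.mem_mk_left _ _⟩
      (Or.inl rfl) ?_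
    intro x hx y hxy
    by_cases hcxy : s(x, y) ∈ c.collapsed f
    · exact Or.imp (fun h => h.trans (proj_eq_of_mem hf hcxy))
        (fun h => h.trans (proj_eq_of_mem hf hcxy)) hx
    · have hy : y ∈ s(u, v) ∨ y ∈ s(u', v') := by
        have hmem : y ∈ s(x, y) := Sym2.mem_mk_right _ _
        rcases hx with hx | hx
        · rcases key (x, s(x, y)) ⟨hx, hxy, hcxy, Sym2.mem_mk_left _ _⟩ with h | h
          exacts [Or.inl ((Prod.mk.inj h).2 ▸ hmem), Or.inr ((Prod.mk.inj h).2 ▸ hmem)]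
        · rcases key' (x, s(x, y)) ⟨hx, hxy, hcxy, Sym2.mem_mk_left _ _⟩ with h | h
          exacts [Or.inl ((Prod.mk.inj h).2 ▸ hmem), Or.inr ((Prod.mk.inj h).2 ▸ hmem)]
      simp only [Sym2.mem_iff] at hy
      rcases hy with (rfl | rfl) | (rfl | rfl)
      exacts [Or.inl rfl, Or.inr rfl, Or.inl hu, Or.inr hv]
  have hsub : f \ c.collapsed f ⊆ {s(u, v), s(u', v')} := by
    rintro e ⟨hef, hec⟩
    induction e with | _ x y
    rcases hall ⟨_, hef, Sym2.mem_mk_left x y⟩ with hx | hx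
    · rcases key (x, s(x, y)) ⟨hx, hef, hec, Sym2.mem_mk_left _ _⟩ with h | h
      exacts [Or.inl (Prod.mk.inj h).2, Or.inr (Prod.mk.inj h).2]
    · rcases key' (x, s(x, y)) ⟨hx, hef, hec, Sym2.mem_mk_left _ _⟩ with h | h
      exacts [Or.inl (Prod.mk.inj h).2, Or.inr (Prod.mk.inj h).2]
  have := (c.three_le f hf).trans (Set.encard_le_encard hsub)
  rw [Set.encard_pair hne] at this
  exact absurd this (by norm_num)

end Mesh

end CombinatorialChange

end PolyComplex

namespace PolyComplex

variable {V : Type*} {K : PolyComplex V}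

/-! ### Connected polygons -/

lemma reflTransGen_symm {E : Set (Sym2 V)} {x y : V}
    (h : Relation.ReflTransGen (fun x y => s(x, y) ∈ E) x y) :
    Relation.ReflTransGen (fun x y => s(x, y) ∈ E) y x := by
  induction h with
  | refl => exact Relation.ReflTransGen.refl
  | tail _ h ih => exact Relation.ReflTransGen.head (Sym2.eq_swap ▸ h) ih

lemma isConnectedPolygon_of_center {P : Set (Sym2 V)} (z : V)
    (h : ∀ x ∈ polygonVertices P, Relation.ReflTransGen (fun x y => s(x, y) ∈ P) z x) :
    IsConnectedPolygon P :=
  fun x hx y hy => (reflTransGen_symm (h x hx)).trans (h y hy)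

lemma isConnectedPolygon_vertexPolygon {v : V} {f : Set (Sym2 V)} (hf : f ∈ K) :
    IsConnectedPolygon (vertexPolygon K v f) := by
  have hfan : ∀ g ∈ fan K v f, Relation.ReflTransGen
      (fun x y => s(x, y) ∈ vertexPolygon K v f) (some f, v) (some g, v) := by
    intro g hg
    induction hg with
    | refl => exact Relation.ReflTransGen.refl
    | @tail P Q hP h ih =>
      rcases eq_or_ne P Q with rfl | hne
      · exact ih
      · obtain ⟨hPK, hQK, e, heP, heQ, hv⟩ := h
        exact ih.tail (mem_vertexPolygon.2 ⟨by simpa using hne, rfl, rfl, P, hP, e, heP, hv,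
          some_mem_sides.2 ⟨hPK, heP⟩, some_mem_sides.2 ⟨hQK, heQ⟩⟩)
  refine isConnectedPolygon_of_center (some f, v) ?_
  rintro ⟨s, u⟩ ⟨a, ha, ⟨t, w⟩, rfl⟩
  have h := ha
  obtain ⟨hst, rfl, rfl, -⟩ := mem_vertexPolygon.1 h
  rcases s with _ | g
  · rcases t with _ | g
    · exact absurd rfl hst
    · have ha' : s(((some g, w) : ETVertex V), (none, w)) ∈ vertexPolygon K w f :=
        Sym2.eq_swap ▸ ha
      exact (hfan g (mem_fan_of_mem_vertexPolygon hf ha' rfl)).tail ha'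
  · exact hfan g (mem_fan_of_mem_vertexPolygon hf ha rfl)

/-! ### Images of polygons and local planarity of the affected subcomplex -/

namespace CombinatorialChange

variable {c : CombinatorialChange K}

lemma mem_image_iff {P : Set (Sym2 (ETVertex V))} {p q : c.Vertex} :
    s(p, q) ∈ c.image P ↔ p ≠ q ∧ ∃ x y, s(x, y) ∈ P ∧ c.proj x = p ∧ c.proj y = q := by
  simp only [image, Set.mem_ofPred_eq, Sym2.mk_isDiag_iff, Set.mem_image]
  constructor
  · rintro ⟨⟨a, ha, h⟩, hne⟩
    refine ⟨hne, ?_⟩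
    induction a with | _ x y
    rcases Sym2.eq_iff.1 h with ⟨rfl, rfl⟩ | ⟨rfl, rfl⟩
    · exact ⟨x, y, ha, rfl, rfl⟩
    · exact ⟨y, x, Sym2.eq_swap ▸ ha, rfl, rfl⟩
  · rintro ⟨hne, x, y, h, rfl, rfl⟩
    exact ⟨⟨_, h, rfl⟩, hne⟩

lemma mk_mem_image {P : Set (Sym2 (ETVertex V))} {x y : ETVertex V} (h : s(x, y) ∈ P)
    (hne : x.1 ≠ y.1) : s(c.proj x, c.proj y) ∈ c.image P :=
  mem_image_iff.2 ⟨fun h => hne (fst_eq_of_proj_eq h), x, y, h, rfl, rfl⟩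

lemma isConnectedPolygon_image {P : Set (Sym2 (ETVertex V))} (hP : IsConnectedPolygon P) :
    IsConnectedPolygon (c.image P) := by
  have hstep : ∀ {x y}, Relation.ReflTransGen (fun x y => s(x, y) ∈ P) x y →
      Relation.ReflTransGen (fun x y => s(x, y) ∈ c.image P) (c.proj x) (c.proj y) := by
    intro x y h
    induction h with
    | refl => exact Relation.ReflTransGen.refl
    | @tail b d _ h ih =>
      by_cases hne : c.proj b = c.proj d
      · exact hne ▸ ih
      · exact ih.tail (mem_image_iff.2 ⟨hne, _, _, h, rfl, rfl⟩)
  have hv : ∀ p ∈ polygonVertices (c.image P), ∃ x ∈ polygonVertices P, c.proj x = p := by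
    rintro p ⟨a, ha, q, rfl⟩
    obtain ⟨-, x, y, h, rfl, rfl⟩ := mem_image_iff.1 ha
    exact ⟨x, ⟨_, h, Sym2.mem_mk_left _ _⟩, rfl⟩
  intro p hp q hq
  obtain ⟨x, hx, rfl⟩ := hv p hp
  obtain ⟨y, hy, rfl⟩ := hv q hq
  exact hstep (hP x hx y hy)

section Mesh

variable (hK : K.IsMesh)
include hK

lemma image_edgePolygon_eq {g h : Set (Sym2 V)} (hg : g ∈ K) (hh : h ∈ K) (hne : g ≠ h) {u v : V}
    (hug : s(u, v) ∈ c.collapsed g) (huh : s(u, v) ∈ c.collapsed h) :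
    c.image (edgePolygon K s(u, v)) = {s(c.proj (some g, u), c.proj (some h, u))} := by
  have heg := c.subset g hg hug
  have heh := c.subset h hh huh
  have hsg : some g ∈ sides K s(u, v) := some_mem_sides.2 ⟨hg, heg⟩
  have hsh : some h ∈ sides K s(u, v) := some_mem_sides.2 ⟨hh, heh⟩
  have hne' : some g ≠ some h := by simpa using hne
  have hsides := hK.isTwoSided.sides_eq hsg hsh hne'
  ext a
  induction a with | _ p q
  constructor
  · intro ha
    obtain ⟨hpq, ⟨s, a⟩, ⟨t, b⟩, hab, rfl, rfl⟩ := mem_image_iff.1 ha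
    obtain ⟨hs, ht, hc⟩ := mem_edgePolygon.1 hab
    simp only [hsides, Set.mem_insert_iff, Set.mem_singleton_iff] at hs ht
    simp only at hc
    have hcol : ∀ k, k ∈ K → s(u, v) ∈ c.collapsed k → ∀ a, a ∈ s(u, v) →
        c.proj (some k, a) = c.proj (some k, u) := by
      intro k hk hkc a ha
      rcases Sym2.mem_iff.1 ha with rfl | rfl
      exacts [rfl, (proj_eq_of_mem hk hkc).symm]
    rcases hc with ⟨rfl, h1⟩ | ⟨hst, rfl, hau⟩
    · exfalso
      apply hpq
      rcases hs with rfl | rfl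
      · exact proj_eq_of_mem hg (h1 ▸ hug)
      · exact proj_eq_of_mem hh (h1 ▸ huh)
    · rcases hs with rfl | rfl <;> rcases ht with rfl | rfl
      · exact absurd rfl hst
      · rw [hcol g hg hug a hau, hcol h hh huh a hau]
        rfl
      · rw [hcol g hg hug a hau, hcol h hh huh a hau]
        exact Sym2.eq_swap
      · exact absurd rfl hst
  · rintro h
    rw [h]
    exact mk_mem_image (mem_edgePolygon.2 ⟨hsg, hsh, Or.inr ⟨hne', rfl, Sym2.mem_mk_left _ _⟩⟩)
      hne'

lemma mem_collapsed_of_proj_eq' {s : Option (Set (Sym2 V))} {u v : V} (hs : s ∈ sides K s(u, v))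
    (h : c.proj (s, u) = c.proj (s, v)) : ∃ g ∈ K, s = some g ∧ s(u, v) ∈ c.collapsed g := by
  rcases s with _ | g
  · have := (Prod.mk.inj (eq_of_proj_eq_of_none h rfl)).2
    subst this
    exact absurd (Sym2.mk_isDiag_iff.2 rfl)
      (hK.isTwoSided.not_isDiag _ (mem_edges_of_mem_sides hs))
  · rw [some_mem_sides] at hs
    exact ⟨g, hs.1, rfl, mem_collapsed_of_proj_eq hK hs.1 hs.2 h⟩

/-- The two crossing edges of a quadrangle survive. If the image is a single edge they coincide, so
both copies of the edge are collapsed and both sides are polygons. -/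
lemma mem_collapsedEdges_iff {a : Sym2 c.Vertex} :
    a ∈ c.collapsedEdges ↔ ∃ g ∈ K, ∃ h ∈ K, g ≠ h ∧ ∃ u v, s(u, v) ∈ c.collapsed g ∧
      s(u, v) ∈ c.collapsed h ∧ a = s(c.proj (some g, u), c.proj (some h, u)) := by
  constructor
  · rintro ⟨e, he, h⟩
    obtain ⟨s, t, hst, hsides⟩ := hK.isTwoSided.two_sides e he
    have hs : s ∈ sides K e := hsides ▸ Set.mem_insert _ _
    have ht : t ∈ sides K e := hsides ▸ Set.mem_insert_of_mem _ rfl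
    induction e with | _ u v
    have h1 : s(c.proj (s, u), c.proj (t, u)) ∈ c.image (edgePolygon K s(u, v)) :=
      mk_mem_image (mem_edgePolygon.2 ⟨hs, ht, Or.inr ⟨hst, rfl, Sym2.mem_mk_left _ _⟩⟩) hst
    have h2 : s(c.proj (s, v), c.proj (t, v)) ∈ c.image (edgePolygon K s(u, v)) :=
      mk_mem_image (mem_edgePolygon.2 ⟨hs, ht, Or.inr ⟨hst, rfl, Sym2.mem_mk_right _ _⟩⟩) hst
    rw [h, Set.mem_singleton_iff] at h1 h2
    have h3 := h1.trans h2.symm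
    rcases Sym2.eq_iff.1 h3 with ⟨h4, h5⟩ | ⟨h4, -⟩
    · obtain ⟨g, hg, rfl, hgc⟩ := mem_collapsed_of_proj_eq' hK hs h4
      obtain ⟨k, hk, rfl, hkc⟩ := mem_collapsed_of_proj_eq' hK ht h5
      exact ⟨g, hg, k, hk, fun h => hst (h ▸ rfl), u, v, hgc, hkc, h1.symm⟩
    · exact absurd (fst_eq_of_proj_eq h4) hst
  · rintro ⟨g, hg, h, hh, hne, u, v, hug, huh, rfl⟩
    exact ⟨s(u, v), ⟨g, hg, c.subset g hg hug⟩, image_edgePolygon_eq hK hg hh hne hug huh⟩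

/-- Two polygons that are generated by vertices have an edge in common only if it is an edge to
which a quadrangle has collapsed. -/
lemma share_vertexPolygon {v v' : V} {f f' : Set (Sym2 V)} (hf : f ∈ K) (hf' : f' ∈ K)
    {x y x' y' : ETVertex V} (h : s(x, y) ∈ vertexPolygon K v f)
    (h' : s(x', y') ∈ vertexPolygon K v' f') (hx : c.proj x = c.proj x')
    (hy : c.proj y = c.proj y') :
    vertexPolygon K v f = vertexPolygon K v' f' ∨
    ∃ g ∈ K, ∃ k ∈ K, g ≠ k ∧ v ≠ v' ∧ x = (some g, v) ∧ y = (some k, v) ∧ s(v, v') ∈ g ∧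
      s(v, v') ∈ k ∧ s(v, v') ∈ c.collapsed g ∧ s(v, v') ∈ c.collapsed k ∧
      vertexPolygon K v g = vertexPolygon K v f ∧
      vertexPolygon K v' g = vertexPolygon K v' f' := by
  obtain ⟨s, u⟩ := x
  obtain ⟨t, w⟩ := y
  obtain ⟨s', u'⟩ := x'
  obtain ⟨t', w'⟩ := y'
  have hs : s = s' := fst_eq_of_proj_eq hx
  have ht : t = t' := fst_eq_of_proj_eq hy
  subst hs ht
  obtain ⟨hst, rfl, rfl, g₁, hg₁, e, he, hve, hse, hte⟩ := mem_vertexPolygon.1 h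
  obtain ⟨-, rfl, rfl, g₂, hg₂, e', he', hve', hse', hte'⟩ := mem_vertexPolygon.1 h'
  simp only at hst hve hse hte hve' hse' hte' h h' hx hy ⊢
  have hpol : ∀ {g}, (s = some g ∨ t = some g) →
      vertexPolygon K w g = vertexPolygon K w f ∧ vertexPolygon K w' g = vertexPolygon K w' f' := by
    rintro g (rfl | rfl)
    · exact ⟨vertexPolygon_eq (mem_fan_of_mem_vertexPolygon hf h rfl),
        vertexPolygon_eq (mem_fan_of_mem_vertexPolygon hf' h' rfl)⟩
    · exact ⟨vertexPolygon_eq (mem_fan_of_mem_vertexPolygon hf (Sym2.eq_swap ▸ h) rfl),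
        vertexPolygon_eq (mem_fan_of_mem_vertexPolygon hf' (Sym2.eq_swap ▸ h') rfl)⟩
  -- For equal vertices, a polygon on one side of the edge belongs to both fans, so the fans agree.
  by_cases hww : w = w'
  · subst hww
    obtain ⟨g, -, -, hg⟩ := IsLocallyPlanar.exists_some_of_ne hst hse hte
    exact Or.inl ((hpol hg).1.symm.trans (hpol hg).2)
  · right
    rcases s with _ | g
    · exact absurd (Prod.mk.inj (eq_of_proj_eq_of_none hx rfl)).2 hww
    rcases t with _ | k
    · exact absurd (Prod.mk.inj (eq_of_proj_eq_of_none hy rfl)).2 hww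
    rw [some_mem_sides] at hse hte hse' hte'
    have hgk : g ≠ k := fun h => hst (h ▸ rfl)
    -- Since `g` and `k` share only one edge, this edge contains both vertices and hence joins them.
    have hee := hK.share_one g hse.1 k hte.1 hgk e hse.2 hte.2 e' hse'.2 hte'.2
    subst hee
    have heq : e = s(w, w') := by
      obtain ⟨z, rfl⟩ := hve
      rcases Sym2.mem_iff.1 hve' with h | h
      · exact absurd h.symm hww
      · rw [h]
    subst heq
    exact ⟨g, hse.1, k, hte.1, hgk, hww, rfl, rfl, hse.2, hte.2,
      mem_collapsed_of_proj_eq hK hse.1 hse.2 hx, mem_collapsed_of_proj_eq hK hte.1 hte.2 hy,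
      hpol (Or.inl rfl)⟩

omit hK in
lemma exists_of_mem_class3 {P : Set (Sym2 (ETVertex V))} (hP : P ∈ class3 K) :
    ∃ f ∈ K, ∃ v ∈ polygonVertices f, P = vertexPolygon K v f := hP.2

omit hK in
lemma exists_of_mem_affected {Q : Set (Sym2 c.Vertex)} (hQ : Q ∈ c.affected) :
    ∃ f ∈ K, ∃ v ∈ polygonVertices f, Q = c.image (vertexPolygon K v f) := by
  obtain ⟨⟨P, hP, rfl⟩, -⟩ := hQ
  obtain ⟨f, hf, v, hv, rfl⟩ := exists_of_mem_class3 hP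
  exact ⟨f, hf, v, hv, rfl⟩

/-- An edge in two polygons generated by vertices is an edge to which a quadrangle has
collapsed. -/
lemma mem_collapsedEdges_of_mem_of_mem {P P' : Set (Sym2 (ETVertex V))} (hP : P ∈ class3 K)
    (hP' : P' ∈ class3 K) (hne : c.image P ≠ c.image P') {a : Sym2 c.Vertex}
    (ha : a ∈ c.image P) (ha' : a ∈ c.image P') : a ∈ c.collapsedEdges := by
  obtain ⟨f, hf, v, -, rfl⟩ := exists_of_mem_class3 hP
  obtain ⟨f', hf', v', -, rfl⟩ := exists_of_mem_class3 hP'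
  induction a with | _ p q
  obtain ⟨-, x, y, h, rfl, rfl⟩ := mem_image_iff.1 ha
  obtain ⟨-, x', y', h', hx, hy⟩ := mem_image_iff.1 ha'
  rcases share_vertexPolygon hK hf hf' h h' hx.symm hy.symm with h1 |
    ⟨g, hg, k, hk, hgk, -, rfl, rfl, -, -, hcg, hck, -⟩
  · exact absurd (congrArg c.image h1) hne
  · exact (mem_collapsedEdges_iff hK).2 ⟨g, hg, k, hk, hgk, v, v', hcg, hck, rfl⟩

/-- The vertices of a Class 3 polygon are copies of one vertex on different sides, so collapsing
identifies none of them and the cycle is carried over unchanged. -/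
lemma two_edges_image {P : Set (Sym2 (ETVertex V))} (hP : P ∈ class3 K) {w : c.Vertex}
    (hw : w ∈ polygonVertices (c.image P)) : {a ∈ c.image P | w ∈ a}.ncard = 2 := by
  obtain ⟨f, hf, v, hv, rfl⟩ := exists_of_mem_class3 hP
  obtain ⟨a, ha, q, rfl⟩ := hw
  obtain ⟨-, x, y, h, rfl, rfl⟩ := mem_image_iff.1 ha
  rw [← hK.two_edges_vertexPolygon hf hv ⟨_, h, Sym2.mem_mk_left _ _⟩]
  symm
  have hx2 := (mem_vertexPolygon.1 h).2.1
  refine Set.ncard_congr (fun a _ => Sym2.map c.proj a) ?_ ?_ ?_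
  · rintro a ⟨ha, z, rfl⟩
    exact ⟨mk_mem_image ha (mem_vertexPolygon.1 ha).1, Sym2.mem_mk_left _ _⟩
  · rintro a b ⟨ha, z, rfl⟩ ⟨hb, z', rfl⟩ h
    have h := Sym2.congr_right.1 h
    rw [eq_of_proj_eq_of_snd_eq h ((mem_vertexPolygon.1 ha).2.2.1.trans
      (mem_vertexPolygon.1 hb).2.2.1.symm)]
  · rintro b ⟨hb, q, rfl⟩
    obtain ⟨-, x', y', h', hx, rfl⟩ := mem_image_iff.1 hb
    have := eq_of_proj_eq_of_snd_eq hx ((mem_vertexPolygon.1 h').2.1.trans hx2.symm)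
    subst this
    exact ⟨s(x', y'), ⟨h', Sym2.mem_mk_left _ _⟩, rfl⟩

/-- A shared edge joins copies in two polygons `g` and `k` of `K`, and the Class 3 polygons that
share it belong to the two end points of the only common edge of `g` and `k`; hence there are at
most two. Conversely two Class 3 polygons determine this edge, hence `g` and `k`, hence the shared
edge. -/
theorem isLocallyPlanar_affected : c.affected.IsLocallyPlanar where
  finite := by
    have h := (hK.isTwoSided.finite_eulerTransform_edges.finite_subsets).image c.image
    refine h.subset ?_
    rintro _ ⟨⟨P, hP, rfl⟩, -⟩
    exact ⟨P, fun a ha => ⟨P, Or.inr hP, ha⟩, rfl⟩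
  finite_polygon := by
    rintro _ ⟨⟨P, hP, rfl⟩, -⟩
    refine Set.Finite.subset (Set.Finite.image _ (hK.isTwoSided.finite_eulerTransform_edges.subset
      fun a ha => ⟨P, Or.inr hP, ha⟩ : P.Finite)) fun a ha => ha.1
  not_isDiag := by
    rintro _ ⟨⟨P, hP, rfl⟩, -⟩ e he
    exact he.2
  two_edges := by
    rintro _ ⟨⟨P, hP, rfl⟩, -⟩ w hw
    exact two_edges_image hK hP hw
  two_polygons := by
    intro a P hP Q hQ R hR haP haQ haR
    obtain ⟨f, hf, v, -, rfl⟩ := exists_of_mem_affected hP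
    obtain ⟨f', hf', v', -, rfl⟩ := exists_of_mem_affected hQ
    obtain ⟨f'', hf'', v'', -, rfl⟩ := exists_of_mem_affected hR
    induction a with | _ p q
    obtain ⟨-, x, y, h, rfl, rfl⟩ := mem_image_iff.1 haP
    obtain ⟨-, x', y', h', hx, hy⟩ := mem_image_iff.1 haQ
    obtain ⟨-, x'', y'', h'', hx', hy'⟩ := mem_image_iff.1 haR
    rcases share_vertexPolygon hK hf hf' h h' hx.symm hy.symm with h1 |
      ⟨g, hg, k, hk, hgk, -, rfl, rfl, heg, hek, -, -, -, h1⟩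
    · exact Or.inl (congrArg c.image h1)
    rcases share_vertexPolygon hK hf hf'' h h'' hx'.symm hy'.symm with h2 |
      ⟨g', -, k', -, -, -, hgg, hkk, heg', hek', -, -, -, h2⟩
    · exact Or.inr (Or.inl (congrArg c.image h2))
    right; right
    simp only [Prod.mk.injEq, Option.some.injEq, and_true] at hgg hkk
    subst hgg hkk
    have := Sym2.congr_right.1 (hK.share_one g hg k hk hgk _ heg hek _ heg' hek')
    subst this
    rw [← h1, ← h2]
  share := by
    intro P hP Q hQ hne w a haP haQ _ a' haP' haQ' _
    obtain ⟨f, hf, v, -, rfl⟩ := exists_of_mem_affected hP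
    obtain ⟨f', hf', v', -, rfl⟩ := exists_of_mem_affected hQ
    induction a with | _ p q
    induction a' with | _ p' q'
    obtain ⟨-, x, y, h, rfl, rfl⟩ := mem_image_iff.1 haP
    obtain ⟨-, x', y', h', hx, hy⟩ := mem_image_iff.1 haQ
    obtain ⟨-, z, t, k, rfl, rfl⟩ := mem_image_iff.1 haP'
    obtain ⟨-, z', t', k', hz, ht⟩ := mem_image_iff.1 haQ'
    rcases share_vertexPolygon hK hf hf' h h' hx.symm hy.symm with h1 |
      ⟨g₁, hg₁, g₂, hg₂, hg, -, rfl, rfl, h1, h2, -⟩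
    · exact absurd (congrArg c.image h1) hne
    rcases share_vertexPolygon hK hf hf' k k' hz.symm ht.symm with h3 |
      ⟨g₃, hg₃, g₄, hg₄, hg', -, rfl, rfl, h3, h4, -⟩
    · exact absurd (congrArg c.image h3) hne
    have h123 := hK.two_polygons _ g₁ hg₁ g₂ hg₂ g₃ hg₃ h1 h2 h3
    have h124 := hK.two_polygons _ g₁ hg₁ g₂ hg₂ g₄ hg₄ h1 h2 h4
    rcases h123 with h | rfl | rfl
    · exact absurd h hg
    · rcases h124 with h | h | rfl
      exacts [absurd h hg, absurd h hg', rfl]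
    · rcases h124 with h | rfl | h
      exacts [absurd h hg, Sym2.eq_swap, absurd h hg']

omit hK in
lemma isConnectedPolygon_of_mem_affected {Q : Set (Sym2 c.Vertex)} (hQ : Q ∈ c.affected) :
    IsConnectedPolygon Q := by
  obtain ⟨f, hf, v, -, rfl⟩ := exists_of_mem_affected hQ
  exact isConnectedPolygon_image (isConnectedPolygon_vertexPolygon hf)

/-- In a complex of polygons generated by vertices each fan has a boundary edge. -/
lemma exists_boundary_fan {L : PolyComplex c.Vertex} (hL : L ⊆ c.affected)
    {Q : Set (Sym2 c.Vertex)} (hQ : Q ∈ L) {w : c.Vertex} (hw : w ∈ polygonVertices Q) :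
    ∃ R ∈ fan L w Q, ∃ a ∈ R, w ∈ a ∧ IsBoundaryEdge L a := by
  by_contra! hno
  have hnext : ∀ R ∈ fan L w Q, ∀ a ∈ R, w ∈ a → ∃ R' ∈ L, R' ≠ R ∧ a ∈ R' := by
    intro R hR a ha hwa
    exact (IsLocallyPlanar.isBoundaryEdge_or (mem_of_mem_fan hQ hR) ha).resolve_left
      (hno R hR a ha hwa)
  obtain ⟨f₀, hf₀, v, hv, rfl⟩ := exists_of_mem_affected (hL hQ)
  obtain ⟨a, ha, q, rfl⟩ := hw
  obtain ⟨-, ⟨s, u⟩, y, h, rfl, rfl⟩ := mem_image_iff.1 ha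
  obtain rfl : u = v := (mem_vertexPolygon.1 h).2.1
  rcases s with _ | f
  -- A shared edge joins copies in two polygons, so an edge at an unaltered vertex is never shared.
  · obtain ⟨R', hR', hne, haR'⟩ := hnext _ (self_mem_fan _ _) _ ha (Sym2.mem_mk_left _ _)
    obtain ⟨f', hf', v', -, rfl⟩ := exists_of_mem_affected (hL hR')
    obtain ⟨-, x', y', h', hx, hy⟩ := mem_image_iff.1 haR'
    rcases share_vertexPolygon hK hf₀ hf' h h' hx.symm hy.symm with h1 |
      ⟨g, -, -, -, -, -, h1, -⟩
    · exact hne (congrArg c.image h1).symm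
    · simp at h1
  · have hfan := mem_fan_of_mem_vertexPolygon hf₀ h rfl
    have hf := mem_of_mem_fan hf₀ hfan
    set Q := c.image (vertexPolygon K u f₀) with hQdef
    set w := c.proj (some f, u) with hwdef
    -- For `x` in `S` and an edge `s(x, y)` of `f`, the polygon of `L` across the corresponding edge
    -- at `w` can only be the one generated by `y`, and then `s(x, y)` is collapsed and `y` is in
    -- `S`. Walking around, all edges of `f` turn out to be collapsed.
    let S : Set V := {z | z ∈ polygonVertices f ∧ c.image (vertexPolygon K z f) ∈ fan L w Q ∧
      c.proj (some f, z) = w}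
    have hstep : ∀ x ∈ S, ∀ y, s(x, y) ∈ f → y ∈ S ∧ s(x, y) ∈ c.collapsed f := by
      rintro x ⟨hxf, hxfan, hxw⟩ y hxy
      obtain ⟨t, ht, htf⟩ := hK.isTwoSided.exists_other_side ⟨f, hf, hxy⟩ (some f)
      have hP : s(((some f, x) : ETVertex V), (t, x)) ∈ vertexPolygon K x f :=
        IsLocallyPlanar.mem_vertexPolygon_of_sides hxy (Sym2.mem_mk_left _ _) htf.symm
          (some_mem_sides.2 ⟨hf, hxy⟩) ht
      have ha := mk_mem_image (c := c) hP htf.symm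
      have hwa : w ∈ s(c.proj (some f, x), c.proj (t, x)) := hxw ▸ Sym2.mem_mk_left _ _
      obtain ⟨R', hR', hne, haR'⟩ := hnext _ hxfan _ ha hwa
      have hR'fan := mem_fan_of_mem hxfan (mem_of_mem_fan hQ hxfan) hR' ha haR' hwa
      obtain ⟨f', hf', x', -, rfl⟩ := exists_of_mem_affected (hL hR')
      obtain ⟨-, z, z', h', hz, hz'⟩ := mem_image_iff.1 haR'
      rcases share_vertexPolygon hK hf hf' hP h' hz.symm hz'.symm with h1 |
        ⟨g, hg, k, hk, hgk, -, hgf, hkt, heg, hek, hcg, -, -, h1⟩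
      · exact absurd (congrArg c.image h1).symm hne
      simp only [Prod.mk.injEq, Option.some.injEq, and_true] at hgf hkt
      subst hgf hkt
      have := Sym2.congr_right.1 (hK.share_one f hf k hk hgk _ heg hek _ hxy
        (some_mem_sides.1 ht).2)
      subst this
      rw [← h1] at hR'fan
      exact ⟨⟨⟨_, hxy, Sym2.mem_mk_right _ _⟩, hR'fan, (proj_eq_of_mem hf hcg).symm.trans hxw⟩, hcg⟩
    have huf : u ∈ polygonVertices f := mem_polygonVertices_of_mem_fan hv hfan
    have huS : u ∈ S := ⟨huf, by rw [vertexPolygon_eq hfan]; exact self_mem_fan _ _, rfl⟩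
    have hall := (hK.connected_polygon f hf).subset huf huS fun x hx y hxy => (hstep x hx y hxy).1
    have hempty : f \ c.collapsed f = ∅ := by
      rw [Set.eq_empty_iff_forall_notMem]
      rintro e ⟨hef, hec⟩
      induction e with | _ x y
      exact hec (hstep x (hall ⟨_, hef, Sym2.mem_mk_left _ _⟩) y hef).2
    have := c.three_le f hf
    rw [hempty, Set.encard_empty] at this
    exact absurd this (by norm_num)

end Mesh

end CombinatorialChange

end PolyComplex

namespace PolyComplex

variable {V : Type*} {K : PolyComplex V}

/-! ### Parity of the part that is not replaced -/

lemma even_ncard_biUnion {α β : Type*} {U : Set α} (hU : U.Finite) {T : α → Set β}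
    (hfin : ∀ i ∈ U, (T i).Finite) (heven : ∀ i ∈ U, Even (T i).ncard)
    (hdisj : ∀ i ∈ U, ∀ j ∈ U, i ≠ j → Disjoint (T i) (T j)) :
    Even (⋃ i ∈ U, T i).ncard := by
  induction U, hU using Set.Finite.induction_on with
  | empty => simp
  | @insert i U hi hU ih =>
    have hU' : ∀ j ∈ U, j ∈ insert i U := fun j hj => Set.mem_insert_of_mem _ hj
    rw [Set.biUnion_insert, Set.ncard_union_eq _ (hfin i (Set.mem_insert _ _))
      (hU.biUnion fun j hj => hfin j (hU' j hj))]
    · exact (heven i (Set.mem_insert _ _)).add (ih (fun j hj => hfin j (hU' j hj))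
        (fun j hj => heven j (hU' j hj)) fun j hj k hk => hdisj j (hU' j hj) k (hU' k hk))
    · rw [Set.disjoint_iUnion₂_right]
      intro j hj
      exact hdisj i (Set.mem_insert _ _) j (hU' j hj) fun h => hi (h ▸ hj)

namespace CombinatorialChange

variable (c : CombinatorialChange K)

/-- The edges that are copies of edges of `K`. -/
def copyEdges : Set (Sym2 c.Vertex) :=
  {a | ∃ x y, x.1 = y.1 ∧ c.proj x ≠ c.proj y ∧ s(x, y) ∈ K.eulerTransform.edges ∧
    a = s(c.proj x, c.proj y)}

/-- The edges that join copies of a vertex of `K`. -/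
def crossEdges : Set (Sym2 c.Vertex) :=
  {a | ∃ x y, x.1 ≠ y.1 ∧ s(x, y) ∈ K.eulerTransform.edges ∧ a = s(c.proj x, c.proj y)}

variable {c}

lemma mem_crossEdges_of_mem_class3 {P : Set (Sym2 (ETVertex V))} (hP : P ∈ class3 K)
    {a : Sym2 c.Vertex} (ha : a ∈ c.image P) : a ∈ c.crossEdges := by
  have hP' : P ∈ K.eulerTransform := Or.inr hP
  obtain ⟨f, hf, v, -, rfl⟩ := exists_of_mem_class3 hP
  induction a with | _ p q
  obtain ⟨-, x, y, h, rfl, rfl⟩ := mem_image_iff.1 ha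
  exact ⟨x, y, (mem_vertexPolygon.1 h).1, ⟨_, hP', h⟩, rfl⟩

lemma disjoint_copyEdges_crossEdges : Disjoint c.copyEdges c.crossEdges := by
  rw [Set.disjoint_left]
  rintro _ ⟨x, y, h, -, -, rfl⟩ ⟨x', y', h', -, heq⟩
  rcases Sym2.eq_iff.1 heq with ⟨h1, h2⟩ | ⟨h1, h2⟩
  · exact h' ((fst_eq_of_proj_eq h1).symm.trans (h.trans (fst_eq_of_proj_eq h2)))
  · exact h' ((fst_eq_of_proj_eq h2).symm.trans (h.symm.trans (fst_eq_of_proj_eq h1)))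

lemma notMem_affected_of_mem_copyEdges {Q : Set (Sym2 c.Vertex)} {a : Sym2 c.Vertex}
    (ha : a ∈ Q) (hc : a ∈ c.copyEdges) : Q ∉ c.affected := by
  rintro ⟨⟨P, hP, rfl⟩, -⟩
  exact Set.disjoint_left.1 disjoint_copyEdges_crossEdges hc (mem_crossEdges_of_mem_class3 hP ha)

section Mesh

variable (hK : K.IsMesh)
include hK

lemma exists_class3_of_cross {x y : ETVertex V} (hne : x.1 ≠ y.1)
    (h : s(x, y) ∈ K.eulerTransform.edges) : ∃ P ∈ class3 K, s(x, y) ∈ P := by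
  rcases mk_mem_eulerTransform_edges.1 h with ⟨h1, -⟩ | ⟨-, hxy, e, he, hs, ht⟩
  · exact absurd h1 hne
  · obtain ⟨s, v⟩ := x
    obtain ⟨t, w⟩ := y
    obtain rfl : v = w := hxy
    obtain ⟨f, hf, hef, -⟩ := IsLocallyPlanar.exists_some_of_ne hne hs ht
    exact ⟨_, hK.vertexPolygon_mem hf ⟨e, hef, he⟩,
      IsLocallyPlanar.mem_vertexPolygon_of_sides hef he hne hs ht⟩

/-- A quadrangle remains a polygon unless both copies of its edge are collapsed. -/
lemma image_edgePolygon_mem {s : Option (Set (Sym2 V))} {u v : V} (hs : s ∈ sides K s(u, v))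
    (hne : c.proj (s, u) ≠ c.proj (s, v)) :
    c.image (edgePolygon K s(u, v)) ∈ c.eulerTransform \ c.affected := by
  have he := mem_edges_of_mem_sides hs
  obtain ⟨t, ht, hts⟩ := hK.isTwoSided.exists_other_side he s
  have h1 : s(c.proj (s, u), c.proj (s, v)) ∈ c.image (edgePolygon K s(u, v)) :=
    mem_image_iff.2 ⟨hne, (s, u), (s, v), mem_edgePolygon.2 ⟨hs, hs, Or.inl ⟨rfl, rfl⟩⟩, rfl, rfl⟩
  have h2 : s(c.proj (s, u), c.proj (t, u)) ∈ c.image (edgePolygon K s(u, v)) :=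
    mk_mem_image (mem_edgePolygon.2 ⟨hs, ht, Or.inr ⟨hts.symm, rfl, Sym2.mem_mk_left _ _⟩⟩) hts.symm
  have h3 : s(c.proj (s, v), c.proj (t, v)) ∈ c.image (edgePolygon K s(u, v)) :=
    mk_mem_image (mem_edgePolygon.2 ⟨hs, ht, Or.inr ⟨hts.symm, rfl, Sym2.mem_mk_right _ _⟩⟩)
      hts.symm
  have hst : ∀ a b, c.proj (s, a) ≠ c.proj (t, b) := fun a b h => hts (fst_eq_of_proj_eq h).symm
  refine ⟨⟨?_, _, edgePolygon_mem he, rfl⟩, notMem_affected_of_mem_copyEdges h1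
    ⟨(s, u), (s, v), rfl, hne, mem_eulerTransform_edges.2 ⟨_, he, mem_edgePolygon.2
      ⟨hs, hs, Or.inl ⟨rfl, rfl⟩⟩⟩, rfl⟩⟩
  rw [← Set.encard_eq_three.2 ⟨s(c.proj (s, u), c.proj (s, v)), s(c.proj (s, u), c.proj (t, u)),
    s(c.proj (s, v), c.proj (t, v)), ?_, ?_, ?_, rfl⟩]
  · refine Set.encard_le_encard ?_
    rintro a (rfl | rfl | rfl)
    exacts [h1, h2, h3]
  · intro h
    exact hst _ _ (Sym2.congr_right.1 h)
  · intro h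
    rcases Sym2.eq_iff.1 h with ⟨h, -⟩ | ⟨h, -⟩
    exacts [hne h, hst _ _ h]
  · intro h
    rcases Sym2.eq_iff.1 h with ⟨h, -⟩ | ⟨h, -⟩
    exacts [hne h, hst _ _ h]

lemma copyEdges_subset : c.copyEdges ⊆ edges (c.eulerTransform \ c.affected) := by
  rintro _ ⟨⟨s, u⟩, ⟨t, v⟩, hst, hne, h, rfl⟩
  obtain rfl : s = t := hst
  rcases mk_mem_eulerTransform_edges.1 h with ⟨-, hs⟩ | ⟨h1, -⟩
  · exact ⟨_, image_edgePolygon_mem hK hs hne, mem_image_iff.2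
      ⟨hne, (s, u), (s, v), mem_edgePolygon.2 ⟨hs, hs, Or.inl ⟨rfl, rfl⟩⟩, rfl, rfl⟩⟩
  · exact absurd rfl h1

/-- The quadrangle on which the edge lies is still a polygon, as otherwise it would have collapsed
to this very edge; and no quadrangle with a copied edge left is affected. -/
lemma crossEdges_sdiff_subset :
    c.crossEdges \ c.collapsedEdges ⊆ edges (c.eulerTransform \ c.affected) := by
  rintro _ ⟨⟨⟨s, u⟩, ⟨t, v⟩, hst, h, rfl⟩, hnc⟩
  rcases mk_mem_eulerTransform_edges.1 h with ⟨h1, -⟩ | ⟨-, huv, e, hue, hs, ht⟩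
  · exact absurd h1 hst
  obtain rfl : u = v := huv
  obtain ⟨w, rfl⟩ := hue
  have hmem : s(c.proj (s, u), c.proj (t, u)) ∈ c.image (edgePolygon K s(u, w)) :=
    mk_mem_image (mem_edgePolygon.2 ⟨hs, ht, Or.inr ⟨hst, rfl, Sym2.mem_mk_left _ _⟩⟩) hst
  by_cases h1 : c.proj (s, u) = c.proj (s, w)
  · by_cases h2 : c.proj (t, u) = c.proj (t, w)
    · obtain ⟨g, hg, rfl, hgc⟩ := mem_collapsed_of_proj_eq' hK hs h1
      obtain ⟨k, hk, rfl, hkc⟩ := mem_collapsed_of_proj_eq' hK ht h2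
      exact absurd ((mem_collapsedEdges_iff hK).2 ⟨g, hg, k, hk, fun h => hst (h ▸ rfl), u, w, hgc,
        hkc, rfl⟩) hnc
    · exact ⟨_, image_edgePolygon_mem hK ht h2, hmem⟩
  · exact ⟨_, image_edgePolygon_mem hK hs h1, hmem⟩

/-- The edges of the complex without the subcomplex that is replaced. -/
theorem edges_sdiff_affected : edges (c.eulerTransform \ c.affected) =
    c.copyEdges ∪ (c.crossEdges \ c.collapsedEdges) := by
  refine Set.Subset.antisymm ?_ (Set.union_subset (copyEdges_subset hK)
    (crossEdges_sdiff_subset hK))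
  rintro a ⟨Q, ⟨⟨h3, P, hP, rfl⟩, hQ⟩, ha⟩
  induction a with | _ p q
  obtain ⟨hpq, x, y, h, rfl, rfl⟩ := mem_image_iff.1 ha
  have hET : s(x, y) ∈ K.eulerTransform.edges := ⟨P, hP, h⟩
  by_cases hxy : x.1 = y.1
  · exact Or.inl ⟨x, y, hxy, hpq, hET, rfl⟩
  refine Or.inr ⟨⟨x, y, hxy, hET, rfl⟩, fun hc => ?_⟩
  -- An edge to which a quadrangle collapsed is not on a Class 1 polygon; the only quadrangle with
  -- it is the collapsed one, which is no longer a polygon; and a Class 3 polygon containing it is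
  -- affected.
  rcases hP with (⟨f, hf, rfl⟩ | ⟨e, he, rfl⟩) | hP
  · rw [mem_copyPolygon] at h
    exact hxy (h.1.trans h.2.1.symm)
  · obtain ⟨g, hg, k, hk, hgk, u, v, hgc, hkc, heq⟩ := (mem_collapsedEdges_iff hK).1 hc
    obtain ⟨hs, ht, -⟩ := mem_edgePolygon.1 h
    have hgke : e ∈ g ∧ e ∈ k := by
      rcases Sym2.eq_iff.1 heq with ⟨h1, h2⟩ | ⟨h1, h2⟩
      · rw [fst_eq_of_proj_eq h1, some_mem_sides] at hs
        rw [fst_eq_of_proj_eq h2, some_mem_sides] at ht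
        exact ⟨hs.2, ht.2⟩
      · rw [fst_eq_of_proj_eq h1, some_mem_sides] at hs
        rw [fst_eq_of_proj_eq h2, some_mem_sides] at ht
        exact ⟨ht.2, hs.2⟩
    obtain rfl := hK.share_one g hg k hk hgk e hgke.1 hgke.2 _ (c.subset g hg hgc)
      (c.subset k hk hkc)
    rw [image_edgePolygon_eq hK hg hk hgk hgc hkc, Set.encard_singleton] at h3
    exact absurd h3 (by norm_num)
  · exact hQ ⟨⟨P, hP, rfl⟩, _, hc, ha⟩

/-- The number of boundary edges at a vertex is even. -/
lemma even_ncard_boundaryEdges (v : V) : Even {e | v ∈ e ∧ IsBoundaryEdge K e}.ncard := by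
  have h2 := hK.isTwoSided
  have hfin : K.eulerTransform.edges.Finite := h2.finite_eulerTransform_edges
  have hclass : (class3 K).Finite := hfin.finite_subsets.subset
    fun P hP a ha => ⟨P, Or.inr hP, ha⟩
  -- The boundary edges at `v` correspond to the crossing edges at the unaltered copy of `v`.
  -- Edge-disjoint Class 3 cycles partition these, with two edges each.
  have heven := even_ncard_biUnion hclass
    (T := fun P => {a ∈ P | ((none, v) : ETVertex V) ∈ a}) ?_ ?_ ?_
  · have hpol : ∀ e, ∃ g, IsBoundaryEdge K e → g ∈ K ∧ e ∈ g := by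
      intro e
      by_cases he : IsBoundaryEdge K e
      · obtain ⟨g, hg, -⟩ := he
        exact ⟨g, fun _ => hg⟩
      · exact ⟨∅, fun h => absurd h he⟩
    choose g hg using hpol
    have hcard := Set.ncard_congr (s := {e | v ∈ e ∧ IsBoundaryEdge K e})
      (t := ⋃ P ∈ class3 K, {a ∈ P | ((none, v) : ETVertex V) ∈ a})
      (fun e _ => s(((none, v) : ETVertex V), (some (g e), v))) ?_ ?_ ?_
    · rwa [hcard]
    · rintro e ⟨hve, hb⟩
      obtain ⟨hgK, heg⟩ := hg e hb
      refine Set.mem_biUnion (hK.vertexPolygon_mem hgK ⟨e, heg, hve⟩) ⟨?_, Sym2.mem_mk_left _ _⟩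
      exact IsLocallyPlanar.mem_vertexPolygon_of_sides heg hve (by simp) (none_mem_sides.2 hb)
        (some_mem_sides.2 ⟨hgK, heg⟩)
    · rintro e e' ⟨hve, hb⟩ ⟨hve', hb'⟩ h
      have h : g e = g e' := by simpa using h
      obtain ⟨hgK, heg⟩ := hg e hb
      exact hK.boundary_separated _ hgK v e heg hve hb e' (h ▸ (hg e' hb').2) hve' hb'
    · intro a ha
      obtain ⟨P, hP, ha, ⟨t, u⟩, rfl⟩ := Set.mem_iUnion₂.1 ha
      obtain ⟨f, hf, w, -, rfl⟩ := exists_of_mem_class3 hP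
      obtain ⟨hst, rfl, rfl, k, hk, e, he, hve, hs, ht⟩ := mem_vertexPolygon.1 ha
      simp only at hst hs ht hve
      rw [none_mem_sides] at hs
      refine ⟨e, ⟨hve, hs⟩, ?_⟩
      rcases t with _ | t
      · exact absurd rfl hst
      · rw [hs.unique (hg e hs) (some_mem_sides.1 ht)]
  · intro P hP
    exact (hfin.subset fun a ha => ⟨P, Or.inr hP, ha⟩ : P.Finite).subset fun a ha => ha.1
  · intro P hP
    obtain ⟨f, hf, w, hw, rfl⟩ := exists_of_mem_class3 hP
    by_cases hx : ((none, v) : ETVertex V) ∈ polygonVertices (vertexPolygon K w f)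
    · rw [hK.two_edges_vertexPolygon hf hw hx]
      exact even_two
    · have : {a ∈ vertexPolygon K w f | ((none, v) : ETVertex V) ∈ a} = ∅ :=
        Set.eq_empty_iff_forall_notMem.2 fun a ha => hx ⟨a, ha.1, ha.2⟩
      rw [this, Set.ncard_empty]
      exact Even.zero
  · intro P hP P' hP' hne
    rw [Set.disjoint_left]
    rintro a ⟨ha, -⟩ ⟨ha', -⟩
    obtain ⟨f, hf, w, hw, rfl⟩ := exists_of_mem_class3 hP
    obtain ⟨f', hf', w', hw', rfl⟩ := exists_of_mem_class3 hP'
    induction a with | _ x y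
    obtain ⟨h1, h2, -, g, hg, e, he, hve, hs, ht⟩ := mem_vertexPolygon.1 ha
    obtain rfl : w = w' := h2.symm.trans (mem_vertexPolygon.1 ha').2.1
    obtain ⟨k, -, -, hk⟩ := IsLocallyPlanar.exists_some_of_ne h1 hs ht
    apply hne
    rcases hk with hk | hk
    · rw [← vertexPolygon_eq (mem_fan_of_mem_vertexPolygon hf ha hk),
        ← vertexPolygon_eq (mem_fan_of_mem_vertexPolygon hf' ha' hk)]
    · rw [Sym2.eq_swap] at ha ha'
      rw [← vertexPolygon_eq (mem_fan_of_mem_vertexPolygon hf ha hk),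
        ← vertexPolygon_eq (mem_fan_of_mem_vertexPolygon hf' ha' hk)]

/-- The number of copies of edges at a vertex is even. -/
lemma even_ncard_copyEdges (w : c.Vertex) : Even {a ∈ c.copyEdges | w ∈ a}.ncard := by
  have hrep : ∀ a ∈ c.copyEdges, w ∈ a → ∃ s u v, s ∈ sides K s(u, v) ∧
      c.proj (s, u) ≠ c.proj (s, v) ∧ w = c.proj (s, u) ∧
      a = s(c.proj (s, u), c.proj (s, v)) := by
    rintro _ ⟨⟨s, u⟩, ⟨t, v⟩, hst, hne, h, rfl⟩ hw
    obtain rfl : s = t := hst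
    rcases mk_mem_eulerTransform_edges.1 h with ⟨-, hs⟩ | ⟨h1, -⟩
    · rcases Sym2.mem_iff.1 hw with rfl | rfl
      · exact ⟨s, u, v, hs, hne, rfl, rfl⟩
      · exact ⟨s, v, u, Sym2.eq_swap ▸ hs, hne.symm, rfl, Sym2.eq_swap⟩
    · exact absurd rfl h1
  by_cases hempty : {a ∈ c.copyEdges | w ∈ a} = ∅
  · rw [hempty, Set.ncard_empty]
    exact Even.zero
  obtain ⟨a, ha, hwa⟩ := Set.nonempty_iff_ne_empty.2 hempty
  obtain ⟨s, u, v, hs, -, rfl, -⟩ := hrep a ha hwa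
  clear hwa ha a hempty
  -- At an unaltered vertex the copies are the boundary edges of `K` there; at a vertex inside `f`
  -- they are the ends counted by `ncard_ends`.
  rcases s with _ | f
  · rw [← Set.ncard_congr (s := {e | u ∈ e ∧ IsBoundaryEdge K e})
      (fun e _ => Sym2.map (fun z => c.proj (none, z)) e)]
    · exact even_ncard_boundaryEdges hK u
    · rintro e ⟨⟨z, rfl⟩, hb⟩
      rw [← none_mem_sides] at hb
      refine ⟨⟨(none, u), (none, z), rfl, fun h => ?_, mk_mem_eulerTransform_edges.2
        (Or.inl ⟨rfl, hb⟩), rfl⟩, Sym2.mem_mk_left _ _⟩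
      have := (Prod.mk.inj (eq_of_proj_eq_of_none h rfl)).2
      exact hK.isTwoSided.not_isDiag _ (mem_edges_of_mem_sides hb) (Sym2.mk_isDiag_iff.2 this)
    · intro e e' _ _ h
      refine Sym2.map.injective ?_ h
      intro z z' h
      exact (Prod.mk.inj (eq_of_proj_eq_of_none h rfl)).2
    · rintro a ⟨ha, hwa⟩
      obtain ⟨s, u', v', hs', -, hw, rfl⟩ := hrep a ha hwa
      have := eq_of_proj_eq_of_none hw rfl
      cases this
      exact ⟨s(u, v'), ⟨Sym2.mem_mk_left _ _, none_mem_sides.1 hs'⟩, rfl⟩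
  · rw [some_mem_sides] at hs
    obtain ⟨hf, huv⟩ := hs
    have huf : u ∈ polygonVertices f := ⟨_, huv, Sym2.mem_mk_left _ _⟩
    rw [← Set.ncard_congr (s := {p : V × Sym2 V | c.proj (some f, u) = c.proj (some f, p.1) ∧
      p.2 ∈ f ∧ p.2 ∉ c.collapsed f ∧ p.1 ∈ p.2})
      (fun p _ => Sym2.map (fun z => c.proj (some f, z)) p.2)]
    · rcases ncard_ends (c := c) hK hf huf with h | h
      · rw [h]; exact Even.zero
      · rw [h]; exact even_two
    · rintro ⟨x, e⟩ ⟨hx, hef, hec, hxe⟩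
      simp only at hx hef hec hxe ⊢
      obtain ⟨y, rfl⟩ := hxe
      refine ⟨⟨(some f, x), (some f, y), rfl, fun h => hec (mem_collapsed_of_proj_eq hK hf hef h),
        mk_mem_eulerTransform_edges.2 (Or.inl ⟨rfl, some_mem_sides.2 ⟨hf, hef⟩⟩), rfl⟩, ?_⟩
      rw [hx]
      exact Sym2.mem_mk_left _ _
    · rintro ⟨x, e⟩ ⟨x', e'⟩ ⟨hx, hef, hec, hxe⟩ ⟨hx', hef', hec', hxe'⟩ h
      simp only at hx hef hec hxe hx' hef' hec' hxe' h
      obtain ⟨y, rfl⟩ := hxe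
      obtain ⟨y', rfl⟩ := hxe'
      simp only [Sym2.map_mk] at h
      rw [← hx, ← hx', Sym2.congr_right] at h
      have heq := eq_of_proj_eq_of_proj_eq hK hf hef hef' hec hec' (hx.symm.trans hx') h
      rcases Sym2.eq_iff.1 heq with ⟨rfl, rfl⟩ | ⟨rfl, rfl⟩
      · rfl
      -- Both ends of one edge at the same point would mean that this edge is collapsed.
      · exact absurd (mem_collapsed_of_proj_eq hK hf hef (hx.symm.trans hx')) hec
    · rintro a ⟨ha, hwa⟩
      obtain ⟨s, u', v', hs', hne, hw, rfl⟩ := hrep a ha hwa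
      obtain rfl : some f = s := fst_eq_of_proj_eq hw
      rw [some_mem_sides] at hs'
      exact ⟨(u', s(u', v')), ⟨hw, hs'.2, fun h => hne (proj_eq_of_mem hf h),
        Sym2.mem_mk_left _ _⟩, rfl⟩

end Mesh

section Pieces

variable {pieces : Set (PolyComplex c.Vertex)}
  (hpieces : IsEdgeDisjointDecomposition c.affected pieces)
include hpieces

lemma subset_affected {L : PolyComplex c.Vertex} (hL : L ∈ pieces) : L ⊆ c.affected :=
  hpieces.sUnion_eq ▸ Set.subset_sUnion_of_mem hL

lemma exists_piece {Q : Set (Sym2 c.Vertex)} (hQ : Q ∈ c.affected) : ∃ L ∈ pieces, Q ∈ L := by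
  rw [← hpieces.sUnion_eq] at hQ
  exact hQ

lemma piece_eq {L M : PolyComplex c.Vertex} (hL : L ∈ pieces) (hM : M ∈ pieces)
    {a : Sym2 c.Vertex} (ha : a ∈ edges L) (ha' : a ∈ edges M) : L = M := by
  by_contra hne
  exact Set.disjoint_left.1 (hpieces.edge_disjoint hL hM hne) ha ha'

/-- Among the edges at a vertex that are not replaced, the number of those that are not boundary
edges of one of the pieces is even. -/
theorem even_ncard_remaining (hK : K.IsMesh) (w : c.Vertex) :
    Even {a | w ∈ a ∧ a ∈ edges (c.eulerTransform \ c.affected) ∧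
      ¬ ∃ L ∈ pieces, IsBoundaryEdge L a}.ncard := by
  let U : Set (Set (Sym2 c.Vertex)) := {Q | (∃ P ∈ class3 K, Q = c.image P) ∧ Q ∉ c.affected}
  have hETfin := hK.isTwoSided.finite_eulerTransform_edges
  have hU : U.Finite := by
    refine (hETfin.finite_subsets.image c.image).subset ?_
    rintro _ ⟨⟨P, hP, rfl⟩, -⟩
    exact ⟨P, fun a ha => ⟨P, Or.inr hP, ha⟩, rfl⟩
  have hQfin : ∀ Q ∈ U, Q.Finite := by
    rintro _ ⟨⟨P, hP, rfl⟩, -⟩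
    exact Set.Finite.subset (Set.Finite.image _ (hETfin.subset
      fun a ha => ⟨P, Or.inr hP, ha⟩ : P.Finite)) fun a ha => ha.1
  have hshare : ∀ P ∈ class3 K, ∀ P' ∈ class3 K, c.image P ≠ c.image P' → ∀ a ∈ c.image P,
      a ∈ c.image P' → c.image P ∈ c.affected := fun P hP P' hP' hne a ha ha' =>
    ⟨⟨P, hP, rfl⟩, a, mem_collapsedEdges_of_mem_of_mem hK hP hP' hne ha ha', ha⟩
  -- A crossing edge to which no quadrangle has collapsed lies on just one Class 3 polygon. If that
  -- polygon is affected, the edge is a boundary edge of its piece and drops out; otherwise the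
  -- whole polygon remains.
  have hset : {a | w ∈ a ∧ a ∈ edges (c.eulerTransform \ c.affected) ∧
      ¬ ∃ L ∈ pieces, IsBoundaryEdge L a} =
      {a ∈ c.copyEdges | w ∈ a} ∪ ⋃ Q ∈ U, {a ∈ Q | w ∈ a} := by
    ext a
    simp only [Set.mem_union, Set.mem_iUnion₂, Set.mem_ofPred_eq, edges_sdiff_affected hK,
      Set.mem_sdiff]
    constructor
    · rintro ⟨hwa, ha | ⟨ha, hnc⟩, hnb⟩
      · exact Or.inl ⟨ha, hwa⟩
      · right
        obtain ⟨x, y, hxy, hET, rfl⟩ := ha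
        obtain ⟨P, hP, h⟩ := exists_class3_of_cross hK hxy hET
        have haP := mk_mem_image (c := c) h hxy
        refine ⟨c.image P, ⟨⟨P, hP, rfl⟩, fun haff => hnb ?_⟩, haP, hwa⟩
        obtain ⟨L, hL, hPL⟩ := exists_piece hpieces haff
        refine ⟨L, hL, ?_⟩
        refine (IsLocallyPlanar.isBoundaryEdge_or hPL haP).resolve_right ?_
        rintro ⟨Q, hQ, hne, haQ⟩
        obtain ⟨⟨P', hP', rfl⟩, -⟩ := subset_affected hpieces hL hQ
        exact hnc (mem_collapsedEdges_of_mem_of_mem hK hP hP' hne.symm haP haQ)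
    · rintro (⟨ha, hwa⟩ | ⟨Q, ⟨⟨P, hP, rfl⟩, hQ⟩, ha, hwa⟩)
      · refine ⟨hwa, Or.inl ha, ?_⟩
        rintro ⟨L, hL, R, ⟨hRL, haR⟩, -⟩
        exact notMem_affected_of_mem_copyEdges haR ha (subset_affected hpieces hL hRL)
      · refine ⟨hwa, Or.inr ⟨mem_crossEdges_of_mem_class3 hP ha, fun hc => hQ
          ⟨⟨P, hP, rfl⟩, _, hc, ha⟩⟩, ?_⟩
        rintro ⟨L, hL, R, ⟨hRL, haR⟩, -⟩
        have hR := subset_affected hpieces hL hRL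
        have hR' := hR
        obtain ⟨⟨P', hP', rfl⟩, -⟩ := hR'
        exact hQ (hshare P hP P' hP' (fun h => hQ (h ▸ hR)) a ha haR)
  have hcopyfin : {a ∈ c.copyEdges | w ∈ a}.Finite := by
    refine (hETfin.image (Sym2.map c.proj)).subset ?_
    rintro _ ⟨⟨x, y, -, -, h, rfl⟩, -⟩
    exact ⟨_, h, rfl⟩
  rw [hset, Set.ncard_union_eq ?_ hcopyfin
    (hU.biUnion fun Q hQ => (hQfin Q hQ).subset fun a ha => ha.1)]
  · refine (even_ncard_copyEdges hK w).add (even_ncard_biUnion hU ?_ ?_ ?_)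
    · exact fun Q hQ => (hQfin Q hQ).subset fun a ha => ha.1
    · rintro _ ⟨⟨P, hP, rfl⟩, -⟩
      by_cases hw : w ∈ polygonVertices (c.image P)
      · rw [two_edges_image hK hP hw]
        exact even_two
      · have : {a ∈ c.image P | w ∈ a} = ∅ :=
          Set.eq_empty_iff_forall_notMem.2 fun a ha => hw ⟨a, ha.1, ha.2⟩
        rw [this, Set.ncard_empty]
        exact Even.zero
    · rintro _ ⟨⟨P, hP, rfl⟩, hQ⟩ _ ⟨⟨P', hP', rfl⟩, -⟩ hne
      rw [Set.disjoint_left]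
      rintro a ⟨ha, -⟩ ⟨ha', -⟩
      exact hQ (hshare P hP P' hP' hne a ha ha')
  · rw [Set.disjoint_left]
    rintro a ⟨ha, -⟩ ha'
    obtain ⟨Q, ⟨⟨P, hP, rfl⟩, -⟩, haP, -⟩ := Set.mem_iUnion₂.1 ha'
    exact Set.disjoint_left.1 disjoint_copyEdges_crossEdges ha
      (mem_crossEdges_of_mem_class3 hP haP)

end Pieces

end CombinatorialChange

end PolyComplex

namespace PolyComplex

variable {V : Type*} {K : PolyComplex V}

/-! ### Paths in the Euler transformation -/

/-- There is a path of edges from the set `E`. -/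
abbrev Linked (E : Set (Sym2 V)) : V → V → Prop :=
  Relation.ReflTransGen fun x y => s(x, y) ∈ E

lemma Linked.symm {E : Set (Sym2 V)} {x y : V} (h : Linked E x y) : Linked E y x :=
  reflTransGen_symm h

lemma Linked.of_mem {E : Set (Sym2 V)} {x y : V} (h : s(x, y) ∈ E) : Linked E x y :=
  Relation.ReflTransGen.single h

lemma Linked.map {W : Type*} {E : Set (Sym2 V)} {F : Set (Sym2 W)} (φ : V → W)
    (hφ : ∀ x y, s(x, y) ∈ E → Linked F (φ x) (φ y)) {x y : V} (h : Linked E x y) :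
    Linked F (φ x) (φ y) := by
  induction h with
  | refl => exact Relation.ReflTransGen.refl
  | tail _ h ih => exact ih.trans (hφ _ _ h)

lemma linked_copy {P : Set (Sym2 V)} (hP : P ∈ K) (hc : IsConnectedPolygon P) {x y : V}
    (hx : x ∈ polygonVertices P) (hy : y ∈ polygonVertices P) :
    Linked (eulerTransform K).edges (some P, x) (some P, y) :=
  Linked.map (F := (eulerTransform K).edges) (fun x => ((some P, x) : ETVertex V))
    (fun _ _ h => Linked.of_mem (Set.mem_sUnion_of_mem (mem_copyPolygon.2 ⟨rfl, rfl, h⟩)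
      (copyPolygon_mem hP))) (hc x hx y hy)

lemma linked_sides {e : Sym2 V} {x : V} (hx : x ∈ e) {s t : Option (Set (Sym2 V))}
    (hs : s ∈ sides K e) (ht : t ∈ sides K e) :
    Linked (eulerTransform K).edges (s, x) (t, x) := by
  rcases eq_or_ne s t with rfl | hne
  · exact Relation.ReflTransGen.refl
  · exact Linked.of_mem (mk_mem_eulerTransform_edges.2 (Or.inr ⟨hne, rfl, e, hx, hs, ht⟩))

lemma linked_of_share {P Q : Set (Sym2 V)} (hP : P ∈ K) (hQ : Q ∈ K) (hPc : IsConnectedPolygon P)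
    (hQc : IsConnectedPolygon Q) {e : Sym2 V} (heP : e ∈ P) (heQ : e ∈ Q) {x y : V}
    (hx : x ∈ polygonVertices P) (hy : y ∈ polygonVertices Q) :
    Linked (eulerTransform K).edges (some P, x) (some Q, y) := by
  induction e with | _ u v
  have hu := Sym2.mem_mk_left u v
  exact ((linked_copy hP hPc hx ⟨_, heP, hu⟩).trans (linked_sides hu (some_mem_sides.2 ⟨hP, heP⟩)
    (some_mem_sides.2 ⟨hQ, heQ⟩))).trans (linked_copy hQ hQc ⟨_, heQ, hu⟩ hy)

lemma linked_fan {P Q : Set (Sym2 V)} {v : V} (hQ : Q ∈ fan K v P) :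
    Linked (eulerTransform K).edges (some P, v) (some Q, v) := by
  induction hQ with
  | refl => exact Relation.ReflTransGen.refl
  | tail _ h ih =>
    obtain ⟨hP, hQ, e, heP, heQ, hv⟩ := h
    exact ih.trans (linked_sides hv (some_mem_sides.2 ⟨hP, heP⟩) (some_mem_sides.2 ⟨hQ, heQ⟩))

lemma isConnectedPolygon_copyPolygon {f : Set (Sym2 V)} (hf : IsConnectedPolygon f) :
    IsConnectedPolygon (copyPolygon f) := by
  rintro ⟨s, x⟩ ⟨a, ha, ⟨r, x'⟩, rfl⟩ ⟨t, y⟩ ⟨b, hb, ⟨r', y'⟩, rfl⟩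
  obtain ⟨rfl, -, h⟩ := mem_copyPolygon.1 ha
  obtain ⟨rfl, -, h'⟩ := mem_copyPolygon.1 hb
  exact Linked.map (fun x => ((some f, x) : ETVertex V)) (fun _ _ h => Linked.of_mem
    (mem_copyPolygon.2 ⟨rfl, rfl, h⟩)) (hf x ⟨_, h, Sym2.mem_mk_left _ _⟩ y
      ⟨_, h', Sym2.mem_mk_left _ _⟩)

lemma mem_of_mem_polygonVertices_edgePolygon {e : Sym2 V} {x : ETVertex V}
    (hx : x ∈ polygonVertices (edgePolygon K e)) : x.1 ∈ sides K e ∧ x.2 ∈ e := by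
  obtain ⟨a, ha, y, rfl⟩ := hx
  obtain ⟨hs, -, ⟨-, rfl⟩ | ⟨-, -, h⟩⟩ := mem_edgePolygon.1 ha
  exacts [⟨hs, Sym2.mem_mk_left _ _⟩, ⟨hs, h⟩]

lemma isConnectedPolygon_edgePolygon (e : Sym2 V) : IsConnectedPolygon (edgePolygon K e) := by
  rintro ⟨s, x⟩ hx ⟨t, y⟩ hy
  obtain ⟨hs, hx⟩ := mem_of_mem_polygonVertices_edgePolygon hx
  obtain ⟨ht, hy⟩ := mem_of_mem_polygonVertices_edgePolygon hy
  simp only at hs hx ht hy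
  have h1 : Linked (edgePolygon K e) (s, x) (t, x) := by
    rcases eq_or_ne s t with rfl | hne
    · exact Relation.ReflTransGen.refl
    · exact Linked.of_mem (mem_edgePolygon.2 ⟨hs, ht, Or.inr ⟨hne, rfl, hx⟩⟩)
  have h2 : Linked (edgePolygon K e) (t, x) (t, y) := by
    rcases eq_or_ne x y with rfl | hne
    · exact Relation.ReflTransGen.refl
    · exact Linked.of_mem (mem_edgePolygon.2 ⟨ht, ht, Or.inl ⟨rfl,
        (Sym2.mem_and_mem_iff hne).1 ⟨hx, hy⟩⟩⟩)
  exact h1.trans h2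

lemma exists_side_of_mem_vertices {x : ETVertex V} (hx : x ∈ (eulerTransform K).vertices) :
    ∃ e, x.2 ∈ e ∧ x.1 ∈ sides K e := by
  obtain ⟨a, ha, y, rfl⟩ := hx
  rcases mk_mem_eulerTransform_edges.1 ha with ⟨-, h⟩ | ⟨-, -, e, he, hs, -⟩
  exacts [⟨_, Sym2.mem_mk_left _ _, h⟩, ⟨e, he, hs⟩]

lemma exists_linked_of_mem_vertices {x : ETVertex V} (hx : x ∈ (eulerTransform K).vertices) :
    ∃ P ∈ K, x.2 ∈ polygonVertices P ∧ Linked (eulerTransform K).edges (some P, x.2) x := by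
  obtain ⟨e, he, hs⟩ := exists_side_of_mem_vertices hx
  obtain ⟨P, hP, heP⟩ := mem_edges_of_mem_sides hs
  exact ⟨P, hP, ⟨e, heP, he⟩, linked_sides he (some_mem_sides.2 ⟨hP, heP⟩) hs⟩

lemma mem_polygonVertices_copyPolygon {f : Set (Sym2 V)} {v : V} (hv : v ∈ polygonVertices f) :
    ((some f, v) : ETVertex V) ∈ polygonVertices (copyPolygon f) := by
  obtain ⟨e, he, u, rfl⟩ := hv
  exact ⟨s((some f, v), (some f, u)), mem_copyPolygon.2 ⟨rfl, rfl, he⟩, Sym2.mem_mk_left _ _⟩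

/-! ### The generalized Euler transformation of a connected complex is connected -/

section GenEuler

variable (hc : ∀ P ∈ K, IsConnectedPolygon P)
include hc

lemma linked_copy_edgePolygon {f : Set (Sym2 V)} (hf : f ∈ K) {e : Sym2 V} (he : e ∈ f)
    {x y : ETVertex V} (hx : x ∈ polygonVertices (copyPolygon f))
    (hy : y ∈ polygonVertices (edgePolygon K e)) :
    Linked (genEulerTransform K).edges (some (copyPolygon f), x) (some (edgePolygon K e), y) := by
  have hs : some f ∈ sides K e := some_mem_sides.2 ⟨hf, he⟩
  induction e with | _ u v
  exact linked_of_share (copyPolygon_mem hf) (edgePolygon_mem ⟨f, hf, he⟩)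
    (isConnectedPolygon_copyPolygon (hc f hf)) (isConnectedPolygon_edgePolygon _)
    (e := s((some f, u), (some f, v))) (mem_copyPolygon.2 ⟨rfl, rfl, he⟩)
    (mem_edgePolygon.2 ⟨hs, hs, Or.inl ⟨rfl, rfl⟩⟩) hx hy

/-- The quadrangle of the common edge serves as a bridge: it shares an edge with each of the two
Class 1 polygons. -/
lemma linked_copy_copy {f g : Set (Sym2 V)} (hf : f ∈ K) (hg : g ∈ K) {e : Sym2 V} (hef : e ∈ f)
    (heg : e ∈ g) {u v : V} (hu : u ∈ polygonVertices f) (hv : v ∈ polygonVertices g) :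
    Linked (genEulerTransform K).edges (some (copyPolygon f), (some f, u))
      (some (copyPolygon g), (some g, v)) := by
  have hs : some f ∈ sides K e := some_mem_sides.2 ⟨hf, hef⟩
  induction e with | _ a b
  have hx : ((some f, a) : ETVertex V) ∈ polygonVertices (edgePolygon K s(a, b)) :=
    ⟨s((some f, a), (some f, b)), mem_edgePolygon.2 ⟨hs, hs, Or.inl ⟨rfl, rfl⟩⟩,
      Sym2.mem_mk_left _ _⟩
  exact (linked_copy_edgePolygon hc hf hef (mem_polygonVertices_copyPolygon hu) hx).trans
    (linked_copy_edgePolygon hc hg heg (mem_polygonVertices_copyPolygon hv) hx).symm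

lemma linked_copy_fan {f g : Set (Sym2 V)} {v : V} (hg : g ∈ fan K v f) : Linked (genEulerTransform K).edges
      (some (copyPolygon f), (some f, v)) (some (copyPolygon g), (some g, v)) := by
  induction hg with
  | refl => exact Relation.ReflTransGen.refl
  | tail _ h ih =>
    obtain ⟨hP, hQ, e, heP, heQ, hve⟩ := h
    exact ih.trans (linked_copy_copy hc hP hQ heP heQ ⟨e, heP, hve⟩ ⟨e, heQ, hve⟩)

/-- The unaltered vertices are connected to the copies of the polygons at them. -/
lemma linked_copy_unaltered {f : Set (Sym2 V)} (hf : f ∈ K) {v : V}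
    (hv : v ∈ polygonVertices f)
    (hb : ∃ g ∈ fan K v f, ∃ e ∈ g, v ∈ e ∧ IsBoundaryEdge K e) {u : V}
    (hu : u ∈ polygonVertices f) :
    Linked (genEulerTransform K).edges (some (copyPolygon f), (some f, u)) (none, (none, v)) := by
  obtain ⟨g, hg, e, he, ⟨w, rfl⟩, hb⟩ := hb
  have hgK := mem_of_mem_fan hf hg
  have hs := none_mem_sides.2 hb
  have hmem : s(((none, v) : ETVertex V), (none, w)) ∈ edgePolygon K s(v, w) :=
    mem_edgePolygon.2 ⟨hs, hs, Or.inl ⟨rfl, rfl⟩⟩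
  have hside := IsLocallyPlanar.sides_of_fst_eq_none (K := K) (x := (none, v)) (y := (none, w)) rfl
    rfl hmem
  have h1 := linked_copy (copyPolygon_mem hf) (isConnectedPolygon_copyPolygon (hc f hf))
    (mem_polygonVertices_copyPolygon hu) (mem_polygonVertices_copyPolygon hv)
  have h2 := linked_copy_fan hc hg
  have h3 := linked_copy_edgePolygon hc hgK he
    (mem_polygonVertices_copyPolygon (mem_polygonVertices_of_mem_fan hv hg))
    ⟨_, hmem, Sym2.mem_mk_left _ _⟩
  -- The unaltered edge has the quadrangle on one side and nothing on the other, so the second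
  -- transformation joins the quadrangle's copy of the vertex to the vertex itself.
  have h4 : Linked (genEulerTransform K).edges (some (edgePolygon K s(v, w)), (none, v))
      (none, (none, v)) :=
    linked_sides (Sym2.mem_mk_left (none, v) (none, w)) (hside ▸ Set.mem_insert _ _)
      (hside ▸ Set.mem_insert_of_mem _ rfl)
  exact ((h1.trans h2).trans h3).trans h4

/-- Each vertex of the generalized Euler transformation is connected to the copy of a polygon. -/
lemma exists_linked_copy (hK : K.IsLocallyPlanar) {z : ETVertex (ETVertex V)}
    (hz : z ∈ (genEulerTransform K).vertices) :
    ∃ f ∈ K, ∃ v ∈ polygonVertices f,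
      Linked (genEulerTransform K).edges (some (copyPolygon f), (some f, v)) z := by
  obtain ⟨P, hP, hx, h⟩ := exists_linked_of_mem_vertices hz
  rcases hP with (⟨f, hf, rfl⟩ | ⟨e, ⟨f, hf, he⟩, rfl⟩) | ⟨h3, f, hf, v, hv, rfl⟩
  · have hx' := hx
    obtain ⟨a, ha, y, rfl⟩ := hx'
    obtain ⟨-, -, h'⟩ := mem_copyPolygon.1 ha
    have hv : z.2.2 ∈ polygonVertices f := ⟨_, h', Sym2.mem_mk_left _ _⟩
    exact ⟨f, hf, _, hv, (linked_copy (copyPolygon_mem hf) (isConnectedPolygon_copyPolygon (hc f hf))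
      (mem_polygonVertices_copyPolygon hv) hx).trans h⟩
  · have hv : e.out.1 ∈ polygonVertices f := ⟨e, he, Sym2.out_fst_mem e⟩
    exact ⟨f, hf, _, hv, (linked_copy_edgePolygon hc hf he (mem_polygonVertices_copyPolygon hv)
      hx).trans h⟩
  -- A Class 3 polygon is reached from `f` through the quadrangle of an edge of `f` at `v`, with
  -- which it shares a crossing edge.
  · refine ⟨f, hf, v, hv, Relation.ReflTransGen.trans ?_ h⟩
    obtain ⟨e, he, hve⟩ := hv
    have hs : some f ∈ sides K e := some_mem_sides.2 ⟨hf, he⟩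
    obtain ⟨t, ht, hts⟩ := exists_ne_of_pair (hK.two_sides ⟨f, hf, he⟩) (some f)
    have h1 : s(((some f, v) : ETVertex V), (t, v)) ∈ edgePolygon K e :=
      mem_edgePolygon.2 ⟨hs, ht, Or.inr ⟨hts.symm, rfl, hve⟩⟩
    have h2 : s(((some f, v) : ETVertex V), (t, v)) ∈ vertexPolygon K v f :=
      IsLocallyPlanar.mem_vertexPolygon_of_sides he hve hts.symm hs ht
    exact (linked_copy_edgePolygon hc hf he (mem_polygonVertices_copyPolygon ⟨e, he, hve⟩)
      ⟨_, h1, Sym2.mem_mk_left _ _⟩).trans (linked_of_share (edgePolygon_mem ⟨f, hf, he⟩)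
        (Or.inr ⟨h3, f, hf, v, ⟨e, he, hve⟩, rfl⟩) (isConnectedPolygon_edgePolygon e)
        (isConnectedPolygon_vertexPolygon hf) h1 h2 ⟨_, h1, Sym2.mem_mk_left _ _⟩ hx)

end GenEuler

/-! ### The Euler transformation of a mesh is connected -/

namespace IsMesh

variable (hK : K.IsMesh)
include hK

/-- Polygons in different fans at `v` are linked through the unaltered copy of `v`, since each of
the fans has a boundary edge there. -/
lemma linked_of_mem_of_mem {P Q : Set (Sym2 V)} (hP : P ∈ K) (hQ : Q ∈ K) {v : V}
    (hvP : v ∈ polygonVertices P) (hvQ : v ∈ polygonVertices Q) :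
    Linked (eulerTransform K).edges (some P, v) (some Q, v) := by
  by_cases hfan : Q ∈ fan K v P
  · exact linked_fan hfan
  · have hnone : ∀ {P Q}, P ∈ K → Q ∈ K → v ∈ polygonVertices P → v ∈ polygonVertices Q →
        Q ∉ fan K v P → Linked (eulerTransform K).edges (some P, v) (none, v) := by
      intro P Q hP hQ hvP hvQ hfan
      obtain ⟨R, hR, e, he, hve, hb⟩ := hK.fan_boundary P hP Q hQ v hvP hvQ hfan
      exact (linked_fan hR).trans (linked_sides hve (some_mem_sides.2 ⟨mem_of_mem_fan hP hR, he⟩)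
        (none_mem_sides.2 hb))
    exact (hnone hP hQ hvP hvQ hfan).trans
      (hnone hQ hP hvQ hvP (fun h => hfan (fan_symm h))).symm

theorem linked_eulerTransform {x y : ETVertex V} (hx : x ∈ (eulerTransform K).vertices)
    (hy : y ∈ (eulerTransform K).vertices) : Linked (eulerTransform K).edges x y := by
  obtain ⟨P, hP, hxP, h⟩ := exists_linked_of_mem_vertices hx
  obtain ⟨Q, hQ, hyQ, h'⟩ := exists_linked_of_mem_vertices hy
  refine h.symm.trans (Relation.ReflTransGen.trans ?_ h')
  have hchain := hK.chain P hP Q hQ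
  clear h h'
  have key : ∀ R, Relation.ReflTransGen (fun P Q => P ∈ K ∧ Q ∈ K ∧
      (polygonVertices P ∩ polygonVertices Q).Nonempty) P R → R ∈ K → ∀ z ∈ polygonVertices R,
      Linked (eulerTransform K).edges (some P, x.2) (some R, z) := by
    intro R hR
    induction hR with
    | refl => exact fun hR z hz => linked_copy hR (hK.connected_polygon _ hR) hxP hz
    | tail _ h ih =>
      intro hR z hz
      obtain ⟨hS, -, v, hvS, hvR⟩ := h
      exact ((ih hS v hvS).trans (hK.linked_of_mem_of_mem hS hR hvS hvR)).trans
        (linked_copy hR (hK.connected_polygon _ hR) hvR hz)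
  exact key Q hchain hQ _ hyQ

end IsMesh

end PolyComplex

namespace PolyComplex

variable {V : Type*}

/-! ### Criterion for an Eulerian 1-skeleton -/

section Skeleton

variable {F : PolyComplex V}

lemma skeleton_adj {x y : F.vertices} :
    F.skeleton.Adj x y ↔ s(x.1, y.1) ∈ F.edges ∧ x.1 ≠ y.1 := by
  simp [skeleton, SimpleGraph.fromEdgeSet_adj]

lemma mem_vertices_of_mk_mem {x y : V} (h : s(x, y) ∈ F.edges) : y ∈ F.vertices :=
  ⟨_, h, Sym2.mem_mk_right x y⟩

lemma reachable_of_linked {x : F.vertices} {y : V} (h : Linked F.edges x y) :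
    ∃ hy : y ∈ F.vertices, F.skeleton.Reachable x ⟨y, hy⟩ := by
  induction h with
  | refl => exact ⟨x.2, .rfl⟩
  | @tail z y _ h ih =>
    obtain ⟨hz, ih⟩ := ih
    refine ⟨mem_vertices_of_mk_mem h, ?_⟩
    rcases eq_or_ne z y with rfl | hne
    · exact ih
    · exact ih.trans (SimpleGraph.Adj.reachable (skeleton_adj.2 ⟨h, hne⟩))

lemma finite_vertices (hF : F.edges.Finite) : F.vertices.Finite := by
  have : F.vertices = ⋃ e ∈ F.edges, {v | v ∈ e} := by
    ext v
    simp [vertices]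
  rw [this]
  refine hF.biUnion fun e _ => ?_
  induction e with | _ x y
  exact (Set.toFinite {x, y}).subset fun z hz => by simpa using hz

theorem isEulerianGraph_skeleton (hfin : F.edges.Finite) (hne : F.vertices.Nonempty)
    (hdiag : ∀ e ∈ F.edges, ¬ e.IsDiag) (heven : ∀ x, Even {y | s(x, y) ∈ F.edges}.ncard)
    (hlink : ∀ x ∈ F.vertices, ∀ y ∈ F.vertices, Linked F.edges x y) :
    IsEulerianGraph F.skeleton := by
  classical
  have := (finite_vertices hfin).to_subtype
  have := Fintype.ofFinite F.vertices
  have := hne.to_subtype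
  have hconn : F.skeleton.Connected :=
    ⟨fun x y => (reachable_of_linked (hlink x x.2 y y.2)).2⟩
  have hdeg : ∀ v, Even (F.skeleton.neighborSet v).ncard := by
    intro v
    convert heven v.1 using 1
    rw [← Set.ncard_image_of_injective _ Subtype.val_injective]
    congr 1
    ext y
    constructor
    · rintro ⟨y, hy, rfl⟩
      exact (skeleton_adj.1 hy).1
    · intro h
      exact ⟨⟨y, mem_vertices_of_mk_mem h⟩, skeleton_adj.2
        ⟨h, fun he => hdiag _ h (Sym2.mk_isDiag_iff.2 he)⟩, rfl⟩
  refine ⟨hconn, fun v => ⟨Set.toFinite _, hdeg v⟩, ?_⟩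
  obtain ⟨v, p, hp⟩ := hconn.exists_isEulerian _ fun v => by
    rw [← SimpleGraph.card_neighborSet_eq_degree, ← Nat.card_eq_fintype_card, Nat.card_coe_set_eq]
    exact hdeg v
  refine ⟨v, p, ?_⟩
  convert hp

end Skeleton

/-! ### The edges of a complex with replaced pieces -/

section Replace

variable {K k L M : PolyComplex V} {pieces : Set (PolyComplex V)}

lemma place_unaltered (w : V) : place L (none, (none, w)) = Sum.inl w := by simp [place]

lemma place_eq_inl {x : ETVertex (ETVertex V)} {w : V} :
    place L x = Sum.inl w ↔ x = (none, (none, w)) := by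
  obtain ⟨s, t, v⟩ := x
  by_cases h : s = none ∧ t = none
  · obtain ⟨rfl, rfl⟩ := h
    simp [place]
  · simp only [place, if_neg h, reduceCtorEq, Prod.mk.injEq, false_iff]
    tauto

lemma place_eq_inr {x z : ETVertex (ETVertex V)} :
    place L x = Sum.inr (M, z) ↔ L = M ∧ x = z ∧ ¬ (z.1 = none ∧ z.2.1 = none) := by
  by_cases h : x.1 = none ∧ x.2.1 = none
  · simp only [place, if_pos h, reduceCtorEq, false_iff]
    rintro ⟨-, rfl, hz⟩
    exact hz h
  · simp only [place, if_neg h, Sum.inr.injEq, Prod.mk.injEq]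
    constructor
    · rintro ⟨rfl, rfl⟩
      exact ⟨rfl, rfl, h⟩
    · exact fun h => ⟨h.1, h.2.1⟩

lemma place_injective : Function.Injective (place L) := by
  intro x y h
  rcases hy : place L y with w | ⟨M, z⟩
  · rw [place_eq_inl.1 (h.trans hy), place_eq_inl.1 hy]
  · rw [(place_eq_inr.1 (h.trans hy)).2.1, (place_eq_inr.1 hy).2.1]

lemma edges_replace : edges (replace K k pieces) = Sym2.map Sum.inl '' edges (K \ k) ∪
    ⋃ L ∈ pieces, Sym2.map (place L) '' (genEulerTransform L).edges := by
  ext a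
  simp only [edges, replace, Set.mem_sUnion, Set.mem_union, Set.mem_image, Set.mem_iUnion]
  constructor
  · rintro ⟨_, ⟨P, hP, rfl⟩ | ⟨L, hL, P, hP, rfl⟩, a, ha, rfl⟩
    · exact Or.inl ⟨a, ⟨P, hP, ha⟩, rfl⟩
    · exact Or.inr ⟨L, hL, a, ⟨P, hP, ha⟩, rfl⟩
  · rintro (⟨a, ⟨P, hP, ha⟩, rfl⟩ | ⟨L, hL, a, ⟨P, hP, ha⟩, rfl⟩)
    · exact ⟨_, Or.inl ⟨P, hP, rfl⟩, a, ha, rfl⟩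
    · exact ⟨_, Or.inr ⟨L, hL, P, hP, rfl⟩, a, ha, rfl⟩

lemma mk_mem_edges_replace {p q : ReplVertex V} : s(p, q) ∈ edges (replace K k pieces) ↔
    (∃ w u, s(w, u) ∈ edges (K \ k) ∧ Sum.inl w = p ∧ Sum.inl u = q) ∨
    ∃ L ∈ pieces, ∃ x y, s(x, y) ∈ (genEulerTransform L).edges ∧ place L x = p ∧
      place L y = q := by
  rw [edges_replace]
  simp only [Set.mem_union, Set.mem_image, Set.mem_iUnion]
  constructor
  · rintro (⟨a, ha, h⟩ | ⟨L, hL, a, ha, h⟩)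
    · induction a with | _ w u
      rcases Sym2.eq_iff.1 h with ⟨h1, h2⟩ | ⟨h1, h2⟩
      · exact Or.inl ⟨w, u, ha, h1, h2⟩
      · exact Or.inl ⟨u, w, Sym2.eq_swap ▸ ha, h2, h1⟩
    · induction a with | _ x y
      rcases Sym2.eq_iff.1 h with ⟨h1, h2⟩ | ⟨h1, h2⟩
      · exact Or.inr ⟨L, hL, x, y, ha, h1, h2⟩
      · exact Or.inr ⟨L, hL, y, x, Sym2.eq_swap ▸ ha, h2, h1⟩
  · rintro (⟨w, u, h, rfl, rfl⟩ | ⟨L, hL, x, y, h, rfl, rfl⟩)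
    · exact Or.inl ⟨_, h, rfl⟩
    · exact Or.inr ⟨L, hL, _, h, rfl⟩

lemma linked_inl {w u : V} (h : s(w, u) ∈ edges (K \ k)) :
    Linked (replace K k pieces).edges (Sum.inl w) (Sum.inl u) :=
  Linked.of_mem (mk_mem_edges_replace.2 (Or.inl ⟨w, u, h, rfl, rfl⟩))

lemma linked_place (hL : L ∈ pieces) {x y : ETVertex (ETVertex V)}
    (h : Linked (genEulerTransform L).edges x y) :
    Linked (replace K k pieces).edges (place L x) (place L y) :=
  h.map (place L) fun x y h =>
    Linked.of_mem (mk_mem_edges_replace.2 (Or.inr ⟨L, hL, x, y, h, rfl, rfl⟩))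

/-- The neighbors of an unaltered vertex in a generalized Euler transformation. -/
lemma IsLocallyPlanar.unaltered_mk_mem (hL : L.IsLocallyPlanar) {w : V}
    {y : ETVertex (ETVertex V)} :
    s((none, (none, w)), y) ∈ (genEulerTransform L).edges ↔ ∃ u, IsBoundaryEdge L s(w, u) ∧
      (y = (none, (none, u)) ∨ y = (some (edgePolygon L s(w, u)), (none, w))) := by
  have hside : ∀ u, IsBoundaryEdge L s(w, u) → sides (eulerTransform L) s((none, w), (none, u)) =
      {some (edgePolygon L s(w, u)), none} := fun u hu =>
    sides_of_fst_eq_none rfl rfl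
      (mem_edgePolygon.2 ⟨none_mem_sides.2 hu, none_mem_sides.2 hu, Or.inl ⟨rfl, rfl⟩⟩)
  obtain ⟨s, t, v⟩ := y
  rw [genEulerTransform, mk_mem_eulerTransform_edges]
  constructor
  · rintro (⟨h1, h2⟩ | ⟨h1, h2, e, he, hs, ht⟩)
    · simp only at h1 h2
      subst h1
      obtain ⟨-, h, hb⟩ := hL.isBoundaryEdge_eulerTransform.1 (none_mem_sides.1 h2)
      simp only at h hb
      subst h
      exact ⟨v, hb, Or.inl rfl⟩
    · simp only [Prod.mk.injEq] at h1 h2 he hs ht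
      obtain ⟨rfl, rfl⟩ := h2
      obtain ⟨⟨r, u⟩, rfl⟩ := he
      obtain ⟨-, h, hb⟩ := hL.isBoundaryEdge_eulerTransform.1 (none_mem_sides.1 hs)
      simp only at h hb
      subst h
      rw [hside u hb] at ht
      rcases ht with rfl | rfl
      · exact ⟨u, hb, Or.inr rfl⟩
      · exact absurd rfl h1
  · rintro ⟨u, hb, h | h⟩
    · cases h
      refine Or.inl ⟨rfl, ?_⟩
      simp only [hside _ hb]
      exact Or.inr rfl
    · cases h
      refine Or.inr ⟨by simp, rfl, s((none, w), (none, u)), Sym2.mem_mk_left _ _, ?_⟩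
      simp only [hside u hb]
      exact ⟨Or.inr rfl, Or.inl rfl⟩

/-- The new vertices have even degree. -/
lemma even_neighbors_inr (hpieces : ∀ L ∈ pieces, L.IsLocallyPlanar)
    (z : PolyComplex V × ETVertex (ETVertex V)) :
    Even {q | s(Sum.inr z, q) ∈ (replace K k pieces).edges}.ncard := by
  obtain ⟨L, z⟩ := z
  -- The other elements of the right summand stand for no vertex and have no neighbours.
  by_cases h : L ∈ pieces ∧ ¬ (z.1 = none ∧ z.2.1 = none)
  · obtain ⟨hL, hz⟩ := h
    have : {q | s(Sum.inr (L, z), q) ∈ (replace K k pieces).edges} =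
        place L '' {y | s(z, y) ∈ (genEulerTransform L).edges} := by
      ext q
      simp only [Set.mem_ofPred_eq, mk_mem_edges_replace, Set.mem_image]
      constructor
      · rintro (⟨w, u, -, h, -⟩ | ⟨M, hM, x, y, hxy, h, rfl⟩)
        · cases h
        · obtain ⟨rfl, rfl, -⟩ := place_eq_inr.1 h
          exact ⟨y, hxy, rfl⟩
      · rintro ⟨y, hy, rfl⟩
        exact Or.inr ⟨L, hL, z, y, hy, place_eq_inr.2 ⟨rfl, rfl, hz⟩, rfl⟩
    rw [this, Set.ncard_image_of_injective _ place_injective]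
    exact (hpieces L hL).isTwoSided_eulerTransform.even_neighbors z
  · have : {q | s(Sum.inr (L, z), q) ∈ (replace K k pieces).edges} = ∅ := by
      ext q
      simp only [Set.mem_ofPred_eq, mk_mem_edges_replace, Set.mem_empty_iff_false, iff_false]
      rintro (⟨w, u, -, h, -⟩ | ⟨M, hM, x, y, hxy, h', rfl⟩)
      · cases h
      · obtain ⟨rfl, rfl, hz⟩ := place_eq_inr.1 h'
        exact h ⟨hM, hz⟩
    rw [this, Set.ncard_empty]
    exact Even.zero

/-- An old vertex has even degree if it is on an even number of remaining edges that are not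
boundary edges of a piece: each boundary edge brings along one new edge. -/
lemma even_neighbors_inl (hpieces : ∀ L ∈ pieces, L.IsLocallyPlanar)
    (hdisj : ∀ L ∈ pieces, ∀ M ∈ pieces, ∀ a ∈ edges L, a ∈ edges M → L = M)
    (hfin : (replace K k pieces).edges.Finite) (w : V)
    (heven : Even {a | w ∈ a ∧ a ∈ edges (K \ k) ∧ ¬ ∃ L ∈ pieces, IsBoundaryEdge L a}.ncard) :
    Even {q | s(Sum.inl w, q) ∈ (replace K k pieces).edges}.ncard := by
  classical
  let A := {a | w ∈ a ∧ a ∈ edges (K \ k) ∧ ¬ ∃ L ∈ pieces, IsBoundaryEdge L a}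
  let B := {a | w ∈ a ∧ ∃ L ∈ pieces, IsBoundaryEdge L a}
  -- Edge-disjointness makes the piece with boundary edge `a` unique; the value for other edges
  -- plays no role.
  let piece : Sym2 V → PolyComplex V := fun a =>
    if h : ∃ L ∈ pieces, IsBoundaryEdge L a then h.choose else ∅
  have hmem : ∀ {L : PolyComplex V} {a}, IsBoundaryEdge L a → a ∈ edges L := by
    rintro L a ⟨P, ⟨hP, ha⟩, -⟩
    exact ⟨P, hP, ha⟩
  have hpiece : ∀ {a L}, L ∈ pieces → IsBoundaryEdge L a → piece a = L := by
    intro a L hL hb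
    have h : ∃ L ∈ pieces, IsBoundaryEdge L a := ⟨L, hL, hb⟩
    simp only [piece, dif_pos h]
    exact hdisj _ h.choose_spec.1 _ hL a (hmem h.choose_spec.2) (hmem hb)
  let φ : Sym2 V → ReplVertex V := fun a => Sum.inl (otherEnd w a)
  let ψ : Sym2 V → ReplVertex V := fun a =>
    Sum.inr (piece a, (some (edgePolygon (piece a) a), (none, w)))
  have hφ : Set.InjOn φ {a | w ∈ a} := fun a ha b hb h =>
    otherEnd_injOn w ha hb (Sum.inl_injective h)
  have hψ : Set.InjOn ψ B := by
    rintro a ⟨-, L, hL, hb⟩ b - h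
    simp only [ψ, Sum.inr.injEq, Prod.mk.injEq, Option.some.injEq, and_true] at h
    obtain ⟨h1, h2⟩ := h
    rw [← h1, hpiece hL hb] at h2
    exact edgePolygon_injective (hmem hb) h2
  -- A boundary edge of a piece may also be a remaining edge. Counting it only in `B` makes the
  -- three parts disjoint, and `B` enters twice: through the edge itself and through the new edge it
  -- brings along.
  have hN : {q | s(Sum.inl w, q) ∈ (replace K k pieces).edges} = φ '' A ∪ (φ '' B ∪ ψ '' B) := by
    ext q
    simp only [Set.mem_ofPred_eq, mk_mem_edges_replace]
    constructor
    · rintro (⟨w', u, h, h', rfl⟩ | ⟨L, hL, x, y, h, hx, rfl⟩)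
      · obtain rfl := Sum.inl_injective h'
        by_cases hb : ∃ L ∈ pieces, IsBoundaryEdge L s(w', u)
        · exact Or.inr (Or.inl ⟨_, ⟨Sym2.mem_mk_left _ _, hb⟩, by simp only [φ, otherEnd_mk]⟩)
        · exact Or.inl ⟨_, ⟨Sym2.mem_mk_left _ _, h, hb⟩, by simp only [φ, otherEnd_mk]⟩
      · obtain rfl := place_eq_inl.1 hx
        obtain ⟨u, hb, rfl | rfl⟩ := (hpieces L hL).unaltered_mk_mem.1 h
        · exact Or.inr (Or.inl ⟨_, ⟨Sym2.mem_mk_left _ _, L, hL, hb⟩, by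
            simp only [φ, otherEnd_mk, place_unaltered]⟩)
        · refine Or.inr (Or.inr ⟨_, ⟨Sym2.mem_mk_left _ _, L, hL, hb⟩, ?_⟩)
          simp only [ψ, hpiece hL hb]
          exact (place_eq_inr.2 ⟨rfl, rfl, by simp⟩).symm
    · rintro (⟨a, ⟨⟨u, rfl⟩, h, -⟩, rfl⟩ | ⟨a, ⟨⟨u, rfl⟩, L, hL, hb⟩, rfl⟩ |
        ⟨a, ⟨⟨u, rfl⟩, L, hL, hb⟩, rfl⟩)
      · exact Or.inl ⟨w, u, h, rfl, by simp only [φ, otherEnd_mk]⟩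
      · refine Or.inr ⟨L, hL, _, _, (hpieces L hL).unaltered_mk_mem.2 ⟨u, hb, Or.inl rfl⟩,
          place_unaltered w, ?_⟩
        simp only [φ, otherEnd_mk, place_unaltered]
      · refine Or.inr ⟨L, hL, _, _, (hpieces L hL).unaltered_mk_mem.2 ⟨u, hb, Or.inr rfl⟩,
          place_unaltered w, ?_⟩
        simp only [ψ, hpiece hL hb]
        exact place_eq_inr.2 ⟨rfl, rfl, by simp⟩
  have hfinN : {q | s(Sum.inl w, q) ∈ (replace K k pieces).edges}.Finite :=
    Set.Finite.preimage (fun a _ b _ h => Sym2.congr_right.1 h) hfin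
  rw [hN, Set.finite_union, Set.finite_union] at hfinN
  have hBfin : B.Finite := hfinN.2.2.of_finite_image hψ
  rw [hN, Set.ncard_union_eq ?_ hfinN.1 (hfinN.2.1.union hfinN.2.2),
    (hφ.mono fun a ha => ha.1).ncard_image]
  · refine heven.add (even_ncard_of_two_parts hBfin φ ψ (hφ.mono fun a ha => ha.1) hψ ?_ rfl)
    exact fun _ _ _ _ h => by cases h
  · rw [Set.disjoint_left]
    rintro _ ⟨a, ha, rfl⟩ (⟨b, hb, h⟩ | ⟨b, hb, h⟩)
    · exact ha.2.2 (hφ hb.1 ha.1 h ▸ hb.2)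
    · cases h

end Replace

end PolyComplex

/-! ### Connectedness after the replacement and conclusion -/

namespace PolyComplex

variable {V : Type*} {K : PolyComplex V}

lemma IsTwoSided.not_isDiag_eulerTransform (hK : K.IsTwoSided) :
    ∀ e ∈ (eulerTransform K).edges, ¬ e.IsDiag := by
  intro e he hd
  induction e with | _ x y
  obtain rfl := Sym2.mk_isDiag_iff.1 hd
  rcases mk_mem_eulerTransform_edges.1 he with ⟨-, h⟩ | ⟨h, -⟩
  · exact hK.not_isDiag _ (mem_edges_of_mem_sides h) (Sym2.mk_isDiag_iff.2 rfl)
  · exact h rfl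

namespace CombinatorialChange

variable {c : CombinatorialChange K} {pieces : Set (PolyComplex c.Vertex)}

section Mesh

variable (hK : K.IsMesh)
include hK

lemma exists_of_mk_mem_sdiff {w u : c.Vertex}
    (h : s(w, u) ∈ edges (c.eulerTransform \ c.affected)) :
    ∃ x ∈ (PolyComplex.eulerTransform K).vertices, c.proj x = w := by
  have : ∃ x y, s(x, y) ∈ (PolyComplex.eulerTransform K).edges ∧
      s(w, u) = s(c.proj x, c.proj y) := by
    rw [edges_sdiff_affected hK] at h
    rcases h with ⟨x, y, -, -, h, he⟩ | ⟨⟨x, y, -, h, he⟩, -⟩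
    exacts [⟨x, y, h, he⟩, ⟨x, y, h, he⟩]
  obtain ⟨x, y, hxy, he⟩ := this
  rcases Sym2.eq_iff.1 he with ⟨rfl, rfl⟩ | ⟨rfl, rfl⟩
  · exact ⟨x, ⟨_, hxy, Sym2.mem_mk_left _ _⟩, rfl⟩
  · exact ⟨y, ⟨_, hxy, Sym2.mem_mk_right _ _⟩, rfl⟩

lemma finite_edges_sdiff : (edges (c.eulerTransform \ c.affected)).Finite := by
  refine (hK.isTwoSided.finite_eulerTransform_edges.image (Sym2.map c.proj)).subset ?_
  rw [edges_sdiff_affected hK]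
  rintro a (⟨x, y, -, -, h, rfl⟩ | ⟨⟨x, y, -, h, rfl⟩, -⟩)
  exacts [⟨_, h, rfl⟩, ⟨_, h, rfl⟩]

omit hK in
lemma not_isDiag_sdiff : ∀ a ∈ edges (c.eulerTransform \ c.affected), ¬ a.IsDiag := by
  rintro a ⟨_, ⟨⟨-, P, -, rfl⟩, -⟩, ha⟩
  exact ha.2

variable (hpieces : IsEdgeDisjointDecomposition c.affected pieces)
include hpieces

lemma isLocallyPlanar_piece {L : PolyComplex c.Vertex} (hL : L ∈ pieces) : L.IsLocallyPlanar :=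
  (isLocallyPlanar_affected hK).mono (subset_affected hpieces hL)

lemma finite_edges_replace : (edges (replace c.eulerTransform c.affected pieces)).Finite := by
  have hfin : pieces.Finite := (isLocallyPlanar_affected hK).finite.finite_subsets.subset
    fun L hL => subset_affected hpieces hL
  rw [edges_replace]
  exact ((finite_edges_sdiff hK).image _).union (hfin.biUnion fun L hL =>
    (isLocallyPlanar_piece hK hpieces hL).isTwoSided_eulerTransform.finite_eulerTransform_edges.image
      _)

lemma not_isDiag_replace :
    ∀ a ∈ edges (replace c.eulerTransform c.affected pieces), ¬ a.IsDiag := by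
  intro a ha hd
  induction a with | _ p q
  obtain rfl := Sym2.mk_isDiag_iff.1 hd
  rcases mk_mem_edges_replace.1 ha with ⟨w, u, h, rfl, h'⟩ | ⟨L, hL, x, y, h, rfl, h'⟩
  · obtain rfl := Sum.inl_injective h'
    exact not_isDiag_sdiff _ h (Sym2.mk_isDiag_iff.2 rfl)
  · obtain rfl := place_injective h'
    exact (isLocallyPlanar_piece hK hpieces hL).isTwoSided_eulerTransform.not_isDiag_eulerTransform
      _ h (Sym2.mk_isDiag_iff.2 rfl)

/-- The vertices of a replaced polygon remain connected to its copies. -/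
lemma linked_copy_inl {L : PolyComplex c.Vertex} (hL : L ∈ pieces) {Q : Set (Sym2 c.Vertex)}
    (hQ : Q ∈ L) {u w : c.Vertex} (hu : u ∈ polygonVertices Q) (hw : w ∈ polygonVertices Q) :
    Linked (replace c.eulerTransform c.affected pieces).edges
      (place L (some (copyPolygon Q), (some Q, u))) (Sum.inl w) := by
  have hsub := subset_affected hpieces hL
  have h := linked_copy_unaltered (K := L)
    (fun P hP => isConnectedPolygon_of_mem_affected (hsub hP)) hQ hw
    (exists_boundary_fan hK hsub hQ hw) hu
  have h := linked_place (K := c.eulerTransform) (k := c.affected) hL h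
  rwa [place_unaltered] at h

lemma linked_of_mem_affected {Q : Set (Sym2 c.Vertex)} (hQ : Q ∈ c.affected) {u w : c.Vertex}
    (hu : u ∈ polygonVertices Q) (hw : w ∈ polygonVertices Q) :
    Linked (replace c.eulerTransform c.affected pieces).edges (Sum.inl u) (Sum.inl w) := by
  obtain ⟨L, hL, hQL⟩ := exists_piece hpieces hQ
  exact (linked_copy_inl hK hpieces hL hQL hu hu).symm.trans
    (linked_copy_inl hK hpieces hL hQL hu hw)

/-- An edge either survives, shrinks to a point, or is an edge to which a quadrangle has collapsed.
In the last case its end points lie on a replaced polygon and are linked through the transformed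
piece. -/
lemma linked_proj_of_mem {x y : ETVertex V} (h : s(x, y) ∈ (PolyComplex.eulerTransform K).edges) :
    Linked (replace c.eulerTransform c.affected pieces).edges (Sum.inl (c.proj x))
      (Sum.inl (c.proj y)) := by
  have hE := edges_sdiff_affected (c := c) hK
  by_cases hxy : x.1 = y.1
  · by_cases hp : c.proj x = c.proj y
    · rw [hp]
    · exact linked_inl (hE ▸ Or.inl ⟨x, y, hxy, hp, h, rfl⟩)
  · by_cases ha : s(c.proj x, c.proj y) ∈ c.collapsedEdges
    · obtain ⟨P, hP, hmem⟩ := exists_class3_of_cross hK hxy h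
      have hmem := mk_mem_image (c := c) hmem hxy
      exact linked_of_mem_affected hK hpieces ⟨⟨P, hP, rfl⟩, _, ha, hmem⟩
        ⟨_, hmem, Sym2.mem_mk_left _ _⟩ ⟨_, hmem, Sym2.mem_mk_right _ _⟩
    · exact linked_inl (hE ▸ Or.inr ⟨⟨x, y, hxy, h, rfl⟩, ha⟩)

lemma linked_proj {x y : ETVertex V} (hx : x ∈ (PolyComplex.eulerTransform K).vertices)
    (hy : y ∈ (PolyComplex.eulerTransform K).vertices) :
    Linked (replace c.eulerTransform c.affected pieces).edges (Sum.inl (c.proj x))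
      (Sum.inl (c.proj y)) :=
  (hK.linked_eulerTransform hx hy).map (fun x => Sum.inl (c.proj x))
    fun _ _ h => linked_proj_of_mem hK hpieces h

/-- Each new vertex is linked to a copy of a polygon of its piece, and this to the old vertices of
the polygon, which come from the Euler transformation of `K`. -/
lemma exists_linked_proj {p : ReplVertex c.Vertex}
    (hp : p ∈ (replace c.eulerTransform c.affected pieces).vertices) :
    ∃ x ∈ (PolyComplex.eulerTransform K).vertices,
      Linked (replace c.eulerTransform c.affected pieces).edges (Sum.inl (c.proj x)) p := by
  obtain ⟨a, ha, q, rfl⟩ := hp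
  rcases mk_mem_edges_replace.1 ha with ⟨w, u, h, rfl, -⟩ | ⟨L, hL, z, y, h, rfl, -⟩
  · obtain ⟨x, hx, rfl⟩ := exists_of_mk_mem_sdiff hK h
    exact ⟨x, hx, .refl⟩
  · have hsub := subset_affected hpieces hL
    obtain ⟨Q, hQ, v, hv, hlink⟩ := exists_linked_copy
      (fun P hP => isConnectedPolygon_of_mem_affected (hsub hP))
      (isLocallyPlanar_piece hK hpieces hL) ⟨_, h, Sym2.mem_mk_left _ _⟩
    have hv' := hv
    obtain ⟨⟨P, hP, hPQ⟩, -⟩ := hsub hQ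
    rw [hPQ] at hv'
    obtain ⟨b, hb, q', rfl⟩ := hv'
    obtain ⟨-, x, x', hx, rfl, -⟩ := mem_image_iff.1 hb
    exact ⟨x, ⟨_, ⟨P, Or.inr hP, hx⟩, Sym2.mem_mk_left _ _⟩,
      (linked_copy_inl hK hpieces hL hQ hv hv).symm.trans (linked_place hL hlink)⟩

omit hpieces in
lemma nonempty_vertices_replace :
    (replace c.eulerTransform c.affected pieces).vertices.Nonempty := by
  obtain ⟨f, hf⟩ := hK.nonempty
  obtain ⟨e, he, hec⟩ : (f \ c.collapsed f).Nonempty := by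
    rw [← Set.encard_pos]
    exact lt_of_lt_of_le (by norm_num) (c.three_le f hf)
  induction e with | _ u v
  have hs : some f ∈ sides K s(u, v) := some_mem_sides.2 ⟨hf, he⟩
  refine ⟨Sum.inl (c.proj (some f, u)), _, mk_mem_edges_replace.2 (Or.inl ⟨_, c.proj (some f, v),
    ?_, rfl, rfl⟩), Sym2.mem_mk_left _ _⟩
  rw [edges_sdiff_affected hK]
  exact Or.inl ⟨(some f, u), (some f, v), rfl,
    fun h => hec (mem_collapsed_of_proj_eq hK hf he h),
    mk_mem_eulerTransform_edges.2 (Or.inl ⟨rfl, hs⟩), rfl⟩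

theorem isEulerianGraph_replace :
    IsEulerianGraph (replace c.eulerTransform c.affected pieces).skeleton := by
  have hlp : ∀ L ∈ pieces, L.IsLocallyPlanar := fun L hL => isLocallyPlanar_piece hK hpieces hL
  have hfin := finite_edges_replace hK hpieces
  refine isEulerianGraph_skeleton hfin (nonempty_vertices_replace hK)
    (not_isDiag_replace hK hpieces) ?_ ?_
  · rintro (w | z)
    · exact even_neighbors_inl hlp (fun L hL M hM a ha ha' => piece_eq hpieces hL hM ha ha') hfin w
        (even_ncard_remaining hpieces hK w)
    · exact even_neighbors_inr hlp z
  · intro p hp q hq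
    obtain ⟨x, hx, h⟩ := exists_linked_proj hK hpieces hp
    obtain ⟨y, hy, h'⟩ := exists_linked_proj hK hpieces hq
    exact (h.symm.trans (linked_proj hK hpieces hx hy)).trans h'

end Mesh

end CombinatorialChange

end PolyComplex

theorem mainTheorem8 (K : PlaneComplex) (H : Set PlanePolygon) (hK : IsInputMesh K H)
    (c : PolyComplex.CombinatorialChange K.toPolyComplex)
    (pieces : Set (PolyComplex c.Vertex))
    (hpieces : PolyComplex.IsEdgeDisjointDecomposition c.affected pieces) :
    IsEulerianGraph
      (PolyComplex.replace c.eulerTransform c.affected pieces).skeleton :=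
  PolyComplex.CombinatorialChange.isEulerianGraph_replace (PlaneComplex.isMesh hK) hpieces
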